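/- Setting. Let $\Delta$ be a finite ranked signature and $G$ a linear monadic context-free tree grammar over $\Delta$ (nonterminals of rank $0$ or $1$; the variable occurs at most once in a right-hand side), with tree language $\mathbf T=L(G)$. A context is a tree with exactly one hole $X$; heights are normalised so that constants have height $1$ and $X$ has height $0$. Let $\mathrm{yd}$ be a projective yield: each $f$ of rank $n$ has strings $u_0,\dots,u_n$, and $\mathrm{yd}(f(t_1,\dots,t_n))=u_0\,\mathrm{yd}(t_1)\,u_1\cdots \mathrm{yd}(t_n)\,u_n$; the yield of a context is the string generated to the left of the hole followed by the one generated to its right. Let $h$ be a linear nondeleting tree homomorphism into terms of the graph algebra $\mathsf{HR}_k$ of finite edge-labelled multigraphs with $k$ source names (constants, parallel composition, forgetting and renaming of sources), and let $\mathrm{graph}(t)$ be the value of $h(t)$ (for a context, the hole is valued as the empty graph). String tokens are $a,b,c,d$, $\bar a,\bar b,\bar c,\bar d$ and the brackets $\langle,\rangle$. Let $A=\{a\langle^i\bar a^i\rangle^i: i\ge 0\}$, let $B,C,D$ be the analogous languages for $b,c,d$, and $\mathsf{CSD}_s=\bigcup_{n,m\ge1}A^nB^mC^nD^m$. Assume that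 for every $t\in\mathbf T$ the string $\mathrm{yd}(t)$ is in $\mathsf{CSD}_s$ and $\mathrm{graph}(t)$ has, for each $z\in\{a,b,c,d,\bar a,\bar b,\bar c,\bar d\}$, exactly as many $z$-labelled edges as $\mathrm{yd}(t)$ has $z$-tokens. (This holds in particular if the pairs $(\mathrm{yd}(t),\mathrm{graph}(t))$, $t\in\mathbf T$, form a relation $\mathsf{CSD}$ between the strings of $\mathsf{CSD}_s$ and graphs with one $z$-edge for each $z$-token.) For a tree or context $u$ let $n^u_z$ be the number of $z$-tokens of its yield, $e^u_z$ the number of $z$-edges of its graph, and $r^u_z$ the length of the rightmost maximal nonempty run of $z$-tokens in its yield ($0$ if there is none). A number $p$ is a pumping height of $\mathbf T$ if every $t\in\mathbf T$ of height greater than $p$ can be written $t=C_1[C_2[C_3[C_4[t_5]]]]$ with $\mathrm{ht}(C_2[C_3[C_4]])\le p$, $\mathrm{ht}(C_2)+\mathrm{ht}(C_4)>0$, and $C_1[v^i[t_5]]\in\mathbf T$ for all $i\ge0$, where $v^0=C_3$ and $v^{i+1}=C_2[v^i[C_4]]$. For such a $p$ let $l_0$ be a number such that every context of height at most $p$ generates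 at most $l_0$ string tokens and at most $l_0$ edges (for instance the least such number). For $(x,y)\in\mathsf{Sep}=\{(a,c),(c,a),(b,d),(d,b)\}$, an $x,y,l$-separation of $t$ is a decomposition $t=D_x[D_0[t_y]]$ into contexts $D_x,D_0$ and a tree $t_y$ with $n^{D_x}_y=0$, $n^{D_0}_x\le l$ and $n^{t_y}_x=0$; it is minimal if $\mathrm{ht}(D_0)$ is least among all $x,y,l$-separations of $t$. Claim. Such $p$ and $l_0$ exist, and for all such $p$ and $l_0$, all $(x,y)\in\mathsf{Sep}$ and all $t\in\mathbf T$: 1. For every $x,y,l_0$-separation $t=D_x[D_0[t_y]]$, with $t_0=D_0[t_y]$, $$e^{t_0}_{\bar x}\le n^{t_0}_{\bar x}+n^t_x\,l_0 .$$ 2. If $t$ has an $x,y,l_0$-separation, then it has a minimal $x,y,l_0$-separation $t=D_x[D_0[t_y]]$ such that, with $t_0=D_0[t_y]$, $$e^{t_0}_{\bar y}\ge n^t_{\bar y}-n^t_x\,l_0-r^t_{\bar y}.$$ -/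

import Mathlib

/-! ## Ranked trees and one-hole contexts -/

/-- A ranked signature. -/
structure Signature where
  Sym : Type
  rank : Sym → ℕ

/-- Trees over a signature. -/
inductive RTree (Δ : Signature) : Type
  | node (f : Δ.Sym) (ts : Fin (Δ.rank f) → RTree Δ) : RTree Δ

/-- Contexts: trees with exactly one hole `X`. `node f i ts c` has the root symbol `f`, the
context `c` at the child `i` and the tree `ts j _` at every other child `j`. -/
inductive Ctx (Δ : Signature) : Type
  | hole : Ctx Δ
  | node (f : Δ.Sym) (i : Fin (Δ.rank f)) (ts : ∀ j : Fin (Δ.rank f), j ≠ i → RTree Δ)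
      (c : Ctx Δ) : Ctx Δ

/-- Height of a tree; a constant has height `1`. -/
def RTree.height {Δ : Signature} : RTree Δ → ℕ
  | .node _ ts => 1 + Finset.univ.sup fun i => (ts i).height

/-- Height of a context; the trivial context `X` has height `0`. -/
def Ctx.height {Δ : Signature} : Ctx Δ → ℕ
  | .hole => 0
  | .node _ i ts c =>
      1 + Finset.univ.sup fun j => if hj : j = i then c.height else (ts j hj).height

/-- `C[t]`. -/
def Ctx.plug {Δ : Signature} : Ctx Δ → RTree Δ → RTree Δ
  | .hole, t => t
  | .node f i ts c, t => .node f fun j => if hj : j = i then c.plug t else ts j hj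

/-- `C[C']`, again a context. -/
def Ctx.comp {Δ : Signature} : Ctx Δ → Ctx Δ → Ctx Δ
  | .hole, c' => c'
  | .node f i ts c, c' => .node f i ts (c.comp c')

/-! ## Linear monadic context-free tree grammars -/

/-- Right-hand sides and sentential forms: trees over the signature, nonterminals of rank `0`
(`N₀`) and of rank `1` (`N₁`), and the variable `x`. -/
inductive SForm (Δ : Signature) (N₀ N₁ : Type) : Type
  | var : SForm Δ N₀ N₁
  | term (f : Δ.Sym) (ts : Fin (Δ.rank f) → SForm Δ N₀ N₁) : SForm Δ N₀ N₁
  | nt0 (A : N₀) : SForm Δ N₀ N₁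
  | nt1 (B : N₁) (s : SForm Δ N₀ N₁) : SForm Δ N₀ N₁

/-- Number of occurrences of the variable. -/
def SForm.varCount {Δ : Signature} {N₀ N₁ : Type} : SForm Δ N₀ N₁ → ℕ
  | .var => 1
  | .term _ ts => ∑ i, (ts i).varCount
  | .nt0 _ => 0
  | .nt1 _ s => s.varCount

/-- Substitution of `u` for the variable. -/
def SForm.subst {Δ : Signature} {N₀ N₁ : Type} :
    SForm Δ N₀ N₁ → SForm Δ N₀ N₁ → SForm Δ N₀ N₁
  | .var, u => u
  | .term f ts, u => .term f fun i => (ts i).subst u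
  | .nt0 A, _ => .nt0 A
  | .nt1 B s, u => .nt1 B (s.subst u)

/-- A tree as a sentential form. -/
def RTree.toSForm {Δ : Signature} {N₀ N₁ : Type} : RTree Δ → SForm Δ N₀ N₁
  | .node f ts => .term f fun i => (ts i).toSForm

/-- A linear monadic context-free tree grammar: finitely many nonterminals, all of rank `0` or
`1`, and finitely many rules `A → r` and `B(x) → r`, where `x` occurs at most once in the `r` of
a rule of the second kind and not at all in the `r` of a rule of the first kind. -/
structure LMCFTG (Δ : Signature) where
  N₀ : Type
  N₁ : Type
  finite_N₀ : Finite N₀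
  finite_N₁ : Finite N₁
  start : N₀
  rules₀ : Set (N₀ × SForm Δ N₀ N₁)
  rules₁ : Set (N₁ × SForm Δ N₀ N₁)
  finite_rules₀ : rules₀.Finite
  finite_rules₁ : rules₁.Finite
  closed₀ : ∀ r ∈ rules₀, r.2.varCount = 0
  linear₁ : ∀ r ∈ rules₁, r.2.varCount ≤ 1

/-- One rewriting step. -/
inductive LMCFTG.Step {Δ : Signature} (G : LMCFTG Δ) :
    SForm Δ G.N₀ G.N₁ → SForm Δ G.N₀ G.N₁ → Prop
  | rule₀ (A : G.N₀) (r : SForm Δ G.N₀ G.N₁) : (A, r) ∈ G.rules₀ → G.Step (.nt0 A) r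
  | rule₁ (B : G.N₁) (r s : SForm Δ G.N₀ G.N₁) :
      (B, r) ∈ G.rules₁ → G.Step (.nt1 B s) (r.subst s)
  | inTerm (f : Δ.Sym) (ts : Fin (Δ.rank f) → SForm Δ G.N₀ G.N₁) (i : Fin (Δ.rank f))
      (u : SForm Δ G.N₀ G.N₁) :
      G.Step (ts i) u → G.Step (.term f ts) (.term f (Function.update ts i u))
  | inNt1 (B : G.N₁) (s u : SForm Δ G.N₀ G.N₁) :
      G.Step s u → G.Step (.nt1 B s) (.nt1 B u)

/-- The tree language `L(G)`. -/
def LMCFTG.language {Δ : Signature} (G : LMCFTG Δ) : Set (RTree Δ) :=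
  {t | Relation.ReflTransGen G.Step (.nt0 G.start) t.toSForm}

/-! ## Tokens and projective yields -/

/-- The core letters `a, b, c, d`. -/
inductive Core : Type
  | a | b | c | d
  deriving DecidableEq

/-- String tokens: core letters `z`, barred letters `z̄`, and the brackets `⟨` and `⟩`. -/
inductive Token : Type
  | core (z : Core)
  | bar (z : Core)
  | lbr
  | rbr
  deriving DecidableEq

/-- A projective (context-free) yield: a symbol `f` of rank `n` comes with strings `u₀, …, uₙ`,
and the yield of `f(t₁, …, tₙ)` is `u₀ w₁ u₁ w₂ u₂ ⋯ wₙ uₙ`, where `wᵢ` is the yield of `tᵢ`. -/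
structure ProjYield (Δ : Signature) where
  pieces : ∀ f : Δ.Sym, Fin (Δ.rank f + 1) → List Token

/-- The yield of a tree. -/
def ProjYield.tree {Δ : Signature} (yd : ProjYield Δ) : RTree Δ → List Token
  | .node f ts =>
      yd.pieces f 0 ++ (List.finRange (Δ.rank f)).flatMap fun j =>
        yd.tree (ts j) ++ yd.pieces f j.succ

/-- The string that a context generates on the left of its hole. -/
def ProjYield.left {Δ : Signature} (yd : ProjYield Δ) : Ctx Δ → List Token
  | .hole => []
  | .node f i ts c =>
      yd.pieces f 0 ++ ((List.finRange (Δ.rank f)).flatMap fun j =>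
        if hj : j < i then yd.tree (ts j (ne_of_lt hj)) ++ yd.pieces f j.succ else []) ++
      yd.left c

/-- The string that a context generates on the right of its hole. -/
def ProjYield.right {Δ : Signature} (yd : ProjYield Δ) : Ctx Δ → List Token
  | .hole => []
  | .node f i ts c =>
      yd.right c ++ yd.pieces f i.succ ++ (List.finRange (Δ.rank f)).flatMap fun j =>
        if hj : i < j then yd.tree (ts j (ne_of_gt hj)) ++ yd.pieces f j.succ else []

/-- The yield of a context. -/
def ProjYield.ctx {Δ : Signature} (yd : ProjYield Δ) (C : Ctx Δ) : List Token :=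
  yd.left C ++ yd.right C

/-! ## The graph algebra with `k` sources -/

/-- Finite directed multigraphs with edge labels in `L` and (partially defined) sources named
by `Fin k`. -/
structure SGraph (k : ℕ) (L : Type) where
  V : Type
  E : Type
  finite_V : Finite V
  finite_E : Finite E
  src : E → V
  tgt : E → V
  label : E → L
  source : Fin k → Option V

namespace SGraph

variable {k : ℕ} {L : Type}

/-- The empty graph. -/
def empty : SGraph k L where
  V := Empty
  E := Empty
  finite_V := inferInstance
  finite_E := inferInstance
  src := Empty.elim
  tgt := Empty.elim
  label := Empty.elim
  source := fun _ => none

/-- The pairs of nodes that a parallel composition identifies: sources of the same name. -/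
def Fuse (G H : SGraph k L) (u v : G.V ⊕ H.V) : Prop :=
  ∃ (i : Fin k) (a : G.V) (b : H.V),
    G.source i = some a ∧ H.source i = some b ∧ u = Sum.inl a ∧ v = Sum.inr b

/-- Parallel composition: disjoint union with sources of the same name identified. -/
def par (G H : SGraph k L) : SGraph k L where
  V := Quot (Fuse G H)
  E := G.E ⊕ H.E
  finite_V := by
    have := G.finite_V
    have := H.finite_V
    infer_instance
  finite_E := by
    have := G.finite_E
    have := H.finite_E
    infer_instance
  src := Sum.elim (fun e => Quot.mk _ (Sum.inl (G.src e))) (fun e => Quot.mk _ (Sum.inr (H.src e)))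
  tgt := Sum.elim (fun e => Quot.mk _ (Sum.inl (G.tgt e))) (fun e => Quot.mk _ (Sum.inr (H.tgt e)))
  label := Sum.elim G.label H.label
  source := fun i =>
    ((G.source i).map fun a => Quot.mk _ (Sum.inl a)).or
      ((H.source i).map fun b => Quot.mk _ (Sum.inr b))

/-- The source name `i` is forgotten (the node stays). -/
def forget (i : Fin k) (G : SGraph k L) : SGraph k L :=
  { G with source := Function.update G.source i none }

/-- Renaming of sources: the names `i` and `j` are exchanged. -/
def rename (i j : Fin k) (G : SGraph k L) : SGraph k L :=
  { G with source := fun m => G.source (Equiv.swap i j m) }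

/-- The number of edges with label `z`. -/
noncomputable def edgeCount (G : SGraph k L) (z : L) : ℕ :=
  Nat.card {e : G.E // G.label e = z}

/-- The number of all edges. -/
noncomputable def size (G : SGraph k L) : ℕ :=
  Nat.card G.E

end SGraph

/-- Terms over the graph algebra with `k` sources, with variables from `Fin n`. -/
inductive HRTerm (k : ℕ) (L : Type) (n : ℕ) : Type 1
  | var (i : Fin n) : HRTerm k L n
  | const (G : SGraph k L) : HRTerm k L n
  | par (s t : HRTerm k L n) : HRTerm k L n
  | forget (i : Fin k) (s : HRTerm k L n) : HRTerm k L n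
  | rename (i j : Fin k) (s : HRTerm k L n) : HRTerm k L n

/-- Number of occurrences of the variable `m`. -/
def HRTerm.occ {k : ℕ} {L : Type} {n : ℕ} (m : Fin n) : HRTerm k L n → ℕ
  | .var i => if i = m then 1 else 0
  | .const _ => 0
  | .par s t => s.occ m + t.occ m
  | .forget _ s => s.occ m
  | .rename _ _ s => s.occ m

/-- Evaluation in the graph algebra. -/
def HRTerm.eval {k : ℕ} {L : Type} {n : ℕ} (env : Fin n → SGraph k L) :
    HRTerm k L n → SGraph k L
  | .var i => env i
  | .const G => G
  | .par s t => (s.eval env).par (t.eval env)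
  | .forget i s => (s.eval env).forget i
  | .rename i j s => (s.eval env).rename i j

/-- A linear nondeleting tree homomorphism from trees over `Δ` to terms of the graph algebra. -/
structure HRHom (Δ : Signature) (k : ℕ) (L : Type) where
  image : ∀ f : Δ.Sym, HRTerm k L (Δ.rank f)
  linear : ∀ (f : Δ.Sym) (m : Fin (Δ.rank f)), (image f).occ m = 1

/-- The graph generated by a tree. -/
def HRHom.tree {Δ : Signature} {k : ℕ} {L : Type} (h : HRHom Δ k L) : RTree Δ → SGraph k L
  | .node f ts => (h.image f).eval fun i => h.tree (ts i)

/-- The graph generated by a context; the hole contributes the empty graph. -/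
def HRHom.ctx {Δ : Signature} {k : ℕ} {L : Type} (h : HRHom Δ k L) : Ctx Δ → SGraph k L
  | .hole => SGraph.empty
  | .node f i ts c =>
      (h.image f).eval fun j => if hj : j = i then h.ctx c else h.tree (ts j hj)

/-- The string-graph relation of a grammar, a projective yield and a homomorphism. -/
def rel {Δ : Signature} {k : ℕ} {L : Type} (G : LMCFTG Δ) (yd : ProjYield Δ) (h : HRHom Δ k L) :
    Set (List Token × SGraph k L) :=
  {P | ∃ t ∈ G.language, P = (yd.tree t, h.tree t)}

/-! ## Cross-serial dependencies -/

/-- The blocks `z ⟨ⁱ z̄ⁱ ⟩ⁱ` with `i ≥ 0`. -/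
def block (z : Core) : Language Token :=
  {w | ∃ i : ℕ, w = Token.core z :: (List.replicate i Token.lbr ++
    List.replicate i (Token.bar z) ++ List.replicate i Token.rbr)}

/-- The string language `AⁿBᵐCⁿDᵐ` (`n, m ≥ 1`) of cross-serial dependencies, where
`A, B, C, D` are the languages of blocks of the four letters. -/
def csdStrings : Language Token :=
  {w | ∃ n m : ℕ, 1 ≤ n ∧ 1 ≤ m ∧
    w ∈ block Core.a ^ n * block Core.b ^ m * block Core.c ^ n * block Core.d ^ m}

/-- The string-graph pairs whose string is in `csdStrings` and whose graph has exactly one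
`z`-edge for each `z`-token of the string, for each of the eight letters `z`. The edges may be
arranged in any way, and there may be edges with further labels in `Λ`. -/
def csdPairs (k : ℕ) (Λ : Type) : Set (List Token × SGraph k (Token ⊕ Λ)) :=
  {P | P.1 ∈ csdStrings ∧ ∀ z : Core,
    P.2.edgeCount (Sum.inl (Token.core z)) = P.1.count (Token.core z) ∧
    P.2.edgeCount (Sum.inl (Token.bar z)) = P.1.count (Token.bar z)}

/-- The pairs `a/c`, `c/a`, `b/d`, `d/b`. -/
def sepPairs : Set (Core × Core) :=
  {(Core.a, Core.c), (Core.c, Core.a), (Core.b, Core.d), (Core.d, Core.b)}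

/-! ## Pumping height and the constant bounding small contexts -/

/-- `v⁰ = C₃` and `vⁱ⁺¹ = C₂[vⁱ[C₄]]`. -/
def pump {Δ : Signature} (C₂ C₃ C₄ : Ctx Δ) : ℕ → Ctx Δ
  | 0 => C₃
  | i + 1 => C₂.comp ((pump C₂ C₃ C₄ i).comp C₄)

/-- `(C₁, C₂, C₃, C₄, t₅)` is a pumping decomposition of `t` in `T`, for the height `p`. -/
def IsPumpingDecomposition {Δ : Signature} (T : Set (RTree Δ)) (p : ℕ) (t : RTree Δ)
    (C₁ C₂ C₃ C₄ : Ctx Δ) (t₅ : RTree Δ) : Prop :=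
  t = C₁.plug (C₂.plug (C₃.plug (C₄.plug t₅))) ∧
  (C₂.comp (C₃.comp C₄)).height ≤ p ∧
  0 < C₂.height + C₄.height ∧
  ∀ i : ℕ, C₁.plug ((pump C₂ C₃ C₄ i).plug t₅) ∈ T

/-- `p` is a pumping height of `T`: all trees of `T` of height more than `p` have a pumping
decomposition. -/
def IsPumpingHeight {Δ : Signature} (T : Set (RTree Δ)) (p : ℕ) : Prop :=
  ∀ t ∈ T, p < t.height →
    ∃ (C₁ C₂ C₃ C₄ : Ctx Δ) (t₅ : RTree Δ), IsPumpingDecomposition T p t C₁ C₂ C₃ C₄ t₅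

/-- A context of height at most `p` generates at most `l` string tokens and at most `l` edges. -/
def IsGenerationBound {Δ : Signature} {k : ℕ} {L : Type} (yd : ProjYield Δ) (h : HRHom Δ k L)
    (p l : ℕ) : Prop :=
  ∀ C : Ctx Δ, C.height ≤ p → (yd.ctx C).length ≤ l ∧ (h.ctx C).size ≤ l

/-! ## Separations -/

/-- `t = Dx[D₀[ty]]` is an `x,y,l`-separation of `t`. -/
def IsSeparation {Δ : Signature} (yd : ProjYield Δ) (x y : Core) (l : ℕ) (t : RTree Δ)
    (Dx D₀ : Ctx Δ) (ty : RTree Δ) : Prop :=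
  t = Dx.plug (D₀.plug ty) ∧
  (yd.ctx Dx).count (Token.core y) = 0 ∧
  (yd.ctx D₀).count (Token.core x) ≤ l ∧
  (yd.tree ty).count (Token.core x) = 0

/-- `t` is `x,y,l`-separated. -/
def IsSeparated {Δ : Signature} (yd : ProjYield Δ) (x y : Core) (l : ℕ) (t : RTree Δ) : Prop :=
  ∃ (Dx D₀ : Ctx Δ) (ty : RTree Δ), IsSeparation yd x y l t Dx D₀ ty

/-- A separation is minimal if the height of its middle context is minimal. -/
def IsMinimalSeparation {Δ : Signature} (yd : ProjYield Δ) (x y : Core) (l : ℕ) (t : RTree Δ)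
    (Dx D₀ : Ctx Δ) (ty : RTree Δ) : Prop :=
  IsSeparation yd x y l t Dx D₀ ty ∧
  ∀ (Dx' D₀' : Ctx Δ) (ty' : RTree Δ),
    IsSeparation yd x y l t Dx' D₀' ty' → D₀.height ≤ D₀'.height

/-- The length of the rightmost maximal nonempty run of the token `z` in `w` (`0` if `z` does
not occur). -/
def lastRun (z : Token) (w : List Token) : ℕ :=
  ((w.reverse.dropWhile fun u => decide (u ≠ z)).takeWhile fun u => decide (u = z)).length

/-! Write `t = D[t₀]` with `D = Dx`. The whole tree has as many `z̄`-edges as `z̄`-tokens, so part 1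
says that the `x̄`-tokens of `D` exceed its `x̄`-edges by at most `n_x l₀`, and part 2 that `D` has
at most `n_x l₀ + r_ȳ` edges `ȳ`. Both are shown for every context `D` without `y` by induction on
the size of `t` (`context_induction`): a pumping decomposition of `t` is cut back to `C₁[C₃[t₅]]`,
and `exists_located` compares `D` with what is left of it. Either `t₀` is a piece of `C₂[C₃[C₄]]`
and hence small, or the hole of `D` is in one of seven positions (`Located`).

The pumped strings `s₁P₁ⁱs₂P₂ⁱs₃P₃ⁱs₄P₄ⁱs₅` are all cross-serial. In a prefix of such a string there
are at most as many closing brackets as bars and at most as many bars as opening brackets, with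
equality before each core letter and at the end. Comparing growth rates in `i` gives the same for
the `Pⱼ`. If a core letter `x` is pumped, `n_x` grows, and the extra `l₀` pays for everything that
is pumped. If `x̄` is pumped but `x` is not, then each `Pⱼ` with `x̄` is a power of `x̄`; since
brackets must balance, this can only be `P₂` or `P₃`, the strings of `C₄`, and `s₃` has no core
letter. As `D` has no `y`, the letters `y` are in `t₀`, so the hole of `D` is neither in `C₄` nor in
`t₅`. In the remaining positions `D` contains all pumped tokens and edges or none of the pumped
bars, which settles part 1 (`bars_le_edges_step`).

For part 2 the bound by `n_x l₀` plus the number of `ȳ` after the last `y` is not inductive, because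
inserting a new last `y` can make that number drop. `EdgeBound` therefore also measures the edges by
the closing brackets to the right of the hole minus the bars other than `ȳ` there. This excess is at
most the number of `ȳ` after the last `y` (`nR_le`), and a pumping step lowers it only when it is at
most the number of pumped bars, hence at most `l₀/2` (`Located.excess_le`); then the crude
alternative `2e ≤ 2A + l₀` holds. A later step with a pumped `y` adds `l₀` to the allowance: one
half covers this slack, the other the newly pumped edges (`edgeBound_step`). At the end the `ȳ`
after the last `y` form a single run (`barsAfterLast_le_lastRun`).

A pumping height exists because a high derivation tree has a long path of forms with strictly
decreasing minimal heights, on which a form repeats either at two trees or at two contexts with only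
contexts in between. A bound `l₀` exists because there are finitely many contexts of bounded height.
-/

/-! ## Combinatorics of the strings of cross-serial dependencies -/

/-- Position of a letter in the alphabetical order. -/
def Core.idx : Core → ℕ
  | .a => 0
  | .b => 1
  | .c => 2
  | .d => 3

theorem Core.idx_injective : Function.Injective Core.idx := by
  intro x y h
  cases x <;> cases y <;> simp_all [Core.idx]

/-- Position of a token inside a block. -/
def Token.phase : Token → ℕ
  | .core _ => 0
  | .lbr => 1
  | .bar _ => 2
  | .rbr => 3

/-- The letter of a token that is not a bracket. -/
def Token.letter : Token → Option Core
  | .core z => some z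
  | .bar z => some z
  | .lbr => none
  | .rbr => none

def Token.isBar : Token → Bool
  | .bar _ => true
  | _ => false

/-- Barred letters other than `ȳ`. -/
def Token.isBarNe (y : Core) : Token → Bool
  | .bar z => decide (z ≠ y)
  | _ => false

/-- Barred letters after `ȳ` in the alphabetical order. -/
def Token.isBarGt (y : Core) : Token → Bool
  | .bar z => decide (y.idx < z.idx)
  | _ => false

/-- Number of barred letters. -/
abbrev nBar (w : List Token) : ℕ := w.countP Token.isBar

abbrev nBarNe (y : Core) (w : List Token) : ℕ := w.countP (Token.isBarNe y)

abbrev nBarGt (y : Core) (w : List Token) : ℕ := w.countP (Token.isBarGt y)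

abbrev nL (w : List Token) : ℕ := w.count Token.lbr

abbrev nR (w : List Token) : ℕ := w.count Token.rbr

theorem nBar_eq (y : Core) (w : List Token) : nBar w = w.count (Token.bar y) + nBarNe y w := by
  induction w with
  | nil => rfl
  | cons p w ih =>
    simp only [nBar, nBarNe] at ih ⊢
    rw [List.countP_cons, List.countP_cons, List.count_cons, ih]
    rcases p with z | z | _ | _ <;> simp [Token.isBar, Token.isBarNe]
    by_cases h : z = y <;> simp [h] <;> omega

theorem nBarGt_le_nBarNe (y : Core) (w : List Token) : nBarGt y w ≤ nBarNe y w := by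
  apply List.countP_mono_left
  intro p _ h
  rcases p with z | z | _ | _ <;> simp_all [Token.isBarNe, Token.isBarGt]
  rintro rfl
  omega

theorem nBarGt_le_nBar (y : Core) (w : List Token) : nBarGt y w ≤ nBar w :=
  (nBarGt_le_nBarNe y w).trans (by rw [nBar_eq y w]; omega)

/-- Each bar is matched by a closing bracket. This factor 2 is what limits the pumped bars to half
of `l₀`. -/
theorem two_mul_nBar_le_length {w : List Token} (h : nR w = nBar w) : 2 * nBar w ≤ w.length := by
  have key : ∀ w : List Token, nR w + nBar w ≤ w.length := by
    intro w
    induction w with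
    | nil => simp
    | cons p w ih =>
      simp only [nBar, nR] at ih ⊢
      rw [List.countP_cons, List.count_cons, List.length_cons]
      rcases p with z | z | _ | _ <;> simp [Token.isBar] <;> omega
  have := key w
  omega

/-- A block as a list of tokens. -/
def blockList (p : Core × ℕ) : List Token :=
  Token.core p.1 :: (List.replicate p.2 Token.lbr ++ List.replicate p.2 (Token.bar p.1) ++
    List.replicate p.2 Token.rbr)

/-- The properties of the strings of cross-serial dependencies that matter below. -/
structure IsCrossSerial (w : List Token) : Prop where
  prefix_le : ∀ u v, w = u ++ v → nR u ≤ nBar u ∧ nBar u ≤ nL u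
  balanced_before_core : ∀ u z v, w = u ++ Token.core z :: v → nR u = nBar u ∧ nBar u = nL u
  balanced : nR w = nBar w ∧ nBar w = nL w
  letters_sorted : ∀ u v, w = u ++ v → ∀ p ∈ u, ∀ q ∈ v, ∀ z z', p.letter = some z →
    q.letter = some z' → z.idx ≤ z'.idx
  core_of_bar : ∀ u v, w = u ++ v → ∀ z, Token.bar z ∈ u → Token.core z ∈ u
  phase_sorted : ∀ u m v, w = u ++ m ++ v → (∀ z, Token.core z ∉ m) →
    m.Pairwise fun p q => p.phase ≤ q.phase
  count_a_c : w.count (Token.core Core.a) = w.count (Token.core Core.c)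
  count_b_d : w.count (Token.core Core.b) = w.count (Token.core Core.d)
  count_a_pos : 1 ≤ w.count (Token.core Core.a)
  count_b_pos : 1 ≤ w.count (Token.core Core.b)

theorem blockList_balanced (p : Core × ℕ) :
    nR (blockList p) = nBar (blockList p) ∧ nBar (blockList p) = nL (blockList p) := by
  simp [nR, nL, nBar, blockList, List.countP_replicate, List.count_replicate, Token.isBar]

theorem blockList_prefix_le {p : Core × ℕ} {u c : List Token} (h : blockList p = u ++ c) :
    nR u ≤ nBar u ∧ nBar u ≤ nL u := by
  have hu : u = (blockList p).take u.length := by rw [h]; simp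
  rw [hu]
  generalize u.length = n
  cases n with
  | zero => simp
  | succ n =>
    simp [nR, nL, nBar, blockList, List.take_append, List.take_replicate,
      List.countP_replicate, List.count_replicate, Token.isBar]

theorem blocks_prefix_le (L : List (Core × ℕ)) :
    ∀ u v, L.flatMap blockList = u ++ v → nR u ≤ nBar u ∧ nBar u ≤ nL u := by
  induction L with
  | nil =>
    intro u v h
    have : u = [] := by
      rcases u with _ | _
      · rfl
      · simp at h
    subst this
    simp
  | cons p L ih =>
    intro u v h
    rw [List.flatMap_cons, List.append_eq_append_iff] at h
    rcases h with ⟨a, rfl, h⟩ | ⟨c, h, rfl⟩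
    · have h1 := ih _ _ h
      have h2 := blockList_balanced p
      simp only [nR, nL, nBar, List.countP_append, List.count_append] at h1 h2 ⊢
      omega
    · exact blockList_prefix_le h

theorem blocks_balanced (L : List (Core × ℕ)) :
    nR (L.flatMap blockList) = nBar (L.flatMap blockList) ∧
      nBar (L.flatMap blockList) = nL (L.flatMap blockList) := by
  induction L with
  | nil => simp
  | cons p L ih =>
    have h2 := blockList_balanced p
    simp only [List.flatMap_cons, nR, nL, nBar, List.countP_append, List.count_append] at ih h2 ⊢
    omega

theorem core_mem_blockList {p : Core × ℕ} {u c : List Token} {z : Core}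
    (h : blockList p = u ++ Token.core z :: c) : u = [] := by
  rcases u with _ | ⟨q, u⟩
  · rfl
  · exfalso
    simp only [blockList, List.cons_append, List.cons.injEq] at h
    have : Token.core z ∈ u ++ Token.core z :: c := by simp
    rw [← h.2] at this
    simp [List.mem_replicate] at this

/-- A core letter occurs only at the beginning of a block, so what precedes it consists of complete
blocks. -/
theorem blocks_balanced_before_core (L : List (Core × ℕ)) :
    ∀ u z v, L.flatMap blockList = u ++ Token.core z :: v → nR u = nBar u ∧ nBar u = nL u := by
  induction L with
  | nil => intro u z v h; simp at h
  | cons p L ih =>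
    intro u z v h
    rw [List.flatMap_cons, List.append_eq_append_iff] at h
    rcases h with ⟨a, rfl, h⟩ | ⟨c, h, hv⟩
    · have h1 := ih _ _ _ h
      have h2 := blockList_balanced p
      simp only [nR, nL, nBar, List.countP_append, List.count_append] at h1 h2 ⊢
      omega
    · rcases c with _ | ⟨q, c⟩
      · rw [List.append_nil] at h
        rw [← h]
        exact blockList_balanced p
      · simp only [List.cons_append, List.cons.injEq] at hv
        rw [← hv.1] at h
        rw [core_mem_blockList h]
        simp

theorem blocks_core_of_bar (L : List (Core × ℕ)) :
    ∀ u v, L.flatMap blockList = u ++ v → ∀ z, Token.bar z ∈ u → Token.core z ∈ u := by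
  have hb : ∀ p : Core × ℕ, ∀ z, Token.bar z ∈ blockList p → z = p.1 := by
    intro p z h
    simp [blockList, List.mem_replicate] at h
    exact h.2
  induction L with
  | nil =>
    intro u v h z hz
    have h' : Token.bar z ∈ u ++ v := List.mem_append_left _ hz
    rw [← h] at h'
    simp at h'
  | cons p L ih =>
    intro u v h z hz
    rw [List.flatMap_cons, List.append_eq_append_iff] at h
    rcases h with ⟨a, rfl, h⟩ | ⟨c, h, hv⟩
    · rcases List.mem_append.1 hz with hz | hz
      · rw [hb p z hz]
        simp [blockList]
      · exact List.mem_append_right _ (ih _ _ h z hz)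
    · have h1 : z = p.1 := hb p z (by rw [h]; exact List.mem_append_left _ hz)
      rcases u with _ | ⟨q, u⟩
      · simp at hz
      · simp only [blockList, List.cons_append, List.cons.injEq] at h
        rw [h1, h.1]
        simp

theorem blocks_letters_sorted {L : List (Core × ℕ)}
    (hL : (L.map Prod.fst).Pairwise fun z z' => z.idx ≤ z'.idx) :
    (L.flatMap blockList).Pairwise fun p q => ∀ z z', p.letter = some z →
      q.letter = some z' → z.idx ≤ z'.idx := by
  have hb : ∀ p : Core × ℕ, ∀ q ∈ blockList p, ∀ z, q.letter = some z → z = p.1 := by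
    intro p q hq z hz
    simp only [blockList, List.mem_cons, List.mem_append, List.mem_replicate] at hq
    rcases hq with rfl | (⟨_, rfl⟩ | ⟨_, rfl⟩) | ⟨_, rfl⟩ <;> simp_all [Token.letter]
  rw [List.pairwise_flatMap]
  refine ⟨fun p _ => ?_, ?_⟩
  · apply List.pairwise_of_forall_mem_list
    intro q hq q' hq' z z' hz hz'
    rw [hb p q hq z hz, hb p q' hq' z' hz']
  · rw [List.pairwise_map] at hL
    refine hL.imp ?_
    intro p p' h q hq q' hq' z z' hz hz'
    rw [hb p q hq z hz, hb p' q' hq' z' hz']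
    exact h

/-- Every block begins with a core letter, so a segment without core letters stays inside one block.
-/
theorem blocks_phase_sorted (L : List (Core × ℕ)) : ∀ u m v, L.flatMap blockList = u ++ m ++ v →
    (∀ z, Token.core z ∉ m) → m.Pairwise fun p q => p.phase ≤ q.phase := by
  have hb : ∀ p : Core × ℕ, (blockList p).Pairwise fun p q => p.phase ≤ q.phase := by
    intro p
    simp only [blockList, List.pairwise_cons, List.pairwise_append, List.mem_append,
      List.mem_replicate, List.pairwise_replicate]
    refine ⟨?_, ⟨?_, ?_, ?_⟩, ?_, ?_⟩
    all_goals grind [Token.phase]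
  induction L with
  | nil =>
    intro u m v h _
    simp only [List.flatMap_nil, List.nil_eq, List.append_eq_nil_iff] at h
    rw [h.1.2]
    exact List.Pairwise.nil
  | cons p L ih =>
    intro u m v h hm
    rw [List.flatMap_cons, List.append_assoc, List.append_eq_append_iff] at h
    rcases h with ⟨a, rfl, h⟩ | ⟨c, h, hv⟩
    · rw [← List.append_assoc] at h
      exact ih _ _ _ h hm
    · rw [List.append_eq_append_iff] at hv
      rcases hv with ⟨a, hc, h2⟩ | ⟨a, rfl, h2⟩
      · have := hb p
        rw [h, hc, List.pairwise_append] at this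
        exact (List.pairwise_append.1 this.2.1).1
      · have hsub : a = [] := by
          rcases a with _ | ⟨q, a⟩
          · rfl
          · exfalso
            rcases L with _ | ⟨p', L⟩
            · simp at h2
            · simp only [List.flatMap_cons, blockList, List.cons_append, List.cons.injEq] at h2
              apply hm p'.1
              rw [h2.1]
              simp
        rw [hsub, List.append_nil]
        have := hb p
        rw [h, List.pairwise_append] at this
        exact this.2.1

theorem exists_blocks_of_mem_pow (z : Core) (n : ℕ) (w : List Token) (h : w ∈ block z ^ n) :
    ∃ L : List (Core × ℕ), w = L.flatMap blockList ∧ L.map Prod.fst = List.replicate n z := by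
  induction n generalizing w with
  | zero =>
    rw [pow_zero, Language.mem_one] at h
    exact ⟨[], by simp [h], rfl⟩
  | succ n ih =>
    rw [pow_succ', Language.mem_mul] at h
    obtain ⟨w1, ⟨i, h1⟩, w2, h2, rfl⟩ := h
    obtain ⟨L, hL, hL'⟩ := ih w2 h2
    refine ⟨(z, i) :: L, ?_, ?_⟩
    · rw [List.flatMap_cons, ← hL, h1]
      rfl
    · simp [hL', List.replicate_succ]

theorem count_core_blocks (z : Core) (L : List (Core × ℕ)) :
    (L.flatMap blockList).count (Token.core z) = (L.map Prod.fst).count z := by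
  induction L with
  | nil => rfl
  | cons p L ih =>
    rw [List.flatMap_cons, List.count_append, ih, List.map_cons, List.count_cons]
    simp [blockList, List.count_cons, List.count_replicate]
    omega

theorem isCrossSerial_of_mem {w : List Token} (h : w ∈ csdStrings) : IsCrossSerial w := by
  obtain ⟨n, m, hn, hm, h⟩ := h
  obtain ⟨w3, h3, wd, hd, rfl⟩ := h
  obtain ⟨w2, h2, wc, hc, rfl⟩ := h3
  obtain ⟨wa, ha, wb, hb, rfl⟩ := h2
  obtain ⟨La, rfl, hLa⟩ := exists_blocks_of_mem_pow _ _ _ ha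
  obtain ⟨Lb, rfl, hLb⟩ := exists_blocks_of_mem_pow _ _ _ hb
  obtain ⟨Lc, rfl, hLc⟩ := exists_blocks_of_mem_pow _ _ _ hc
  obtain ⟨Ld, rfl, hLd⟩ := exists_blocks_of_mem_pow _ _ _ hd
  obtain ⟨L, hL, hw⟩ : ∃ L : List (Core × ℕ), L = La ++ Lb ++ Lc ++ Ld ∧
      L.map Prod.fst = List.replicate n Core.a ++ List.replicate m Core.b ++
        List.replicate n Core.c ++ List.replicate m Core.d :=
    ⟨_, rfl, by simp [hLa, hLb, hLc, hLd]⟩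
  have e : (fun x1 x2 : List Token => x1 ++ x2) ((fun x1 x2 : List Token => x1 ++ x2)
      ((fun x1 x2 : List Token => x1 ++ x2) (La.flatMap blockList) (Lb.flatMap blockList))
      (Lc.flatMap blockList)) (Ld.flatMap blockList) = L.flatMap blockList := by
    simp [hL]
  rw [e]
  have hs : (L.map Prod.fst).Pairwise fun z z' => z.idx ≤ z'.idx := by
    rw [hw]
    simp only [List.pairwise_append, List.mem_append, List.mem_replicate,
      List.pairwise_replicate]
    refine ⟨⟨⟨?_, ?_, ?_⟩, ?_, ?_⟩, ?_, ?_⟩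
    all_goals grind [Core.idx]
  refine ⟨fun u v h => blocks_prefix_le L u v h,
    fun u z v h => blocks_balanced_before_core L u z v h, blocks_balanced L, ?_,
    fun u v h => blocks_core_of_bar L u v h, fun u m v h => blocks_phase_sorted L u m v h,
    ?_, ?_, ?_, ?_⟩
  · intro u v h p hp q hq
    have := blocks_letters_sorted hs
    rw [h, List.pairwise_append] at this
    exact this.2.2 p hp q hq
  all_goals
    simp only [count_core_blocks, hw]
    simp [List.count_replicate]
  · exact hn
  · exact hm

/-- Number of tokens `ȳ` after the last token `y`. -/
def barsAfterLast (y : Core) (w : List Token) : ℕ :=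
  (w.reverse.takeWhile fun p => decide (p ≠ Token.core y)).count (Token.bar y)

theorem barsAfterLast_append_of_notMem {y : Core} {u v : List Token} (h : Token.core y ∉ v) :
    barsAfterLast y (u ++ v) = barsAfterLast y u + v.count (Token.bar y) := by
  unfold barsAfterLast
  rw [List.reverse_append, List.takeWhile_append_of_pos, List.count_append, List.count_reverse,
    Nat.add_comm]
  intro p hp
  rw [List.mem_reverse] at hp
  simp only [ne_eq, decide_not, Bool.not_eq_eq_eq_not, Bool.not_true, decide_eq_false_iff_not]
  rintro rfl
  exact h hp

theorem barsAfterLast_append_of_mem {y : Core} {u v : List Token} (h : Token.core y ∈ v) :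
    barsAfterLast y (u ++ v) = barsAfterLast y v := by
  unfold barsAfterLast
  rw [List.reverse_append, List.takeWhile_append, if_neg]
  intro h'
  have h1 := List.Sublist.eq_of_length
    (List.takeWhile_sublist (l := v.reverse) fun p => decide (p ≠ Token.core y)) h'
  rw [List.takeWhile_eq_self_iff] at h1
  simpa using h1 _ (List.mem_reverse.2 h)

theorem barsAfterLast_cons_of_notMem {y : Core} {u v : List Token} (h : Token.core y ∉ v) :
    barsAfterLast y (u ++ Token.core y :: v) = v.count (Token.bar y) := by
  have e : u ++ Token.core y :: v = (u ++ [Token.core y]) ++ v := by simp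
  rw [e, barsAfterLast_append_of_notMem h, barsAfterLast_append_of_mem (by simp)]
  simp [barsAfterLast]

theorem barsAfterLast_insert {y : Core} {P : List Token} (h : Token.core y ∉ P)
    (u v : List Token) :
    barsAfterLast y (u ++ v) ≤ barsAfterLast y (u ++ (P ++ v)) ∧
      barsAfterLast y (u ++ (P ++ v)) ≤ barsAfterLast y (u ++ v) + P.count (Token.bar y) := by
  by_cases hv : Token.core y ∈ v
  · rw [← List.append_assoc, barsAfterLast_append_of_mem hv, barsAfterLast_append_of_mem hv]
    omega
  · rw [← List.append_assoc, barsAfterLast_append_of_notMem hv,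
      barsAfterLast_append_of_notMem hv, barsAfterLast_append_of_notMem h]
    omega

theorem exists_last_of_mem {p : Token} {w : List Token} (h : p ∈ w) :
    ∃ u v, w = u ++ p :: v ∧ p ∉ v := by
  obtain ⟨u, v, h1, h2⟩ := List.eq_append_cons_of_mem (List.mem_reverse.2 h)
  refine ⟨v.reverse, u.reverse, ?_, by simpa using h2⟩
  rw [← List.reverse_reverse w, h1]
  simp

theorem length_le_lastRun {z : Token} {A B : List Token} (n : ℕ) (h : z ∉ B) :
    n ≤ lastRun z (A ++ List.replicate n z ++ B) := by
  rcases n with _ | n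
  · simp
  unfold lastRun
  rw [List.reverse_append, List.dropWhile_append_of_pos, List.reverse_append,
    List.reverse_replicate, List.replicate_succ, List.cons_append, List.dropWhile_cons_of_neg,
    ← List.cons_append, ← List.replicate_succ, List.takeWhile_append_of_pos]
  · simp
  · simp
  · simp
  · intro p hp
    rw [List.mem_reverse] at hp
    simp only [ne_eq, decide_not, Bool.not_eq_eq_eq_not, Bool.not_true, decide_eq_false_iff_not]
    rintro rfl
    exact h hp

namespace IsCrossSerial

variable {w : List Token}

/-- Two occurrences of `ȳ` squeeze everything between them: a letter there must be `y` by
alphabetical order, and without core letters the phase is constant. -/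
theorem bars_of_between (hw : IsCrossSerial w) {y : Core} {u m v : List Token}
    (h : w = u ++ (Token.bar y :: (m ++ Token.bar y :: v))) (hm : Token.core y ∉ m) :
    ∀ p ∈ m, p = Token.bar y := by
  have hcore : ∀ z, Token.core z ∉ m := by
    intro z hz
    have h1 := hw.letters_sorted (u ++ [Token.bar y]) (m ++ Token.bar y :: v) (by simp [h])
      (Token.bar y) (by simp) (Token.core z) (by simp [hz]) y z rfl rfl
    have h2 := hw.letters_sorted (u ++ (Token.bar y :: m)) (Token.bar y :: v) (by simp [h])
      (Token.core z) (by simp [hz]) (Token.bar y) (by simp) z y rfl rfl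
    have h3 : z = y := Core.idx_injective (le_antisymm h2 h1)
    exact hm (h3 ▸ hz)
  have hp := hw.phase_sorted u (Token.bar y :: (m ++ [Token.bar y])) v (by simp [h]) (by
    intro z
    simp [hcore z])
  rw [List.pairwise_cons, List.pairwise_append] at hp
  intro p hpm
  have h1 := hp.1 p (by simp [hpm])
  have h2 := hp.2.2.2 p hpm (Token.bar y) (by simp)
  rcases p with z | z | _ | _
  · simp [Token.phase] at h1
  · have h1 := hw.letters_sorted (u ++ [Token.bar y]) (m ++ Token.bar y :: v) (by simp [h])
      (Token.bar y) (by simp) (Token.bar z) (by simp [hpm]) y z rfl rfl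
    have h2 := hw.letters_sorted (u ++ (Token.bar y :: m)) (Token.bar y :: v) (by simp [h])
      (Token.bar z) (by simp [hpm]) (Token.bar y) (by simp) z y rfl rfl
    rw [Core.idx_injective (le_antisymm h2 h1)]
  · simp [Token.phase] at h1
  · simp [Token.phase] at h2

/-- No `y` separates the `ȳ` after the last `y`, so by `bars_of_between` they are contiguous and
belong to the rightmost run. -/
theorem barsAfterLast_le_lastRun (hw : IsCrossSerial w) {y : Core} (hy : Token.core y ∈ w) :
    barsAfterLast y w ≤ lastRun (Token.bar y) w := by
  obtain ⟨u, v, h, hv⟩ := exists_last_of_mem hy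
  rw [h, barsAfterLast_cons_of_notMem hv, ← h]
  by_cases hb : Token.bar y ∈ v
  · obtain ⟨v1, B, h1, hB⟩ := exists_last_of_mem hb
    by_cases hb1 : Token.bar y ∈ v1
    · obtain ⟨A, m, h2, hA⟩ := List.eq_append_cons_of_mem hb1
      have hm := hw.bars_of_between (u := u ++ Token.core y :: A) (m := m) (v := B) (y := y)
        (by simp [h, h1, h2]) (by
          intro h'
          apply hv
          simp [h1, h2, h'])
      have hm' : m = List.replicate m.length (Token.bar y) := List.eq_replicate_iff.2 ⟨rfl, hm⟩
      have hw' : w = (u ++ Token.core y :: A) ++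
          List.replicate (m.length + 2) (Token.bar y) ++ B := by
        rw [h, h1, h2, List.replicate_succ, List.replicate_succ', ← hm']
        simp
      have hc : v.count (Token.bar y) = m.length + 2 := by
        rw [h1, h2, hm']
        simp [List.count_eq_zero_of_not_mem hA, List.count_eq_zero_of_not_mem hB]
      rw [hc, hw']
      exact length_le_lastRun _ hB
    · have hc : v.count (Token.bar y) = 1 := by
        rw [h1]
        simp [List.count_eq_zero_of_not_mem hb1, List.count_eq_zero_of_not_mem hB]
      have hw' : w = (u ++ Token.core y :: v1) ++ List.replicate 1 (Token.bar y) ++ B := by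
        rw [h, h1]
        simp
      rw [hc, hw']
      exact length_le_lastRun _ hB
  · rw [List.count_eq_zero_of_not_mem hb]
    exact Nat.zero_le _

/-- With `P = α ȳ β`, the part between the two copies of this `ȳ` in `PP` is `βα`, which is all the
rest of `P`. -/
theorem homogeneous {P u v : List Token} {y : Core} (hw : IsCrossSerial (u ++ (P ++ (P ++ v))))
    (hb : Token.bar y ∈ P) (hy : Token.core y ∉ P) : ∀ p ∈ P, p = Token.bar y := by
  obtain ⟨α, β, rfl⟩ := List.append_of_mem hb
  have hm := hw.bars_of_between (u := u ++ α) (m := β ++ α) (v := β ++ v) (y := y) (by simp) (by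
    simp only [List.mem_append, List.mem_cons] at hy ⊢
    tauto)
  intro p hp
  simp only [List.mem_append, List.mem_cons] at hp hm
  rcases hp with hp | hp | hp
  · exact hm p (Or.inr hp)
  · exact hp
  · exact hm p (Or.inl hp)

end IsCrossSerial

/-! ## Pumped families of strings -/

/-- `Pⁱ`. -/
def iter (P : List Token) : ℕ → List Token
  | 0 => []
  | i + 1 => P ++ iter P i

theorem iter_succ' (P : List Token) (i : ℕ) : iter P (i + 1) = iter P i ++ P := by
  induction i with
  | zero => simp [iter]
  | succ i ih =>
    rw [iter, ih, ← List.append_assoc, ← iter, ← ih]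

theorem count_iter (P : List Token) (p : Token) (i : ℕ) :
    (iter P i).count p = i * P.count p := by
  induction i with
  | zero => simp [iter]
  | succ i ih => rw [iter, List.count_append, ih]; ring

theorem nBar_append (u v : List Token) : nBar (u ++ v) = nBar u + nBar v :=
  List.countP_append

theorem nBar_iter (P : List Token) (i : ℕ) : nBar (iter P i) = i * nBar P := by
  induction i with
  | zero => simp [iter]
  | succ i ih =>
    simp only [nBar] at ih ⊢
    rw [iter, List.countP_append, ih]; ring

/-- Comparison of slopes; it turns inequalities for the prefixes of all words `F.word i` into
inequalities for the pumped strings. -/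
theorem le_of_forall_add_mul_le {a b c d : ℕ} (h : ∀ i, c + i * a ≤ d + i * b) : a ≤ b := by
  by_contra hab
  have h1 := h (d + 1)
  have h2 : (d + 1) * (b + 1) ≤ (d + 1) * a := Nat.mul_le_mul_left _ (by omega)
  nlinarith

/-- The strings `s₁ P₁ⁱ s₂ P₂ⁱ s₃ P₃ⁱ s₄ P₄ⁱ s₅`. -/
structure PumpedFamily where
  (s₁ P₁ s₂ P₂ s₃ P₃ s₄ P₄ s₅ : List Token)

namespace PumpedFamily

def word (F : PumpedFamily) (i : ℕ) : List Token :=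
  F.s₁ ++ (iter F.P₁ i ++ (F.s₂ ++ (iter F.P₂ i ++ (F.s₃ ++ (iter F.P₃ i ++
    (F.s₄ ++ (iter F.P₄ i ++ F.s₅)))))))

theorem prefix_one {F : PumpedFamily} (hF : ∀ i, IsCrossSerial (F.word i)) :
    nR F.P₁ ≤ nBar F.P₁ ∧ nBar F.P₁ ≤ nL F.P₁ := by
  have h : ∀ i, _ := fun i => (hF i).prefix_le (F.s₁ ++ iter F.P₁ i) _
    (by simp only [word, List.append_assoc]; rfl)
  simp only [nR, nL, List.count_append, nBar_append, count_iter, nBar_iter] at h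
  exact ⟨le_of_forall_add_mul_le fun i => (h i).1, le_of_forall_add_mul_le fun i => (h i).2⟩

theorem prefix_two {F : PumpedFamily} (hF : ∀ i, IsCrossSerial (F.word i)) :
    nR F.P₁ + nR F.P₂ ≤ nBar F.P₁ + nBar F.P₂ ∧
      nBar F.P₁ + nBar F.P₂ ≤ nL F.P₁ + nL F.P₂ := by
  have h : ∀ i, _ := fun i => (hF i).prefix_le (F.s₁ ++ (iter F.P₁ i ++ (F.s₂ ++ iter F.P₂ i))) _
    (by simp only [word, List.append_assoc]; rfl)
  simp only [nR, nL, List.count_append, nBar_append, count_iter, nBar_iter] at h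
  refine ⟨le_of_forall_add_mul_le (c := nR F.s₁ + nR F.s₂) (d := nBar F.s₁ + nBar F.s₂)
    fun i => ?_, le_of_forall_add_mul_le (c := nBar F.s₁ + nBar F.s₂) (d := nL F.s₁ + nL F.s₂)
    fun i => ?_⟩
  · linarith [(h i).1]
  · linarith [(h i).2]

theorem prefix_three {F : PumpedFamily} (hF : ∀ i, IsCrossSerial (F.word i)) :
    nR F.P₁ + nR F.P₂ + nR F.P₃ ≤ nBar F.P₁ + nBar F.P₂ + nBar F.P₃ ∧
      nBar F.P₁ + nBar F.P₂ + nBar F.P₃ ≤ nL F.P₁ + nL F.P₂ + nL F.P₃ := by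
  have h : ∀ i, _ := fun i => (hF i).prefix_le (F.s₁ ++ (iter F.P₁ i ++ (F.s₂ ++ (iter F.P₂ i ++
    (F.s₃ ++ iter F.P₃ i))))) _ (by simp only [word, List.append_assoc]; rfl)
  simp only [nR, nL, List.count_append, nBar_append, count_iter, nBar_iter] at h
  refine ⟨le_of_forall_add_mul_le (c := nR F.s₁ + nR F.s₂ + nR F.s₃)
    (d := nBar F.s₁ + nBar F.s₂ + nBar F.s₃) fun i => ?_,
    le_of_forall_add_mul_le (c := nBar F.s₁ + nBar F.s₂ + nBar F.s₃)
    (d := nL F.s₁ + nL F.s₂ + nL F.s₃) fun i => ?_⟩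
  · linarith [(h i).1]
  · linarith [(h i).2]

theorem count_word (F : PumpedFamily) (p : Token) (i : ℕ) :
    (F.word i).count p = (F.word 0).count p +
      i * (F.P₁.count p + F.P₂.count p + F.P₃.count p + F.P₄.count p) := by
  simp only [word, List.count_append, count_iter]
  ring

theorem nBar_word (F : PumpedFamily) (i : ℕ) :
    nBar (F.word i) = nBar (F.word 0) +
      i * (nBar F.P₁ + nBar F.P₂ + nBar F.P₃ + nBar F.P₄) := by
  simp only [word, nBar_append, nBar_iter]
  ring

theorem balanced {F : PumpedFamily} (hF : ∀ i, IsCrossSerial (F.word i)) :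
    nR F.P₁ + nR F.P₂ + nR F.P₃ + nR F.P₄ = nBar F.P₁ + nBar F.P₂ + nBar F.P₃ + nBar F.P₄ ∧
      nBar F.P₁ + nBar F.P₂ + nBar F.P₃ + nBar F.P₄ =
        nL F.P₁ + nL F.P₂ + nL F.P₃ + nL F.P₄ := by
  have h0 := (hF 0).balanced
  have h1 := (hF 1).balanced
  rw [nBar_word, nR, nL, count_word, count_word F Token.lbr] at h1
  rw [nR, nL] at h0
  simp only [nR, nL]
  omega

/-- Before a core letter in `s₂`, the pumped part is balanced. -/
theorem balanced_of_core_mem_s₂ {F : PumpedFamily} (hF : ∀ i, IsCrossSerial (F.word i)) {z : Core}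
    (hz : Token.core z ∈ F.s₂) : nR F.P₁ = nBar F.P₁ ∧ nBar F.P₁ = nL F.P₁ := by
  obtain ⟨α, β, hs⟩ := List.append_of_mem hz
  have h : ∀ i, _ := fun i => (hF i).balanced_before_core (F.s₁ ++ (iter F.P₁ i ++ α)) z _
    (by simp only [word, hs, List.append_assoc, List.cons_append]; rfl)
  have h0 := h 0
  have h1 := h 1
  simp only [nR, nL, List.count_append, nBar_append, count_iter, nBar_iter] at h0 h1
  simp only [nR, nL]
  omega

theorem balanced_of_core_mem_s₃ {F : PumpedFamily} (hF : ∀ i, IsCrossSerial (F.word i)) {z : Core}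
    (hz : Token.core z ∈ F.s₃) : nR F.P₁ + nR F.P₂ = nBar F.P₁ + nBar F.P₂ ∧
      nBar F.P₁ + nBar F.P₂ = nL F.P₁ + nL F.P₂ := by
  obtain ⟨α, β, hs⟩ := List.append_of_mem hz
  have h : ∀ i, _ := fun i => (hF i).balanced_before_core
    (F.s₁ ++ (iter F.P₁ i ++ (F.s₂ ++ (iter F.P₂ i ++ α)))) z _
    (by simp only [word, hs, List.append_assoc, List.cons_append]; rfl)
  have h0 := h 0
  have h1 := h 1
  simp only [nR, nL, List.count_append, nBar_append, count_iter, nBar_iter] at h0 h1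
  simp only [nR, nL]
  omega

/-- Before a core letter in `s₄` or `P₄`, the pumped part is balanced. -/
theorem balanced_of_core_mem_s₄ {F : PumpedFamily} (hF : ∀ i, IsCrossSerial (F.word i)) {z : Core}
    (hz : Token.core z ∈ F.s₄ ∨ Token.core z ∈ F.P₄) :
    nR F.P₁ + nR F.P₂ + nR F.P₃ = nBar F.P₁ + nBar F.P₂ + nBar F.P₃ := by
  have hz' : Token.core z ∈ F.s₄ ++ F.P₄ := List.mem_append.2 hz
  obtain ⟨α, β, hs⟩ := List.append_of_mem hz'
  -- The exponent `i + 1` guarantees a first copy of `P₄`, in which the core letter may lie.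
  have h : ∀ i, _ := fun i => (hF (i + 1)).balanced_before_core
    (F.s₁ ++ (iter F.P₁ (i + 1) ++ (F.s₂ ++ (iter F.P₂ (i + 1) ++ (F.s₃ ++
      (iter F.P₃ (i + 1) ++ α)))))) z (β ++ (iter F.P₄ i ++ F.s₅)) (by
      have e : F.s₄ ++ (iter F.P₄ (i + 1) ++ F.s₅) =
          α ++ Token.core z :: (β ++ (iter F.P₄ i ++ F.s₅)) := by
        rw [iter, List.append_assoc, ← List.append_assoc, hs]
        simp
      simp only [word, e, List.append_assoc])
  have h0 := h 0
  have h1 := h 1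
  simp only [nR, nL, List.count_append, nBar_append, count_iter, nBar_iter] at h0 h1
  simp only [nR]
  omega

/-- A pumped string with a token `ȳ` and without `y` is a power of `ȳ`. -/
theorem homogeneous {F : PumpedFamily} (hF : ∀ i, IsCrossSerial (F.word i)) {y : Core}
    {P : List Token} (hP : P = F.P₁ ∨ P = F.P₂ ∨ P = F.P₃ ∨ P = F.P₄)
    (hb : Token.bar y ∈ P) (hy : Token.core y ∉ P) :
    nL P = 0 ∧ nR P = 0 ∧ (∀ z, Token.core z ∉ P) ∧ 1 ≤ nBar P := by
  obtain ⟨u, v, huv⟩ : ∃ u v, F.word 2 = u ++ (P ++ (P ++ v)) := by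
    rcases hP with rfl | rfl | rfl | rfl
    · exact ⟨F.s₁, _, by simp only [word, iter, List.append_assoc, List.nil_append]; rfl⟩
    · exact ⟨F.s₁ ++ (iter F.P₁ 2 ++ F.s₂), _,
        by simp only [word, iter, List.append_assoc, List.nil_append]; rfl⟩
    · exact ⟨F.s₁ ++ (iter F.P₁ 2 ++ (F.s₂ ++ (iter F.P₂ 2 ++ F.s₃))), _,
        by simp only [word, iter, List.append_assoc, List.nil_append]; rfl⟩
    · exact ⟨F.s₁ ++ (iter F.P₁ 2 ++ (F.s₂ ++ (iter F.P₂ 2 ++ (F.s₃ ++ (iter F.P₃ 2 ++ F.s₄))))), _,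
        by simp only [word, iter, List.append_assoc, List.nil_append]; rfl⟩
  have h2 := hF 2
  rw [huv] at h2
  have h := h2.homogeneous hb hy
  refine ⟨?_, ?_, ?_, ?_⟩
  · exact List.count_eq_zero.2 fun h' => by simpa using h _ h'
  · exact List.count_eq_zero.2 fun h' => by simpa using h _ h'
  · exact fun z h' => by simpa using h _ h'
  · exact List.countP_pos_iff.2 ⟨_, hb, rfl⟩

/-- If `ȳ` but not `y` is pumped, then `ȳ` is pumped in the two inner strings only. -/
theorem inner_of_bar_pumped {F : PumpedFamily} (hF : ∀ i, IsCrossSerial (F.word i)) {y : Core}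
    (h₁ : Token.core y ∉ F.P₁) (h₄ : Token.core y ∉ F.P₄) :
    Token.bar y ∉ F.P₁ ∧ Token.bar y ∉ F.P₄ := by
  have a1 := prefix_one hF
  have a3 := prefix_three hF
  have a4 := balanced hF
  -- A power of `ȳ` in `P₁` has no opening bracket before it, and one in `P₄` no closing bracket
  -- after it.
  constructor
  · intro h
    have := homogeneous hF (P := F.P₁) (by simp) h h₁
    omega
  · intro h
    have := homogeneous hF (P := F.P₄) (by simp) h h₄
    omega

/-- If `ȳ` but not `y` is pumped, then the string in the middle has no core letter. -/
theorem core_notMem_s₃ {F : PumpedFamily} (hF : ∀ i, IsCrossSerial (F.word i)) {y : Core}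
    (h₂ : Token.core y ∉ F.P₂) (h₃ : Token.core y ∉ F.P₃)
    (hb : Token.bar y ∈ F.P₂ ∨ Token.bar y ∈ F.P₃) (z : Core) : Token.core z ∉ F.s₃ := by
  intro hz
  have a1 := prefix_one hF
  have a3 := prefix_three hF
  -- A core letter in `s₃` needs a balanced pumped part before it. Bars in `P₂` leave `P₁` with too
  -- many closing brackets, and bars in `P₃` then lack opening brackets.
  have b := balanced_of_core_mem_s₃ hF hz
  rcases hb with hb | hb
  · have := homogeneous hF (P := F.P₂) (by simp) hb h₂
    omega
  · have := homogeneous hF (P := F.P₃) (by simp) hb h₃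
    omega

/-- The situation where `ȳ` but not `y` is pumped, and all `y` are inside. -/
theorem inside_of_bar_pumped {F : PumpedFamily} (hF : ∀ i, IsCrossSerial (F.word i)) {y : Core}
    (hs₁ : Token.core y ∉ F.s₁) (h₁ : Token.core y ∉ F.P₁) (h₂ : Token.core y ∉ F.P₂)
    (h₃ : Token.core y ∉ F.P₃) (hb : Token.bar y ∈ F.P₂ ∨ Token.bar y ∈ F.P₃) :
    Token.core y ∈ F.s₂ ∧ nR F.s₃ = 0 ∧
      ∀ z : Core, y.idx < z.idx → Token.core z ∉ F.s₁ ++ (F.P₁ ++ (F.s₂ ++ (F.P₂ ++ (F.s₃ ++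
        (F.P₃ ++ (F.s₄ ++ F.P₄)))))) := by
  have hw : F.word 1 = F.s₁ ++ (F.P₁ ++ (F.s₂ ++ (F.P₂ ++ (F.s₃ ++ (F.P₃ ++
      (F.s₄ ++ (F.P₄ ++ F.s₅))))))) := by
    simp [word, iter]
  have h1 := hF 1
  rw [hw] at h1
  have hs₃ := core_notMem_s₃ hF h₂ h₃ hb
  have hy : Token.core y ∈ F.s₂ := by
    have : Token.core y ∈ F.s₁ ++ (F.P₁ ++ (F.s₂ ++ (F.P₂ ++ (F.s₃ ++ F.P₃)))) := by
      refine h1.core_of_bar _ (F.s₄ ++ (F.P₄ ++ F.s₅)) (by simp) y ?_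
      simp only [List.mem_append]
      tauto
    simp only [List.mem_append] at this
    have := hs₃ y
    tauto
  have a2 := prefix_two hF
  have b := balanced_of_core_mem_s₂ hF hy
  -- The letter `y` in `s₂` forces `P₁` to be balanced, so no opening brackets are left for bars in
  -- `P₂`.
  have hb3 : Token.bar y ∈ F.P₃ := by
    refine hb.resolve_left fun hb2 => ?_
    have := homogeneous hF (P := F.P₂) (by simp) hb2 h₂
    omega
  have hom := homogeneous hF (P := F.P₃) (by simp) hb3 h₃
  obtain ⟨α, β, hP₃⟩ := List.append_of_mem hb3
  have hgt : ∀ z : Core, y.idx < z.idx → Token.core z ∉ F.s₁ ++ (F.P₁ ++ (F.s₂ ++ (F.P₂ ++ (F.s₃ ++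
      α)))) := by
    intro z hz hmem
    have := h1.letters_sorted (F.s₁ ++ (F.P₁ ++ (F.s₂ ++ (F.P₂ ++ (F.s₃ ++ α)))))
      (Token.bar y :: (β ++ (F.s₄ ++ (F.P₄ ++ F.s₅)))) (by simp [hP₃]) _ hmem (Token.bar y)
      (by simp) z y rfl rfl
    omega
  refine ⟨hy, ?_, ?_⟩
  · obtain ⟨σ, τ, hs₂, hτ⟩ := exists_last_of_mem hy
    -- From the last `y` of `s₂` to a `ȳ` in `P₃` there is no core letter, so this segment lies in
    -- one block, and no closing bracket can precede its `ȳ`.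
    have hnc : ∀ z, Token.core z ∉ τ ++ (F.P₂ ++ (F.s₃ ++ (α ++ [Token.bar y]))) := by
      intro z hz
      have hle : y.idx ≤ z.idx := h1.letters_sorted (F.s₁ ++ (F.P₁ ++ (σ ++ [Token.core y])))
        (τ ++ (F.P₂ ++ (F.s₃ ++ (α ++ [Token.bar y]))) ++ (β ++ (F.s₄ ++ (F.P₄ ++ F.s₅))))
        (by simp [hs₂, hP₃]) (Token.core y) (by simp) _ (List.mem_append_left _ hz) y z rfl rfl
      rcases hle.lt_or_eq with hlt | heq
      · apply hgt z hlt
        simp only [List.mem_append, hs₂, List.mem_cons] at hz ⊢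
        simp only [List.not_mem_nil, reduceCtorEq, or_false] at hz
        tauto
      · obtain rfl := Core.idx_injective heq
        simp only [List.mem_append, List.mem_singleton, reduceCtorEq, or_false] at hz
        have := hs₃ y
        have : Token.core y ∉ α := fun h' => h₃ (by simp [hP₃, h'])
        tauto
    have hp := h1.phase_sorted (F.s₁ ++ (F.P₁ ++ (σ ++ [Token.core y])))
      (τ ++ (F.P₂ ++ (F.s₃ ++ (α ++ [Token.bar y])))) (β ++ (F.s₄ ++ (F.P₄ ++ F.s₅)))
      (by simp [hs₂, hP₃]) hnc
    rw [List.pairwise_append, List.pairwise_append, List.pairwise_append] at hp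
    refine List.count_eq_zero.2 fun hr => ?_
    have := hp.2.1.2.1.2.2 Token.rbr hr (Token.bar y) (by simp)
    simp [Token.phase] at this
  · intro z hz hmem
    have h3 := hom.2.2.1 z
    -- The closing brackets for the bars in `P₃` are pumped in `P₄`, so the pumped part is not yet
    -- balanced before `s₄` or within the first copy of `P₄`.
    have h4 : ¬ (Token.core z ∈ F.s₄ ∨ Token.core z ∈ F.P₄) := by
      intro h'
      have := balanced_of_core_mem_s₄ hF h'
      omega
    have := hgt z hz
    simp only [List.mem_append] at hmem this
    tauto

end PumpedFamily

/-! ## Trees and contexts -/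

namespace Ctx

variable {Δ : Signature}

theorem plug_comp (C C' : Ctx Δ) (t : RTree Δ) : (C.comp C').plug t = C.plug (C'.plug t) := by
  induction C with
  | hole => rfl
  | node f i ts c ih => simp only [comp, plug, ih]

theorem comp_assoc (C C' C'' : Ctx Δ) : (C.comp C').comp C'' = C.comp (C'.comp C'') := by
  induction C with
  | hole => rfl
  | node f i ts c ih => simp only [comp, ih]

theorem comp_hole (C : Ctx Δ) : C.comp .hole = C := by
  induction C with
  | hole => rfl
  | node f i ts c ih => simp only [comp, ih]

theorem height_le_height_plug (C : Ctx Δ) (t : RTree Δ) : C.height ≤ (C.plug t).height := by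
  induction C with
  | hole => exact Nat.zero_le _
  | node f i ts c ih =>
    simp only [height, plug, RTree.height]
    refine Nat.add_le_add_left (Finset.sup_mono_fun fun j _ => ?_) 1
    by_cases hj : j = i <;> simp [hj, ih]

theorem height_plug_le (C : Ctx Δ) (t : RTree Δ) :
    (C.plug t).height ≤ C.height + t.height := by
  induction C with
  | hole => simp [plug, height]
  | node f i ts c ih =>
    simp only [height, plug, RTree.height]
    rw [Nat.add_assoc]
    refine Nat.add_le_add_left (Finset.sup_le fun j _ => ?_) 1
    have := Finset.le_sup (f := fun j => if hj : j = i then c.height else (ts j hj).height)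
      (Finset.mem_univ j)
    by_cases hj : j = i
    · simp only [hj, dite_true] at this ⊢
      omega
    · simp only [hj, dite_false] at this ⊢
      omega

theorem height_comp_le (C C' : Ctx Δ) : (C.comp C').height ≤ C.height + C'.height := by
  induction C with
  | hole => simp [comp, height]
  | node f i ts c ih =>
    simp only [height, comp]
    rw [Nat.add_assoc]
    refine Nat.add_le_add_left (Finset.sup_le fun j _ => ?_) 1
    have := Finset.le_sup (f := fun j => if hj : j = i then c.height else (ts j hj).height)
      (Finset.mem_univ j)
    by_cases hj : j = i
    · simp only [hj, dite_true] at this ⊢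
      omega
    · simp only [hj, dite_false] at this ⊢
      omega

theorem height_pos {C : Ctx Δ} (h : C ≠ .hole) : 0 < C.height := by
  cases C with
  | hole => exact absurd rfl h
  | node f i ts c => rw [height]; omega

end Ctx

/-- Number of nodes of a tree. -/
def RTree.nodes {Δ : Signature} : RTree Δ → ℕ
  | .node _ ts => 1 + ∑ i, (ts i).nodes

/-- The induction is on the number of nodes because the removal of a pumped part need not lower the
height. The first conjunct turns the nontriviality condition on heights into a strict decrease. -/
theorem RTree.nodes_plug {Δ : Signature} (C : Ctx Δ) :
    ∃ n, (C.height = 0 ∨ 0 < n) ∧ ∀ t, (C.plug t).nodes = n + t.nodes := by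
  induction C with
  | hole => exact ⟨0, by simp [Ctx.height], by simp [Ctx.plug]⟩
  | node f i ts c ih =>
    obtain ⟨n, -, ih⟩ := ih
    refine ⟨1 + (n + ∑ j ∈ Finset.univ.erase i, if hj : j = i then 0 else (ts j hj).nodes),
      by omega, fun t => ?_⟩
    rw [Ctx.plug, RTree.nodes, ← Finset.add_sum_erase _ _ (Finset.mem_univ i)]
    have : ∀ j ∈ Finset.univ.erase i, (if hj : j = i then c.plug t else ts j hj).nodes =
        if hj : j = i then 0 else (ts j hj).nodes := by
      intro j hj
      simp [Finset.ne_of_mem_erase hj]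
    rw [Finset.sum_congr rfl this]
    simp only [dite_true, ih]
    omega

/-! ## Yields -/

theorem finRange_eq_append {n : ℕ} (i : Fin n) : ∃ l₁ l₂ : List (Fin n),
    List.finRange n = l₁ ++ i :: l₂ ∧ (∀ j ∈ l₁, j < i) ∧ ∀ j ∈ l₂, i < j := by
  obtain ⟨l₁, l₂, h⟩ := List.append_of_mem (List.mem_finRange i)
  have hp := List.pairwise_lt_finRange n
  rw [h, List.pairwise_append, List.pairwise_cons] at hp
  exact ⟨l₁, l₂, h, fun j hj => hp.2.2 j hj i (by simp), hp.2.1.1⟩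

theorem flatMap_eq_nil_of {α β : Type*} {l : List α} {g : α → List β} (h : ∀ a ∈ l, g a = []) :
    l.flatMap g = [] := by
  rw [List.flatMap_congr h]
  simp

theorem flatMap_split {n : ℕ} {β : Type*} (i : Fin n) (g : Fin n → List β) :
    (List.finRange n).flatMap g = ((List.finRange n).flatMap fun j => if j < i then g j else []) ++
      g i ++ (List.finRange n).flatMap fun j => if i < j then g j else [] := by
  obtain ⟨l₁, l₂, h, h₁, h₂⟩ := finRange_eq_append i
  have e1 : l₁.flatMap (fun j => if j < i then g j else []) = l₁.flatMap g :=
    List.flatMap_congr fun j hj => by simp [h₁ j hj]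
  have e2 : l₂.flatMap (fun j => if j < i then g j else []) = [] :=
    flatMap_eq_nil_of fun j hj => by simp [(h₂ j hj).le]
  have e3 : l₁.flatMap (fun j => if i < j then g j else []) = [] :=
    flatMap_eq_nil_of fun j hj => by simp [(h₁ j hj).le]
  have e4 : l₂.flatMap (fun j => if i < j then g j else []) = l₂.flatMap g :=
    List.flatMap_congr fun j hj => by simp [h₂ j hj]
  simp [h, List.flatMap_append, List.flatMap_cons, e1, e2, e3, e4]

theorem exists_flatMap_update {n : ℕ} {β : Type*} (i : Fin n) (g : Fin n → List β) :
    ∃ u v, ∀ X, ((List.finRange n).flatMap fun j => if j = i then X else g j) = u ++ X ++ v := by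
  refine ⟨(List.finRange n).flatMap fun j => if j < i then g j else [],
    (List.finRange n).flatMap fun j => if i < j then g j else [], fun X => ?_⟩
  rw [flatMap_split i]
  congr 1
  · congr 1
    · refine List.flatMap_congr fun j _ => ?_
      by_cases hj : j < i
      · simp [hj, hj.ne]
      · simp [hj]
    · simp
  · refine List.flatMap_congr fun j _ => ?_
    by_cases hj : i < j
    · simp [hj, hj.ne']
    · simp [hj]

namespace ProjYield

variable {Δ : Signature} (yd : ProjYield Δ)

theorem left_comp (C C' : Ctx Δ) : yd.left (C.comp C') = yd.left C ++ yd.left C' := by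
  induction C with
  | hole => rfl
  | node f i ts c ih => simp only [Ctx.comp, left, ih, List.append_assoc]

theorem right_comp (C C' : Ctx Δ) : yd.right (C.comp C') = yd.right C' ++ yd.right C := by
  induction C with
  | hole => simp [Ctx.comp, right]
  | node f i ts c ih => simp only [Ctx.comp, right, ih, List.append_assoc]

theorem tree_plug (C : Ctx Δ) (t : RTree Δ) :
    yd.tree (C.plug t) = yd.left C ++ (yd.tree t ++ yd.right C) := by
  induction C with
  | hole => simp [Ctx.plug, left, right]
  | node f i ts c ih =>
    rw [Ctx.plug, tree, flatMap_split i, left, right]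
    simp only [dite_true, ih, List.append_assoc]
    congr 2
    · refine List.flatMap_congr fun j _ => ?_
      by_cases hj : j < i
      · simp [hj, hj.ne]
      · simp [hj]
    · congr 4
      refine List.flatMap_congr fun j _ => ?_
      by_cases hj : i < j
      · simp [hj, hj.ne']
      · simp [hj]

end ProjYield

/-! ## Graphs -/

namespace SGraph

variable {k : ℕ} {L : Type}

theorem edgeCount_par (G H : SGraph k L) (z : L) :
    (G.par H).edgeCount z = G.edgeCount z + H.edgeCount z := by
  have := G.finite_E
  have := H.finite_E
  unfold edgeCount
  rw [← Nat.card_sum]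
  exact Nat.card_congr (Equiv.subtypeSum (α := G.E) (β := H.E) (p := fun e => _ = z))

theorem edgeCount_empty (z : L) : (empty : SGraph k L).edgeCount z = 0 := by
  have : IsEmpty {e : (empty : SGraph k L).E // (empty : SGraph k L).label e = z} :=
    ⟨fun e => Empty.elim e.1⟩
  exact Nat.card_of_isEmpty

theorem edgeCount_le_size (G : SGraph k L) (z : L) : G.edgeCount z ≤ G.size := by
  have := G.finite_E
  exact Finite.card_subtype_le _

end SGraph

/-- The operations may identify nodes but never edges, so edge counts are affine in the arguments.
With a linear nondeleting homomorphism all coefficients are 1. -/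
theorem HRTerm.edgeCount_eval {k : ℕ} {L : Type} {n : ℕ} (s : HRTerm k L n) (z : L) :
    ∃ c, ∀ env : Fin n → SGraph k L,
      (s.eval env).edgeCount z = c + ∑ m, s.occ m * (env m).edgeCount z := by
  induction s with
  | var i => exact ⟨0, fun env => by simp [HRTerm.eval, HRTerm.occ]⟩
  | const G => exact ⟨G.edgeCount z, fun env => by simp [HRTerm.eval, HRTerm.occ]⟩
  | par s t ihs iht =>
    obtain ⟨c, hc⟩ := ihs
    obtain ⟨d, hd⟩ := iht
    refine ⟨c + d, fun env => ?_⟩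
    simp only [HRTerm.eval, HRTerm.occ, SGraph.edgeCount_par, hc, hd, add_mul,
      Finset.sum_add_distrib]
    ring
  | forget i s ih => exact ih
  | rename i j s ih => exact ih

namespace HRHom

variable {Δ : Signature} {k : ℕ} {L : Type} (h : HRHom Δ k L)

theorem edgeCount_image (f : Δ.Sym) (z : L) : ∃ c, ∀ env : Fin (Δ.rank f) → SGraph k L,
    ((h.image f).eval env).edgeCount z = c + ∑ m, (env m).edgeCount z := by
  obtain ⟨c, hc⟩ := (h.image f).edgeCount_eval z
  exact ⟨c, fun env => by rw [hc]; simp [h.linear]⟩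

theorem edgeCount_plug (C : Ctx Δ) (t : RTree Δ) (z : L) :
    (h.tree (C.plug t)).edgeCount z = (h.ctx C).edgeCount z + (h.tree t).edgeCount z := by
  induction C with
  | hole => simp [Ctx.plug, ctx, SGraph.edgeCount_empty]
  | node f i ts c ih =>
    obtain ⟨d, hd⟩ := h.edgeCount_image f z
    rw [Ctx.plug, tree, ctx, hd, hd, ← Finset.add_sum_erase _ _ (Finset.mem_univ i),
      ← Finset.add_sum_erase _ _ (Finset.mem_univ i)]
    have : ∀ j ∈ Finset.univ.erase i,
        (h.tree (if hj : j = i then c.plug t else ts j hj)).edgeCount z =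
        (if hj : j = i then h.ctx c else h.tree (ts j hj)).edgeCount z := by
      intro j hj
      simp [Finset.ne_of_mem_erase hj]
    rw [Finset.sum_congr rfl this]
    simp only [dite_true, ih]
    omega

theorem edgeCount_comp (C C' : Ctx Δ) (z : L) :
    (h.ctx (C.comp C')).edgeCount z = (h.ctx C).edgeCount z + (h.ctx C').edgeCount z := by
  induction C with
  | hole => simp [Ctx.comp, ctx, SGraph.edgeCount_empty]
  | node f i ts c ih =>
    obtain ⟨d, hd⟩ := h.edgeCount_image f z
    rw [Ctx.comp, ctx, ctx, hd, hd, ← Finset.add_sum_erase _ _ (Finset.mem_univ i),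
      ← Finset.add_sum_erase _ _ (Finset.mem_univ i)]
    have : ∀ j ∈ Finset.univ.erase i,
        (if hj : j = i then h.ctx (c.comp C') else h.tree (ts j hj)).edgeCount z =
        (if hj : j = i then h.ctx c else h.tree (ts j hj)).edgeCount z := by
      intro j hj
      simp [Finset.ne_of_mem_erase hj]
    rw [Finset.sum_congr rfl this]
    simp only [dite_true, ih]
    omega

end HRHom

/-! ## Relative position of two contexts in a tree -/

/-- The holes of `C` and `D` are in disjoint places of the tree `C[s] = D[t]`: the context `D`
contains `s`, which may be exchanged. -/
def IsBeside {Δ : Signature} {k : ℕ} {L : Type} (yd : ProjYield Δ) (h : HRHom Δ k L) (C : Ctx Δ)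
    (s : RTree Δ) (D : Ctx Δ) (t : RTree Δ) : Prop :=
  ∃ D' : RTree Δ → Ctx Δ, D' s = D ∧ (∀ s', C.plug s' = (D' s').plug t) ∧
    ((∃ α β γ, ∀ s', yd.left (D' s') = α ++ (yd.tree s' ++ β) ∧ yd.right (D' s') = γ) ∨
      ∃ α β γ, ∀ s', yd.left (D' s') = α ∧ yd.right (D' s') = β ++ (yd.tree s' ++ γ)) ∧
    ∀ z, ∃ c, ∀ s', (h.ctx (D' s')).edgeCount z = c + (h.tree s').edgeCount z

section Beside

variable {Δ : Signature} {k : ℕ} {L : Type} {yd : ProjYield Δ} {h : HRHom Δ k L} {C : Ctx Δ}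
  {s : RTree Δ} {D : Ctx Δ} {t : RTree Δ}

/-- As the two holes are disjoint, `t` is a part of the context `C`. This bounds `t` when `C` is
small. -/
theorem IsBeside.count_le (H : IsBeside yd h C s D t) (p : Token) :
    (yd.tree t).count p ≤ (yd.ctx C).count p := by
  obtain ⟨D', -, hp, hy, -⟩ := H
  have e := congrArg (fun t => (yd.tree t).count p) (hp s)
  simp only [yd.tree_plug, List.count_append] at e
  simp only [ProjYield.ctx, List.count_append]
  rcases hy with ⟨α, β, γ, hy⟩ | ⟨α, β, γ, hy⟩
  · rw [(hy s).1, (hy s).2] at e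
    simp only [List.count_append] at e
    omega
  · rw [(hy s).1, (hy s).2] at e
    simp only [List.count_append] at e
    omega

theorem IsBeside.edgeCount_le (H : IsBeside yd h C s D t) (z : L) :
    (h.tree t).edgeCount z ≤ (h.ctx C).edgeCount z := by
  obtain ⟨D', -, hp, -, he⟩ := H
  obtain ⟨c, hc⟩ := he z
  have e := congrArg (fun t => (h.tree t).edgeCount z) (hp s)
  simp only [h.edgeCount_plug, hc] at e
  omega

theorem IsBeside.node (H : IsBeside yd h C s D t) (f : Δ.Sym) (i : Fin (Δ.rank f))
    (ts : ∀ j : Fin (Δ.rank f), j ≠ i → RTree Δ) :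
    IsBeside yd h (.node f i ts C) s (.node f i ts D) t := by
  obtain ⟨D', rfl, hp, hy, he⟩ := H
  refine ⟨fun s' => .node f i ts (D' s'), rfl, fun s' => by simp only [Ctx.plug, hp s'], ?_, ?_⟩
  · obtain ⟨A, hA⟩ : ∃ A, ∀ c, yd.left (.node f i ts c) = A ++ yd.left c := ⟨_, fun c => rfl⟩
    obtain ⟨B, hB⟩ : ∃ B, ∀ c, yd.right (.node f i ts c) = yd.right c ++ B :=
      ⟨_, fun c => List.append_assoc _ _ _⟩
    rcases hy with ⟨α, β, γ, hy⟩ | ⟨α, β, γ, hy⟩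
    · refine Or.inl ⟨A ++ α, β, γ ++ B, fun s' => ?_⟩
      rw [hA, hB, (hy s').1, (hy s').2]
      simp
    · refine Or.inr ⟨A ++ α, β, γ ++ B, fun s' => ?_⟩
      rw [hA, hB, (hy s').1, (hy s').2]
      simp
  · intro z
    obtain ⟨c, hc⟩ := he z
    obtain ⟨d, hd⟩ := h.edgeCount_image f z
    refine ⟨d + c + ∑ j ∈ Finset.univ.erase i,
      if hj : j = i then 0 else (h.tree (ts j hj)).edgeCount z, fun s' => ?_⟩
    rw [HRHom.ctx, hd, ← Finset.add_sum_erase _ _ (Finset.mem_univ i)]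
    have : ∀ j ∈ Finset.univ.erase i,
        (if hj : j = i then h.ctx (D' s') else h.tree (ts j hj)).edgeCount z =
        if hj : j = i then 0 else (h.tree (ts j hj)).edgeCount z := by
      intro j hj
      simp [Finset.ne_of_mem_erase hj]
    rw [Finset.sum_congr rfl this]
    simp only [dite_true, hc]
    omega

theorem isBeside_of_ne {f : Δ.Sym} {i i' : Fin (Δ.rank f)} (hi : i ≠ i')
    {ts : ∀ j : Fin (Δ.rank f), j ≠ i → RTree Δ} {ts' : ∀ j : Fin (Δ.rank f), j ≠ i' → RTree Δ}
    (heq : (Ctx.node f i ts C).plug s = (Ctx.node f i' ts' D).plug t) :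
    IsBeside yd h (.node f i ts C) s (.node f i' ts' D) t := by
  simp only [Ctx.plug, RTree.node.injEq, heq_eq_eq, true_and] at heq
  have hs : ts' i hi = C.plug s := by
    have := congrFun heq i
    simpa [hi] using this.symm
  have ht : ts i' hi.symm = D.plug t := by
    have := congrFun heq i'
    simpa [hi.symm] using this
  have hts : ∀ j (hj : j ≠ i) (hj' : j ≠ i'), ts j hj = ts' j hj' := by
    intro j hj hj'
    have := congrFun heq j
    simpa [hj, hj'] using this
  -- The context `D` keeps its hole below child `i'`; child `i` carries `C` with the exchanged
  -- subtree.
  refine ⟨fun s' => .node f i' (fun j hj => if j = i then C.plug s' else ts' j hj) D,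
    ?_, fun s' => ?_, ?_, fun z => ?_⟩
  · change Ctx.node f i' _ D = Ctx.node f i' ts' D
    congr 1
    funext j hj
    by_cases hji : j = i
    · subst hji
      simp [hs]
    · simp [hji]
  · simp only [Ctx.plug, RTree.node.injEq, heq_eq_eq, true_and]
    funext j
    by_cases hji : j = i
    · subst hji
      simp [hi]
    · by_cases hji' : j = i'
      · subst hji'
        simp [hji, ht]
      · simp [hji, hji', hts j hji hji']
  -- The order of the children `i` and `i'` decides whether the exchanged subtree contributes to the
  -- left or to the right of the hole.
  · rcases lt_or_gt_of_ne hi with hlt | hlt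
    · left
      obtain ⟨u, v, huv⟩ := exists_flatMap_update i fun j =>
        if hj : j < i' then yd.tree (ts' j hj.ne) ++ yd.pieces f j.succ else []
      have e : ∀ s', ((List.finRange (Δ.rank f)).flatMap fun j => if hj : j < i' then
          yd.tree (if j = i then C.plug s' else ts' j hj.ne) ++ yd.pieces f j.succ else []) =
          u ++ (yd.tree (C.plug s') ++ yd.pieces f i.succ) ++ v := by
        intro s'
        rw [← huv]
        refine List.flatMap_congr fun j _ => ?_
        by_cases hji : j = i
        · subst hji
          simp [hlt]
        · simp [hji]
      refine ⟨yd.pieces f 0 ++ (u ++ yd.left C), yd.right C ++ (yd.pieces f i.succ ++ (v ++ yd.left D)),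
        yd.right D ++ yd.pieces f i'.succ ++ (List.finRange (Δ.rank f)).flatMap fun j =>
          if hj : i' < j then yd.tree (ts' j hj.ne') ++ yd.pieces f j.succ else [],
        fun s' => ⟨?_, ?_⟩⟩
      · rw [ProjYield.left, e, yd.tree_plug]
        simp only [List.append_assoc]
      · rw [ProjYield.right]
        congr 1
        refine List.flatMap_congr fun j _ => ?_
        by_cases hj : i' < j
        · simp [hj, (hlt.trans hj).ne']
        · simp [hj]
    · right
      obtain ⟨u, v, huv⟩ := exists_flatMap_update i fun j =>
        if hj : i' < j then yd.tree (ts' j hj.ne') ++ yd.pieces f j.succ else []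
      have e : ∀ s', ((List.finRange (Δ.rank f)).flatMap fun j => if hj : i' < j then
          yd.tree (if j = i then C.plug s' else ts' j hj.ne') ++ yd.pieces f j.succ else []) =
          u ++ (yd.tree (C.plug s') ++ yd.pieces f i.succ) ++ v := by
        intro s'
        rw [← huv]
        refine List.flatMap_congr fun j _ => ?_
        by_cases hji : j = i
        · subst hji
          simp [hlt]
        · simp [hji]
      refine ⟨yd.pieces f 0 ++ ((List.finRange (Δ.rank f)).flatMap fun j =>
          if hj : j < i' then yd.tree (ts' j hj.ne) ++ yd.pieces f j.succ else []) ++ yd.left D,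
        yd.right D ++ (yd.pieces f i'.succ ++ (u ++ yd.left C)),
        yd.right C ++ (yd.pieces f i.succ ++ v), fun s' => ⟨?_, ?_⟩⟩
      · rw [ProjYield.left]
        congr 2
        refine List.flatMap_congr fun j _ => ?_
        by_cases hj : j < i'
        · simp [hj, (hj.trans hlt).ne]
        · simp [hj]
      · rw [ProjYield.right, e, yd.tree_plug]
        simp only [List.append_assoc]
  · obtain ⟨d, hd⟩ := h.edgeCount_image f z
    refine ⟨d + (h.ctx C).edgeCount z + ∑ j ∈ Finset.univ.erase i, (if hj : j = i' then h.ctx D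
      else h.tree (ts' j hj)).edgeCount z, fun s' => ?_⟩
    rw [HRHom.ctx, hd, ← Finset.add_sum_erase _ _ (Finset.mem_univ i)]
    have : ∀ j ∈ Finset.univ.erase i, (if hj : j = i' then h.ctx D else
        h.tree (if j = i then C.plug s' else ts' j hj)).edgeCount z =
        (if hj : j = i' then h.ctx D else h.tree (ts' j hj)).edgeCount z := by
      intro j hj
      simp [Finset.ne_of_mem_erase hj]
    rw [Finset.sum_congr rfl this]
    simp only [hi, dite_false, if_true, h.edgeCount_plug]
    omega

theorem below_or_above_or_beside (yd : ProjYield Δ) (h : HRHom Δ k L) (C : Ctx Δ) (s : RTree Δ)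
    (D : Ctx Δ) (t : RTree Δ) (heq : C.plug s = D.plug t) :
    (∃ D', D = C.comp D' ∧ s = D'.plug t) ∨ (∃ C', C = D.comp C' ∧ t = C'.plug s) ∨
      IsBeside yd h C s D t := by
  induction C generalizing D with
  | hole => exact Or.inl ⟨D, rfl, heq⟩
  | node f i ts c ih =>
    cases D with
    | hole => exact Or.inr (Or.inl ⟨_, rfl, heq.symm⟩)
    | node f' i' ts' d =>
      obtain rfl : f = f' := by
        simp only [Ctx.plug, RTree.node.injEq] at heq
        exact heq.1
      by_cases hi : i = i'
      · subst hi
        have heq' := heq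
        simp only [Ctx.plug, RTree.node.injEq, heq_eq_eq, true_and] at heq'
        have hc : c.plug s = d.plug t := by
          have := congrFun heq' i
          simpa using this
        have hts : ts = ts' := by
          funext j hj
          have := congrFun heq' j
          simpa [hj] using this
        subst hts
        rcases ih d hc with ⟨D', rfl, h2⟩ | ⟨C', rfl, h2⟩ | H
        · exact Or.inl ⟨D', rfl, h2⟩
        · exact Or.inr (Or.inl ⟨C', rfl, h2⟩)
        · exact Or.inr (Or.inr (H.node f i ts))
      · exact Or.inr (Or.inr (isBeside_of_ne hi heq))

end Beside

/-! ## One pumping step, seen from a context in the tree -/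

/-- The word `F.word 1` is `l m r`, where `l` and `r` are generated by a context with `e` edges
of a certain label; removing the pumped part leaves `l' m' r'` and `e'` edges. The pumped contexts
have `e₂` and `e₄` edges. There is one case for each position of the hole of the context. -/
inductive Located (F : PumpedFamily) (e₂ e₄ : ℕ) :
    List Token → List Token → List Token → ℕ → List Token → List Token → List Token → ℕ → Prop
  | left (α m r : List Token) (e : ℕ) (h : F.s₅ = α ++ (m ++ r)) :
      Located F e₂ e₄ (F.s₁ ++ (F.P₁ ++ (F.s₂ ++ (F.P₂ ++ (F.s₃ ++ (F.P₃ ++ (F.s₄ ++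
        (F.P₄ ++ α)))))))) m r (e + e₂ + e₄) (F.s₁ ++ (F.s₂ ++ (F.s₃ ++ (F.s₄ ++ α)))) m r e
  | right (l m α : List Token) (e : ℕ) (h : F.s₁ = l ++ (m ++ α)) :
      Located F e₂ e₄ l m (α ++ (F.P₁ ++ (F.s₂ ++ (F.P₂ ++ (F.s₃ ++ (F.P₃ ++ (F.s₄ ++
        (F.P₄ ++ F.s₅)))))))) (e + e₂ + e₄) l m (α ++ (F.s₂ ++ (F.s₃ ++ (F.s₄ ++ F.s₅)))) e
  | above (l α β r : List Token) (e : ℕ) (h : F.s₁ = l ++ α) (h' : F.s₅ = β ++ r) :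
      Located F e₂ e₄ l (α ++ (F.P₁ ++ (F.s₂ ++ (F.P₂ ++ (F.s₃ ++ (F.P₃ ++ (F.s₄ ++
        (F.P₄ ++ β)))))))) r e l (α ++ (F.s₂ ++ (F.s₃ ++ (F.s₄ ++ β)))) r e
  | outer (p p' q' q : List Token) (e d : ℕ) (h : F.P₁ = p ++ p') (h' : F.P₄ = q' ++ q)
      (hd : d ≤ e₂) :
      Located F e₂ e₄ (F.s₁ ++ p) (p' ++ (F.s₂ ++ (F.P₂ ++ (F.s₃ ++ (F.P₃ ++ (F.s₄ ++ q'))))))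
        (q ++ F.s₅) (e + d) F.s₁ (F.s₂ ++ (F.s₃ ++ F.s₄)) F.s₅ e
  | between (p p' q' q : List Token) (e : ℕ) (h : F.s₂ = p ++ p') (h' : F.s₄ = q' ++ q) :
      Located F e₂ e₄ (F.s₁ ++ (F.P₁ ++ p)) (p' ++ (F.P₂ ++ (F.s₃ ++ (F.P₃ ++ q'))))
        (q ++ (F.P₄ ++ F.s₅)) (e + e₂) (F.s₁ ++ p) (p' ++ (F.s₃ ++ q')) (q ++ F.s₅) e
  | inner (p p' q' q : List Token) (e d : ℕ) (h : F.P₂ = p ++ p') (h' : F.P₃ = q' ++ q)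
      (hd : d ≤ e₄) :
      Located F e₂ e₄ (F.s₁ ++ (F.P₁ ++ (F.s₂ ++ p))) (p' ++ (F.s₃ ++ q'))
        (q ++ (F.s₄ ++ (F.P₄ ++ F.s₅))) (e + e₂ + d) (F.s₁ ++ F.s₂) F.s₃ (F.s₄ ++ F.s₅) e
  | below (p m q : List Token) (e : ℕ) (h : F.s₃ = p ++ (m ++ q)) :
      Located F e₂ e₄ (F.s₁ ++ (F.P₁ ++ (F.s₂ ++ (F.P₂ ++ p)))) m
        (q ++ (F.P₃ ++ (F.s₄ ++ (F.P₄ ++ F.s₅)))) (e + e₂ + e₄) (F.s₁ ++ (F.s₂ ++ p)) m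
        (q ++ (F.s₄ ++ F.s₅)) e

namespace PumpedFamily

theorem word_zero (F : PumpedFamily) : F.word 0 = F.s₁ ++ (F.s₂ ++ (F.s₃ ++ (F.s₄ ++ F.s₅))) := by
  simp [word, iter]

theorem word_one (F : PumpedFamily) : F.word 1 = F.s₁ ++ (F.P₁ ++ (F.s₂ ++ (F.P₂ ++ (F.s₃ ++
    (F.P₃ ++ (F.s₄ ++ (F.P₄ ++ F.s₅))))))) := by
  simp [word, iter]

/-- Number of pumped tokens `p`. -/
def pumpedCount (F : PumpedFamily) (p : Token) : ℕ :=
  F.P₁.count p + F.P₂.count p + F.P₃.count p + F.P₄.count p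

def pumpedBars (F : PumpedFamily) : ℕ :=
  nBar F.P₁ + nBar F.P₂ + nBar F.P₃ + nBar F.P₄

/-- Length of the strings outside `s₁`, `s₃` and `s₅`. -/
def ctxLength (F : PumpedFamily) : ℕ :=
  F.P₁.length + F.s₂.length + F.P₂.length + F.P₃.length + F.s₄.length + F.P₄.length

theorem count_word_one (F : PumpedFamily) (p : Token) :
    (F.word 1).count p = (F.word 0).count p + F.pumpedCount p := by
  rw [count_word, one_mul, pumpedCount]

theorem notMem_of_pumpedCount_eq_zero {F : PumpedFamily} {p : Token} (h : F.pumpedCount p = 0) :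
    p ∉ F.P₁ ∧ p ∉ F.P₂ ∧ p ∉ F.P₃ ∧ p ∉ F.P₄ := by
  simp only [pumpedCount, Nat.add_eq_zero_iff, List.count_eq_zero] at h
  tauto

theorem mem_of_pumpedCount_pos {F : PumpedFamily} {p : Token} (h : 0 < F.pumpedCount p) :
    p ∈ F.P₁ ∨ p ∈ F.P₂ ∨ p ∈ F.P₃ ∨ p ∈ F.P₄ := by
  by_contra hc
  push Not at hc
  simp only [pumpedCount, List.count_eq_zero_of_not_mem hc.1,
    List.count_eq_zero_of_not_mem hc.2.1, List.count_eq_zero_of_not_mem hc.2.2.1,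
    List.count_eq_zero_of_not_mem hc.2.2.2] at h
  omega

theorem count_bar_le_nBar (y : Core) (w : List Token) : w.count (Token.bar y) ≤ nBar w := by
  rw [nBar_eq y]
  omega

theorem pumpedCount_bar_le (F : PumpedFamily) (y : Core) :
    F.pumpedCount (Token.bar y) ≤ F.pumpedBars := by
  have := count_bar_le_nBar y F.P₁
  have := count_bar_le_nBar y F.P₂
  have := count_bar_le_nBar y F.P₃
  have := count_bar_le_nBar y F.P₄
  unfold pumpedCount pumpedBars
  omega

theorem two_mul_pumpedBars_le {F : PumpedFamily} (hF : ∀ i, IsCrossSerial (F.word i)) :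
    2 * F.pumpedBars ≤ F.ctxLength := by
  have h := balanced hF
  have := two_mul_nBar_le_length (w := F.P₁ ++ (F.P₂ ++ (F.P₃ ++ F.P₄))) (by
    simp only [nR, List.count_append, nBar_append] at h ⊢
    omega)
  simp only [nBar_append, List.length_append] at this
  unfold ctxLength pumpedBars
  omega

end PumpedFamily

namespace Located

variable {F : PumpedFamily} {e₂ e₄ : ℕ} {l m r : List Token} {e : ℕ} {l' m' r' : List Token}
  {e' : ℕ}

theorem word_one (H : Located F e₂ e₄ l m r e l' m' r' e') : F.word 1 = l ++ m ++ r := by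
  rw [F.word_one]
  cases H <;> simp_all

theorem word_zero (H : Located F e₂ e₄ l m r e l' m' r' e') : F.word 0 = l' ++ m' ++ r' := by
  rw [F.word_zero]
  cases H <;> simp_all

theorem count_left_le (H : Located F e₂ e₄ l m r e l' m' r' e') (p : Token) :
    l'.count p ≤ l.count p := by
  cases H <;> (try simp only [List.count_append]) <;> omega

theorem count_right_le (H : Located F e₂ e₄ l m r e l' m' r' e') (p : Token) :
    r'.count p ≤ r.count p := by
  cases H <;> (try simp only [List.count_append]) <;> omega

theorem le_edges (H : Located F e₂ e₄ l m r e l' m' r' e') : e' ≤ e := by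
  cases H <;> omega

theorem edges_le (H : Located F e₂ e₄ l m r e l' m' r' e') : e ≤ e' + e₂ + e₄ := by
  cases H <;> omega

theorem count_le (H : Located F e₂ e₄ l m r e l' m' r' e') (p : Token) :
    l.count p + r.count p ≤ l'.count p + r'.count p + F.pumpedCount p := by
  unfold PumpedFamily.pumpedCount
  cases H <;> (try simp only [List.count_append, *]) <;> omega

end Located

open PumpedFamily in
/-- In a context without `y`, the tokens `x̄` outnumber the edges `x̄` by at most `l₀` for each
`x` in the string: one pumping step. -/
theorem bars_le_edges_step {F : PumpedFamily} (hF : ∀ i, IsCrossSerial (F.word i)) {x y : Core}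
    (hxy : ∀ w, IsCrossSerial w → w.count (Token.core x) = w.count (Token.core y))
    {e₂ e₄ e e' l₀ : ℕ} {l m r l' m' r' : List Token}
    (H : Located F e₂ e₄ l m r e l' m' r' e')
    (he : e₂ + e₄ = F.pumpedCount (Token.bar x)) (hl₀ : F.ctxLength ≤ l₀)
    (hl : Token.core y ∉ l) (hr : Token.core y ∉ r) (hy : Token.core y ∈ F.word 1)
    (ih : l'.count (Token.bar x) + r'.count (Token.bar x) ≤
      e' + (F.word 0).count (Token.core x) * l₀) :
    l.count (Token.bar x) + r.count (Token.bar x) ≤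
      e + (F.word 1).count (Token.core x) * l₀ := by
  have hle := H.count_le (Token.bar x)
  have hee := H.le_edges
  have hP : F.pumpedCount (Token.bar x) ≤ l₀ := by
    have := F.pumpedCount_bar_le x
    have := two_mul_pumpedBars_le hF
    omega
  rw [F.count_word_one, Nat.add_mul]
  rcases Nat.eq_zero_or_pos (F.pumpedCount (Token.core x)) with hk | hk
  swap
  -- If `x` is pumped, the allowance grows by at least `l₀`, which exceeds the number of pumped
  -- `x̄`.
  · have := Nat.le_mul_of_pos_left l₀ hk
    omega
  rw [hk, Nat.zero_mul]
  rcases Nat.eq_zero_or_pos (F.pumpedCount (Token.bar x)) with hb | hb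
  · omega
  have hky : F.pumpedCount (Token.core y) = 0 := by
    have h0 := hxy _ (hF 0)
    have h1 := hxy _ (hF 1)
    rw [F.count_word_one, F.count_word_one] at h1
    omega
  obtain ⟨x₁, x₂, x₃, x₄⟩ := notMem_of_pumpedCount_eq_zero hk
  obtain ⟨y₁, y₂, y₃, y₄⟩ := notMem_of_pumpedCount_eq_zero hky
  obtain ⟨b₁, b₄⟩ := inner_of_bar_pumped hF x₁ x₄
  have hb' : Token.bar x ∈ F.P₂ ∨ Token.bar x ∈ F.P₃ := by
    have := mem_of_pumpedCount_pos hb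
    tauto
  have hs₃ := core_notMem_s₃ hF x₂ x₃ hb' y
  -- Since the context has no `y`, the subtree at its hole contains all of them; this excludes holes
  -- inside `C₄` and `t₅`.
  have hm : Token.core y ∈ m := by
    rw [H.word_one] at hy
    simp only [List.mem_append] at hy
    tauto
  have c₁ := List.count_eq_zero_of_not_mem b₁
  have c₄ := List.count_eq_zero_of_not_mem b₄
  unfold pumpedCount at he
  cases H with
  -- With the pumped part beside the hole, the context gains equally many tokens `x̄` and edges
  -- `x̄`.
  | left α m r e h =>
    simp only [List.count_append] at ih ⊢
    omega
  | right l m α e h =>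
    simp only [List.count_append] at ih ⊢
    omega
  | above l α β r e h h' => omega
  -- With the hole in `C₂` or `C₃`, the context gains no `x̄`: those are pumped in `P₂` and `P₃`
  -- only.
  | outer p p' q' q e d h h' hd =>
    rw [h, List.count_append] at c₁
    rw [h', List.count_append] at c₄
    simp only [List.count_append] at ih ⊢
    omega
  | between p p' q' q e h h' =>
    simp only [List.count_append] at ih ⊢
    omega
  | inner p p' q' q e d h h' hd =>
    rw [h] at y₂
    rw [h'] at y₃
    simp only [List.mem_append] at hm y₂ y₃
    tauto
  | below p m q e h =>
    rw [h] at hs₃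
    simp only [List.mem_append] at hs₃
    tauto

/-! ### Counting edges in a context without `y` -/

/-- No letter after `y` occurs in `u`. -/
def NoLetterAfter (y : Core) (u : List Token) : Prop :=
  ∀ z : Core, y.idx < z.idx → Token.core z ∉ u

/-- The invariant for the number `e` of edges `ȳ` that a context without `y` generates. The
context is a part of a tree whose string is `u r`, where `r` is what the context generates on the
right; `A` is the product of `l₀` and the number of tokens `x`. -/
def EdgeBound (y : Core) (l₀ A e : ℕ) (u r : List Token) : Prop :=
  e ≤ A + barsAfterLast y (u ++ r) ∧
    (NoLetterAfter y u ∧ e + nBarNe y r ≤ A + nR r ∨ 2 * e ≤ 2 * A + l₀)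

theorem nBarNe_append (y : Core) (u v : List Token) :
    nBarNe y (u ++ v) = nBarNe y u + nBarNe y v :=
  List.countP_append

theorem nBarGt_append (y : Core) (u v : List Token) :
    nBarGt y (u ++ v) = nBarGt y u + nBarGt y v :=
  List.countP_append

namespace IsCrossSerial

/-- By alphabetical order a bar in `q` belongs to `y` or a later letter, and in the second case that
letter would occur in `u ++ q`. -/
theorem nBarNe_eq_zero {y : Core} {u q v : List Token} (hw : IsCrossSerial (u ++ (q ++ v)))
    (hy : Token.core y ∈ u) (hu : NoLetterAfter y (u ++ q)) : nBarNe y q = 0 := by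
  refine List.countP_eq_zero.2 fun p hp hne => ?_
  rcases p with z | z | _ | _ <;> simp only [Token.isBarNe, decide_eq_true_eq, reduceCtorEq] at hne
  have h1 : y.idx ≤ z.idx := hw.letters_sorted u (q ++ v) rfl _ hy (Token.bar z) (by simp [hp])
    y z rfl rfl
  rcases h1.lt_or_eq with h | h
  · exact hu z h (hw.core_of_bar (u ++ q) v (by simp) z (by simp [hp]))
  · exact hne (Core.idx_injective h).symm

theorem nR_add_nR {y : Core} {α u r : List Token}
    (hw : IsCrossSerial (α ++ Token.core y :: u ++ r)) : nR u + nR r = nBar u + nBar r := by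
  have h1 := hw.balanced_before_core α y (u ++ r) (by simp)
  have h2 := hw.balanced
  have e : α ++ Token.core y :: u ++ r = α ++ ([Token.core y] ++ (u ++ r)) := by simp
  rw [e] at h2
  simp only [nR, nL, List.count_append, nBar_append] at h1 h2 ⊢
  simp [Token.isBar] at h2
  omega

theorem nBar_le_nR {u r : List Token} (hw : IsCrossSerial (u ++ r)) : nBar r ≤ nR r := by
  have h1 := hw.prefix_le u r rfl
  have h2 := hw.balanced
  simp only [nR, nL, List.count_append, nBar_append] at h1 h2 ⊢
  omega

/-- From the last `y` to the end, closing brackets and bars are equally many, and the bars before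
`r` in this segment are all `ȳ`. Thus the second clause of `EdgeBound` implies the first in its left
alternative. -/
theorem nR_le {y : Core} {u r : List Token} (hw : IsCrossSerial (u ++ r))
    (hy : Token.core y ∈ u) (hr : Token.core y ∉ r) (hu : NoLetterAfter y u) :
    nR r ≤ nBarNe y r + barsAfterLast y (u ++ r) := by
  obtain ⟨α, v, rfl, hv⟩ := exists_last_of_mem hy
  have h1 := hw.nR_add_nR
  have h2 := IsCrossSerial.nBarNe_eq_zero (u := α ++ [Token.core y]) (q := v) (v := r) (y := y)
    (by simpa using hw) (by simp) (by simpa using hu)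
  rw [barsAfterLast_append_of_notMem hr, barsAfterLast_cons_of_notMem hv]
  rw [nBar_eq y v, nBar_eq y r, h2] at h1
  omega

theorem noLetterAfter_of_bar {y : Core} {u r : List Token} (hw : IsCrossSerial (u ++ r))
    (hb : Token.bar y ∈ r) : NoLetterAfter y u := by
  intro z hz hzu
  have := hw.letters_sorted u r rfl _ hzu _ hb z y rfl rfl
  omega

/-- Between the last `y` and a later `ȳ` everything belongs to one block, where no closing bracket
precedes an opening one. -/
theorem nR_eq_zero_of_lbr {y : Core} {α u v₁ v₂ v₃ : List Token}
    (hw : IsCrossSerial (α ++ Token.core y :: (u ++ (v₁ ++ Token.lbr :: (v₂ ++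
      Token.bar y :: v₃)))))
    (hu : Token.core y ∉ u) (h₁ : Token.core y ∉ v₁) (h₂ : Token.core y ∉ v₂) : nR u = 0 := by
  have hp := hw.phase_sorted (α ++ [Token.core y]) (u ++ (v₁ ++ Token.lbr :: v₂))
    (Token.bar y :: v₃) (by simp) (by
      intro z hz
      have ha := hw.letters_sorted (α ++ [Token.core y]) (u ++ (v₁ ++ Token.lbr :: v₂) ++
        Token.bar y :: v₃) (by simp) (Token.core y) (by simp) _
        (List.mem_append_left _ hz) y z rfl rfl
      have hb := hw.letters_sorted (α ++ [Token.core y] ++ (u ++ (v₁ ++ Token.lbr :: v₂)))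
        (Token.bar y :: v₃) (by simp) _ (List.mem_append_right _ hz) (Token.bar y) (by simp)
        z y rfl rfl
      obtain rfl := Core.idx_injective (le_antisymm ha hb)
      simp only [List.mem_append, List.mem_cons, reduceCtorEq, false_or] at hz
      tauto)
  refine List.count_eq_zero.2 fun hr => ?_
  have := (List.pairwise_append.1 hp).2.2 Token.rbr hr Token.lbr (by simp)
  simp [Token.phase] at this

/-- If `r` still opens a bracket before a `ȳ`, then no closing bracket lies between the last `y` and
`r`. All of them are in `r`, and the balance after the last `y` turns the first clause of the
invariant into the second. -/
theorem edgeBound_of_lbr_before_bar {y : Core} {l₀ A e : ℕ} {u r v₁ v₂ v₃ : List Token}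
    (hw : IsCrossSerial (u ++ r)) (hy : Token.core y ∈ u) (hr : Token.core y ∉ r)
    (h : r = v₁ ++ Token.lbr :: (v₂ ++ Token.bar y :: v₃))
    (he : e ≤ A + barsAfterLast y (u ++ r)) : EdgeBound y l₀ A e u r := by
  refine ⟨he, Or.inl ⟨hw.noLetterAfter_of_bar (by simp [h]), ?_⟩⟩
  obtain ⟨α, v, rfl, hv⟩ := exists_last_of_mem hy
  rw [barsAfterLast_append_of_notMem hr, barsAfterLast_cons_of_notMem hv] at he
  have hbal := hw.nR_add_nR
  have hz : nR v = 0 := by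
    rw [h] at hw hr
    refine IsCrossSerial.nR_eq_zero_of_lbr (α := α) (u := v) (v₁ := v₁) (v₂ := v₂) (v₃ := v₃)
      (y := y) (by simpa using hw) hv ?_ ?_ <;>
    · simp only [List.mem_append, List.mem_cons] at hr
      tauto
  have c1 := nBar_eq y v
  have c2 := nBar_eq y r
  omega

/-- A crude bound suffices for the invariant. -/
theorem edgeBound_of_le {y : Core} {l₀ A e : ℕ} {u r : List Token}
    (hw : IsCrossSerial (u ++ r)) (hr : Token.core y ∉ r)
    (he : e ≤ A + r.count (Token.bar y)) : EdgeBound y l₀ A e u r := by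
  refine ⟨?_, ?_⟩
  · rw [barsAfterLast_append_of_notMem hr]
    omega
  -- A `ȳ` in `r` rules out later letters in `u`, and a suffix has at least as many closing brackets
  -- as bars. Without `ȳ` in `r` the hypothesis is already `e ≤ A`.
  · by_cases hb : Token.bar y ∈ r
    · have := hw.nBar_le_nR
      rw [nBar_eq y r] at this
      exact Or.inl ⟨hw.noLetterAfter_of_bar hb, by omega⟩
    · rw [List.count_eq_zero_of_not_mem hb] at he
      exact Or.inr (by omega)

end IsCrossSerial

namespace PumpedFamily

theorem barsAfterLast_word_le {F : PumpedFamily} {y : Core} (h₁ : Token.core y ∉ F.P₁)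
    (h₂ : Token.core y ∉ F.P₂) (h₃ : Token.core y ∉ F.P₃) (h₄ : Token.core y ∉ F.P₄) :
    barsAfterLast y (F.word 0) ≤ barsAfterLast y (F.word 1) := by
  rw [F.word_zero, F.word_one]
  refine (barsAfterLast_insert h₁ _ _).1.trans ?_
  have a := (barsAfterLast_insert h₂ (F.s₁ ++ (F.P₁ ++ F.s₂)) (F.s₃ ++ (F.s₄ ++ F.s₅))).1
  have b := (barsAfterLast_insert h₃ (F.s₁ ++ (F.P₁ ++ (F.s₂ ++ (F.P₂ ++ F.s₃))))
    (F.s₄ ++ F.s₅)).1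
  have c := (barsAfterLast_insert h₄ (F.s₁ ++ (F.P₁ ++ (F.s₂ ++ (F.P₂ ++ (F.s₃ ++
    (F.P₃ ++ F.s₄)))))) F.s₅).1
  simp only [List.append_assoc] at a b c ⊢
  exact (a.trans b).trans c

/-- If `ȳ` but not `y` is pumped, then an opening bracket is pumped further left. -/
theorem exists_lbr_before_bar {F : PumpedFamily} (hF : ∀ i, IsCrossSerial (F.word i)) {y : Core}
    (h₂ : Token.core y ∉ F.P₂) (h₃ : Token.core y ∉ F.P₃)
    (hb : Token.bar y ∈ F.P₂ ∨ Token.bar y ∈ F.P₃) :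
    ∃ v₁ v₂ v₃, F.P₁ ++ (F.s₂ ++ (F.P₂ ++ (F.s₃ ++ (F.P₃ ++ (F.s₄ ++ (F.P₄ ++ F.s₅)))))) =
      v₁ ++ Token.lbr :: (v₂ ++ Token.bar y :: v₃) := by
  have p2 := prefix_two hF
  have p3 := prefix_three hF
  rcases hb with hb | hb
  · have hom := homogeneous hF (P := F.P₂) (by simp) hb h₂
    have hL : Token.lbr ∈ F.P₁ := List.count_pos_iff.1 (by
      simp only [nL] at p2 hom
      omega)
    obtain ⟨a, b, hab⟩ := List.append_of_mem hL
    obtain ⟨c, d, hcd⟩ := List.append_of_mem hb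
    exact ⟨a, b ++ (F.s₂ ++ c), d ++ (F.s₃ ++ (F.P₃ ++ (F.s₄ ++ (F.P₄ ++ F.s₅)))),
      by simp [hab, hcd]⟩
  · have hom := homogeneous hF (P := F.P₃) (by simp) hb h₃
    have hL : Token.lbr ∈ F.P₁ ++ (F.s₂ ++ F.P₂) := List.count_pos_iff.1 (by
      simp only [nL, List.count_append] at p3 hom ⊢
      omega)
    obtain ⟨a, b, hab⟩ := List.append_of_mem hL
    obtain ⟨c, d, hcd⟩ := List.append_of_mem hb
    refine ⟨a, b ++ (F.s₃ ++ c), d ++ (F.s₄ ++ (F.P₄ ++ F.s₅)), ?_⟩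
    have e : F.P₁ ++ (F.s₂ ++ (F.P₂ ++ (F.s₃ ++ (F.P₃ ++ (F.s₄ ++ (F.P₄ ++ F.s₅)))))) =
        (F.P₁ ++ (F.s₂ ++ F.P₂)) ++ (F.s₃ ++ (F.P₃ ++ (F.s₄ ++ (F.P₄ ++ F.s₅)))) := by simp
    rw [e, hab, hcd]
    simp

/-- A letter after `y` that was inserted before the string `r'`. -/
theorem nR_le_of_inserted {F : PumpedFamily} (hF : ∀ i, IsCrossSerial (F.word i)) {y z : Core}
    {u' r' α v : List Token} (h0 : F.word 0 = u' ++ r') (hu' : NoLetterAfter y u')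
    (h1 : F.word 1 = α ++ Token.core z :: v) (hz : y.idx < z.idx) (hv : nR r' ≤ nR v) :
    nR r' ≤ nBarNe y r' + F.pumpedBars := by
  have w0 := hF 0
  have w1 := hF 1
  have hbal : nR v = nBar v := by
    have a := w1.balanced_before_core α z v h1
    have b := w1.balanced
    rw [h1] at b
    have e : α ++ Token.core z :: v = α ++ ([Token.core z] ++ v) := by simp
    rw [e] at b
    simp only [nR, nL, List.count_append, nBar_append] at a b ⊢
    simp [Token.isBar] at b
    omega
  -- Every bar after `z` belongs to a letter after `y`. Before pumping such bars occurred only in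
  -- `r'`, so their number is known up to the pumped ones.
  have hgt : nBar v ≤ nBarGt y v := by
    apply List.countP_mono_left
    intro p hp hbar
    rcases p with z' | z' | _ | _ <;> simp only [Token.isBar, Bool.false_eq_true] at hbar
    have := w1.letters_sorted (α ++ [Token.core z]) v (by simp [h1]) (Token.core z) (by simp)
      (Token.bar z') hp z z' rfl rfl
    simp only [Token.isBarGt, decide_eq_true_eq]
    omega
  have hle : nBarGt y v ≤ nBarGt y (F.word 1) := by
    rw [h1]
    exact (((List.sublist_cons_self _ _).trans (List.sublist_append_right _ _))).countP_le
  have hle' : nBarGt y (F.word 1) ≤ nBarGt y (F.word 0) + F.pumpedBars := by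
    rw [F.word_zero, F.word_one]
    simp only [nBarGt_append]
    have a := nBarGt_le_nBar y F.P₁
    have b := nBarGt_le_nBar y F.P₂
    have c := nBarGt_le_nBar y F.P₃
    have d := nBarGt_le_nBar y F.P₄
    unfold pumpedBars
    omega
  have hu0 : nBarGt y u' = 0 := by
    refine List.countP_eq_zero.2 fun p hp hne => ?_
    rcases p with z' | z' | _ | _ <;>
      simp only [Token.isBarGt, decide_eq_true_eq, Bool.false_eq_true] at hne
    exact hu' z' hne (w0.core_of_bar u' r' h0 z' hp)
  have := nBarGt_le_nBarNe y r'
  rw [h0, nBarGt_append] at hle'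
  omega

end PumpedFamily

open PumpedFamily in
/-- The excess of the closing brackets on the right of a context does not decrease, unless it is
small. -/
theorem Located.excess_le {F : PumpedFamily} (hF : ∀ i, IsCrossSerial (F.word i)) {y : Core}
    {e₂ e₄ e e' : ℕ} {l m r l' m' r' : List Token} (H : Located F e₂ e₄ l m r e l' m' r' e')
    (hl : Token.core y ∉ l) (hr : Token.core y ∉ r) (hy : Token.core y ∈ F.word 1)
    (hu' : NoLetterAfter y (l' ++ m')) :
    (NoLetterAfter y (l ++ m) ∧ nR r' + nBarNe y r ≤ nR r + nBarNe y r') ∨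
      nR r' ≤ nBarNe y r' + F.pumpedBars := by
  have h0 := H.word_zero
  have h1 := H.word_one
  by_cases hu : NoLetterAfter y (l ++ m)
  swap
  · right
    unfold NoLetterAfter at hu
    push Not at hu
    obtain ⟨z, hz, hzu⟩ := hu
    obtain ⟨α, β, hαβ⟩ := List.append_of_mem hzu
    refine nR_le_of_inserted hF h0 hu' (z := z) (α := α) (v := β ++ r) (by simp [h1, hαβ]) hz ?_
    have := H.count_right_le Token.rbr
    simp only [nR, List.count_append]
    omega
  have w1 := hF 1
  have hyu : Token.core y ∈ l ++ m := by
    rw [h1] at hy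
    simp only [List.mem_append] at hy ⊢
    tauto
  -- When the hole cuts a pumped string, its right part `q` may contain bars without their closing
  -- brackets. Either all bars of `q` are `ȳ`, which the excess does not count, or `q` contains a
  -- letter after `y` and `nR_le_of_inserted` applies.
  have hstraddle : ∀ q s : List Token, r = q ++ s → nR r' ≤ nR s →
      nBarNe y q = 0 ∨ nR r' ≤ nBarNe y r' + F.pumpedBars := by
    intro q s hq hs
    by_cases huq : NoLetterAfter y (l ++ m ++ q)
    · left
      exact IsCrossSerial.nBarNe_eq_zero (u := l ++ m) (q := q) (v := s)
        (by rw [← hq, ← h1]; exact w1) hyu huq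
    · right
      unfold NoLetterAfter at huq
      push Not at huq
      obtain ⟨z, hz, hzu⟩ := huq
      rcases List.mem_append.1 hzu with hzu | hzu
      · exact absurd hzu (hu z hz)
      obtain ⟨α, β, hαβ⟩ := List.append_of_mem hzu
      refine nR_le_of_inserted hF h0 hu' (z := z) (α := l ++ m ++ α) (v := β ++ s)
        (by rw [h1, hq, hαβ]; simp) hz ?_
      simp only [nR, List.count_append] at hs ⊢
      omega
  have p1 := prefix_one hF
  have p2 := prefix_two hF
  have p3 := prefix_three hF
  have pb := balanced hF
  have n₁ := nBar_eq y F.P₁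
  have n₂ := nBar_eq y F.P₂
  have n₃ := nBar_eq y F.P₃
  have n₄ := nBar_eq y F.P₄
  cases H with
  | left α m r e h => exact Or.inl ⟨hu, by omega⟩
  | right l m α e h =>
    -- In a final part of the pumped strings the bars are at most as many as the closing brackets,
    -- so inserting it does not lower the excess.
    refine Or.inl ⟨hu, ?_⟩
    simp only [nR, nL, List.count_append, nBarNe_append] at p1 p2 p3 pb ⊢
    omega
  | above l α β r e h h' => exact Or.inl ⟨hu, by omega⟩
  | outer p p' q' q e d h h' hd =>
    refine (hstraddle q F.s₅ rfl le_rfl).imp (fun hq => ⟨hu, ?_⟩) id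
    simp only [nR, List.count_append, nBarNe_append]
    omega
  | between p p' q' q e h h' =>
    refine Or.inl ⟨hu, ?_⟩
    simp only [nR, nL, List.count_append, nBarNe_append] at p1 p2 p3 pb ⊢
    omega
  | inner p p' q' q e d h h' hd =>
    refine (hstraddle q (F.s₄ ++ (F.P₄ ++ F.s₅)) rfl ?_).imp (fun hq => ⟨hu, ?_⟩) id
    · simp only [nR, List.count_append]
      omega
    · simp only [nR, nL, List.count_append, nBarNe_append] at p1 p2 p3 pb ⊢
      omega
  | below p m q e h =>
    refine Or.inl ⟨hu, ?_⟩
    simp only [nR, nL, List.count_append, nBarNe_append] at p1 p2 p3 pb ⊢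
    omega

open PumpedFamily in
/-- The case where the hole of the context is between the pumped tokens `ȳ`. -/
theorem edgeBound_of_inside {F : PumpedFamily} (hF : ∀ i, IsCrossSerial (F.word i)) {y : Core}
    {l₀ A e : ℕ} {u r β : List Token} (hw : F.word 1 = u ++ r)
    (hu : u ++ β = F.s₁ ++ (F.P₁ ++ (F.s₂ ++ (F.P₂ ++ (F.s₃ ++ (F.P₃ ++ (F.s₄ ++ F.P₄)))))))
    (hu' : ∃ v, u = F.s₁ ++ (F.P₁ ++ (F.s₂ ++ v)))
    (hs₁ : Token.core y ∉ F.s₁) (h₁ : Token.core y ∉ F.P₁) (h₂ : Token.core y ∉ F.P₂)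
    (h₃ : Token.core y ∉ F.P₃) (hb : Token.bar y ∈ F.P₂ ∨ Token.bar y ∈ F.P₃)
    (hr : Token.core y ∉ r) (hl₀ : F.ctxLength ≤ l₀) (hA : l₀ ≤ A)
    (he : e ≤ (F.word 1).count (Token.bar y)) : EdgeBound y l₀ A e u r := by
  have w1 := hF 1
  obtain ⟨hy, hs₃, hopen⟩ := inside_of_bar_pumped hF hs₁ h₁ h₂ h₃ hb
  have hno : NoLetterAfter y u := by
    intro z hz hzu
    refine hopen z hz ?_
    rw [← hu]
    exact List.mem_append_left _ hzu
  obtain ⟨v, hv⟩ := hu'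
  obtain ⟨σ, τ, hs₂, hσ⟩ := List.eq_append_cons_of_mem hy
  have hyu : Token.core y ∈ u := by simp [hv, hy]
  -- No `ȳ` precedes the first `y`, so every `ȳ` of the word is counted in the balance after that
  -- `y`.
  have hα : Token.bar y ∉ F.s₁ ++ (F.P₁ ++ σ) := by
    intro h
    have := w1.core_of_bar (F.s₁ ++ (F.P₁ ++ σ)) (Token.core y :: (τ ++ (v ++ r)))
      (by simp [hw, hv, hs₂]) y h
    simp only [List.mem_append] at this
    tauto
  have hu2 : u = (F.s₁ ++ (F.P₁ ++ σ)) ++ Token.core y :: (τ ++ v) := by simp [hv, hs₂]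
  have hbal : nR (τ ++ v) + nR r = nBar (τ ++ v) + nBar r := by
    rw [hw, hu2] at w1
    exact w1.nR_add_nR
  -- Apart from `s₃`, which has no closing bracket, the part between the first `y` and the hole is
  -- generated by the small contexts `C₂`, `C₃`, `C₄`.
  have hlen : nR (τ ++ v) ≤ l₀ := by
    rw [hv] at hu
    simp only [List.append_assoc, List.append_cancel_left_eq] at hu
    have hc := congrArg nR hu
    have hs₂' := congrArg nR hs₂
    have a2 := List.count_le_length (a := Token.rbr) (l := F.s₂)
    have a3 := List.count_le_length (a := Token.rbr) (l := F.P₂)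
    have a4 := List.count_le_length (a := Token.rbr) (l := F.P₃)
    have a5 := List.count_le_length (a := Token.rbr) (l := F.s₄)
    have a6 := List.count_le_length (a := Token.rbr) (l := F.P₄)
    unfold ctxLength at hl₀
    simp only [nR, List.count_append, List.count_cons] at hc hs₂' hs₃ ⊢
    omega
  have hcount : (F.word 1).count (Token.bar y) ≤ nBar (τ ++ v) + r.count (Token.bar y) := by
    rw [hw, hu2, List.count_append, List.count_append, List.count_eq_zero_of_not_mem hα,
      List.count_cons]
    have := count_bar_le_nBar y (τ ++ v)
    simp only [beq_iff_eq, reduceCtorEq, if_false]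
    omega
  have hfin : e + nBarNe y r ≤ A + nR r := by
    have := nBar_eq y r
    omega
  refine ⟨?_, Or.inl ⟨hno, hfin⟩⟩
  have := IsCrossSerial.nR_le (hw ▸ w1) hyu hr hno
  omega

open PumpedFamily in
/-- The invariant is preserved by one pumping step. -/
theorem edgeBound_step {F : PumpedFamily} (hF : ∀ i, IsCrossSerial (F.word i)) {x y : Core}
    (hxy : ∀ w, IsCrossSerial w → w.count (Token.core x) = w.count (Token.core y))
    {e₂ e₄ e e' l₀ : ℕ} {l m r l' m' r' : List Token}
    (H : Located F e₂ e₄ l m r e l' m' r' e')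
    (he : e₂ + e₄ = F.pumpedCount (Token.bar y)) (hl₀ : F.ctxLength ≤ l₀)
    (hl : Token.core y ∉ l) (hr : Token.core y ∉ r) (hy : Token.core y ∈ F.word 1)
    (hle : e ≤ (F.word 1).count (Token.bar y))
    (ih : EdgeBound y l₀ ((F.word 0).count (Token.core x) * l₀) e' (l' ++ m') r') :
    EdgeBound y l₀ ((F.word 1).count (Token.core x) * l₀) e (l ++ m) r := by
  have w1 := hF 1
  have hw1 := H.word_one
  have hw0 := H.word_zero
  have hyu : Token.core y ∈ l ++ m := by
    rw [hw1] at hy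
    simp only [List.mem_append] at hy ⊢
    tauto
  have hx1 : l₀ ≤ (F.word 1).count (Token.core x) * l₀ := by
    refine Nat.le_mul_of_pos_left l₀ ?_
    rw [hxy _ w1]
    exact List.count_pos_iff.2 hy
  have hee := H.edges_le
  have hP := F.pumpedCount_bar_le y
  have hB := two_mul_pumpedBars_le hF
  have hex := H.excess_le hF hl hr hy
  have hnR : NoLetterAfter y (l ++ m) → nR r ≤ nBarNe y r + barsAfterLast y (l ++ m ++ r) :=
    fun hu => IsCrossSerial.nR_le (hw1 ▸ w1) hyu hr hu
  obtain ⟨ih1, ih2⟩ := ih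
  rcases Nat.eq_zero_or_pos (F.pumpedCount (Token.core x)) with hk | hk
  swap
  -- If `x` and `y` are pumped, the first clause of the induction hypothesis is useless, since the
  -- last `y` may be new. The second clause suffices: half of the additional `l₀` pays for the
  -- pumped edges and half for the slack.
  · have hA : (F.word 0).count (Token.core x) * l₀ + l₀ ≤
        (F.word 1).count (Token.core x) * l₀ := by
      rw [F.count_word_one, Nat.add_mul]
      have := Nat.le_mul_of_pos_left l₀ hk
      omega
    rcases ih2 with ⟨hu', h⟩ | h
    · rcases hex hu' with ⟨hu, h'⟩ | h'
      · have := hnR hu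
        exact ⟨by omega, Or.inl ⟨hu, by omega⟩⟩
      · exact ⟨by omega, Or.inr (by omega)⟩
    · exact ⟨by omega, Or.inr (by omega)⟩
  have hA : (F.word 1).count (Token.core x) = (F.word 0).count (Token.core x) := by
    rw [F.count_word_one, hk, Nat.add_zero]
  have hky : F.pumpedCount (Token.core y) = 0 := by
    have h0 := hxy _ (hF 0)
    have h1 := hxy _ (hF 1)
    rw [F.count_word_one, F.count_word_one] at h1
    omega
  obtain ⟨y₁, y₂, y₃, y₄⟩ := notMem_of_pumpedCount_eq_zero hky
  have hρ := barsAfterLast_word_le y₁ y₂ y₃ y₄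
  -- Without new edges the invariant survives: the `ȳ` after the last `y` do not decrease, and the
  -- excess drops only where the crude alternative takes over.
  have hsame : e ≤ e' →
      EdgeBound y l₀ ((F.word 1).count (Token.core x) * l₀) e (l ++ m) r := by
    intro hle'
    rw [hw0, hw1] at hρ
    rw [hA]
    refine ⟨by omega, ?_⟩
    rcases ih2 with ⟨hu', h⟩ | h
    · rcases hex hu' with ⟨hu, h'⟩ | h'
      · exact Or.inl ⟨hu, by omega⟩
      · exact Or.inr (by omega)
    · exact Or.inr (by omega)
  rcases Nat.eq_zero_or_pos (F.pumpedCount (Token.bar y)) with hb | hb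
  · exact hsame (by omega)
  obtain ⟨b₁, b₄⟩ := inner_of_bar_pumped hF y₁ y₄
  have hb' : Token.bar y ∈ F.P₂ ∨ Token.bar y ∈ F.P₃ := by
    clear ih1 ih2 hex hnR hsame
    have := mem_of_pumpedCount_pos hb
    tauto
  have hs₃ := core_notMem_s₃ hF y₂ y₃ hb' y
  have hm : Token.core y ∈ m := (List.mem_append.1 hyu).resolve_left hl
  clear hex hnR ih2
  cases H with
  -- The pumped `ȳ` would be to the left of the hole, and a `y` would have to precede them in `l`.
  | left α m r e h =>
    exfalso
    refine hl (w1.core_of_bar _ (m ++ r) (by rw [hw1]; simp only [List.append_assoc]) y ?_)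
    clear hsame
    simp only [List.mem_append]
    tauto
  -- The new edges `ȳ` are matched by new tokens `ȳ` after the last `y`, and the pumped opening
  -- bracket restores the second clause.
  | right l m α e h =>
    obtain ⟨v₁, v₂, v₃, hv⟩ := exists_lbr_before_bar hF y₂ y₃ hb'
    refine IsCrossSerial.edgeBound_of_lbr_before_bar (v₁ := α ++ v₁) (v₂ := v₂) (v₃ := v₃)
      (hw1 ▸ w1) hyu hr (by rw [hv]; simp) ?_
    rw [barsAfterLast_append_of_notMem (by
      clear ih1 hsame
      simp only [List.mem_append] at hr ⊢
      tauto)] at ih1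
    rw [barsAfterLast_append_of_notMem hr, hA]
    unfold pumpedCount at he
    simp only [List.count_append] at ih1 ⊢
    omega
  | above l α β r e h h' => exact hsame le_rfl
  | outer p p' q' q e d h h' hd =>
    have hs₁ : Token.core y ∉ F.s₁ := fun h => hl (List.mem_append_left _ h)
    exact edgeBound_of_inside hF (β := q) (by rw [hw1]) (by simp [h, h'])
      ⟨F.P₂ ++ (F.s₃ ++ (F.P₃ ++ (F.s₄ ++ q'))), by simp [h]⟩ hs₁ y₁ y₂ y₃ hb' hr hl₀ hx1 hle
  | between p p' q' q e h h' =>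
    have hs₁ : Token.core y ∉ F.s₁ := fun h => hl (List.mem_append_left _ h)
    exact edgeBound_of_inside hF (β := q ++ F.P₄) (by rw [hw1]) (by simp [h, h'])
      ⟨F.P₂ ++ (F.s₃ ++ (F.P₃ ++ q')), by simp [h]⟩ hs₁ y₁ y₂ y₃ hb' hr hl₀ hx1 hle
  | inner p p' q' q e d h h' hd =>
    exfalso
    clear hsame
    rw [h] at y₂
    rw [h'] at y₃
    simp only [List.mem_append] at hm y₂ y₃
    tauto
  | below p m q e h =>
    exfalso
    clear hsame
    rw [h] at hs₃
    simp only [List.mem_append] at hs₃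
    tauto

/-! ## Separations under pumping -/

section Pumping

variable {Δ : Signature} {k : ℕ} {L : Type} (yd : ProjYield Δ) (h : HRHom Δ k L)

theorem ProjYield.left_pump (C₂ C₃ C₄ : Ctx Δ) (i : ℕ) : yd.left (pump C₂ C₃ C₄ i) =
    iter (yd.left C₂) i ++ (yd.left C₃ ++ iter (yd.left C₄) i) := by
  induction i with
  | zero => simp [pump, iter]
  | succ i ih =>
    rw [pump, yd.left_comp, yd.left_comp, ih, iter_succ' (yd.left C₄), iter]
    simp only [List.append_assoc]

theorem ProjYield.right_pump (C₂ C₃ C₄ : Ctx Δ) (i : ℕ) : yd.right (pump C₂ C₃ C₄ i) =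
    iter (yd.right C₄) i ++ (yd.right C₃ ++ iter (yd.right C₂) i) := by
  induction i with
  | zero => simp [pump, iter]
  | succ i ih =>
    rw [pump, yd.right_comp, yd.right_comp, ih, iter_succ' (yd.right C₂), iter]
    simp only [List.append_assoc]

/-- The strings of the trees `C₁[vⁱ[t₅]]`, where `C₁` generates `s₁` and `s₅`. -/
def pumpedFamily (s₁ s₅ : List Token) (C₂ C₃ C₄ : Ctx Δ) (t₅ : RTree Δ) : PumpedFamily where
  s₁ := s₁
  P₁ := yd.left C₂
  s₂ := yd.left C₃
  P₂ := yd.left C₄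
  s₃ := yd.tree t₅
  P₃ := yd.right C₄
  s₄ := yd.right C₃
  P₄ := yd.right C₂
  s₅ := s₅

theorem pumpedFamily_word (s₁ s₅ : List Token) (C₂ C₃ C₄ : Ctx Δ) (t₅ : RTree Δ) (i : ℕ) :
    (pumpedFamily yd s₁ s₅ C₂ C₃ C₄ t₅).word i =
      s₁ ++ (yd.tree ((pump C₂ C₃ C₄ i).plug t₅) ++ s₅) := by
  rw [yd.tree_plug, yd.left_pump, yd.right_pump]
  simp only [PumpedFamily.word, pumpedFamily, List.append_assoc]

theorem pumpedFamily_ctxLength (s₁ s₅ : List Token) (C₂ C₃ C₄ : Ctx Δ) (t₅ : RTree Δ) :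
    (pumpedFamily yd s₁ s₅ C₂ C₃ C₄ t₅).ctxLength =
      (yd.ctx (C₂.comp (C₃.comp C₄))).length := by
  simp only [PumpedFamily.ctxLength, pumpedFamily, ProjYield.ctx, yd.left_comp, yd.right_comp,
    List.length_append]
  omega

/-- Where the hole of a context `D` in the tree `C₁[C₂[C₃[C₄[t₅]]]]` is. -/
theorem exists_located {C₁ C₂ C₃ C₄ : Ctx Δ} {t₅ : RTree Δ} {D : Ctx Δ} {t₀ : RTree Δ}
    (heq : C₁.plug (C₂.plug (C₃.plug (C₄.plug t₅))) = D.plug t₀) (z : L) :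
    ((∀ p, (yd.tree t₀).count p ≤ (yd.ctx (C₂.comp (C₃.comp C₄))).count p) ∧
      (h.tree t₀).edgeCount z ≤ (h.ctx (C₂.comp (C₃.comp C₄))).edgeCount z) ∨
    ∃ (F : PumpedFamily) (D' : Ctx Δ) (t₀' : RTree Δ),
      (∀ i, F.word i = yd.tree (C₁.plug ((pump C₂ C₃ C₄ i).plug t₅))) ∧
      F.ctxLength = (yd.ctx (C₂.comp (C₃.comp C₄))).length ∧
      C₁.plug (C₃.plug t₅) = D'.plug t₀' ∧
      Located F ((h.ctx C₂).edgeCount z) ((h.ctx C₄).edgeCount z)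
        (yd.left D) (yd.tree t₀) (yd.right D) ((h.ctx D).edgeCount z)
        (yd.left D') (yd.tree t₀') (yd.right D') ((h.ctx D').edgeCount z) := by
  have hF : ∀ i, (pumpedFamily yd (yd.left C₁) (yd.right C₁) C₂ C₃ C₄ t₅).word i =
      yd.tree (C₁.plug ((pump C₂ C₃ C₄ i).plug t₅)) := fun i => by
    rw [pumpedFamily_word, yd.tree_plug C₁]
  have hlen := pumpedFamily_ctxLength yd (yd.left C₁) (yd.right C₁) C₂ C₃ C₄ t₅
  -- A hole beside the spine of `C₂`, `C₃` or `C₄` means that `t₀` is a part of that context.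
  have hsub : ∀ C : Ctx Δ, (∀ p, (yd.ctx C).count p ≤ (yd.ctx (C₂.comp (C₃.comp C₄))).count p) →
      (h.ctx C).edgeCount z ≤ (h.ctx (C₂.comp (C₃.comp C₄))).edgeCount z →
      ∀ s D, IsBeside yd h C s D t₀ →
      (∀ p, (yd.tree t₀).count p ≤ (yd.ctx (C₂.comp (C₃.comp C₄))).count p) ∧
      (h.tree t₀).edgeCount z ≤ (h.ctx (C₂.comp (C₃.comp C₄))).edgeCount z :=
    fun C h1 h2 s D H => ⟨fun p => (H.count_le p).trans (h1 p), (H.edgeCount_le z).trans h2⟩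
  rcases below_or_above_or_beside yd h _ _ _ _ heq with ⟨D₁, rfl, heq₁⟩ | ⟨C', rfl, rfl⟩ | H
  rotate_left
  · refine Or.inr ⟨_, D, C'.plug (C₃.plug t₅), hF, hlen, by rw [Ctx.plug_comp], ?_⟩
    simp only [yd.tree_plug, List.append_assoc]
    exact Located.above (F := pumpedFamily yd (yd.left (D.comp C')) (yd.right (D.comp C'))
      C₂ C₃ C₄ t₅) (yd.left D) (yd.left C') (yd.right C') (yd.right D) _
      (yd.left_comp _ _) (yd.right_comp _ _)
  -- The whole pumped part is a subtree of `D` off the path to its hole, so `t₀` becomes part of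
  -- `s₅` or of `s₁`.
  · obtain ⟨D', rfl, hp, hy, he⟩ := H
    obtain ⟨c, hc⟩ := he z
    have hE : (h.ctx (D' (C₂.plug (C₃.plug (C₄.plug t₅))))).edgeCount z =
        (h.ctx (D' (C₃.plug t₅))).edgeCount z + (h.ctx C₂).edgeCount z +
          (h.ctx C₄).edgeCount z := by
      simp only [hc, h.edgeCount_plug]
      omega
    rcases hy with ⟨α, β, γ, hy⟩ | ⟨α, β, γ, hy⟩
    · refine Or.inr ⟨pumpedFamily yd α (β ++ (yd.tree t₀ ++ γ)) C₂ C₃ C₄ t₅, D' (C₃.plug t₅), t₀,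
        fun i => ?_, pumpedFamily_ctxLength yd _ _ C₂ C₃ C₄ t₅, hp _, ?_⟩
      · rw [pumpedFamily_word, hp, yd.tree_plug (D' _), (hy _).1, (hy _).2]
        simp only [List.append_assoc]
      · rw [hE, (hy _).1, (hy _).2, (hy _).1, (hy _).2]
        simp only [yd.tree_plug, List.append_assoc]
        exact Located.left (F := pumpedFamily yd α (β ++ (yd.tree t₀ ++ γ)) C₂ C₃ C₄ t₅)
          β (yd.tree t₀) γ _ rfl
    · refine Or.inr ⟨pumpedFamily yd (α ++ (yd.tree t₀ ++ β)) γ C₂ C₃ C₄ t₅, D' (C₃.plug t₅), t₀,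
        fun i => ?_, pumpedFamily_ctxLength yd _ _ C₂ C₃ C₄ t₅, hp _, ?_⟩
      · rw [pumpedFamily_word, hp, yd.tree_plug (D' _), (hy _).1, (hy _).2]
        simp only [List.append_assoc]
      · rw [hE, (hy _).1, (hy _).2, (hy _).1, (hy _).2]
        simp only [yd.tree_plug, List.append_assoc]
        exact Located.right (F := pumpedFamily yd (α ++ (yd.tree t₀ ++ β)) γ C₂ C₃ C₄ t₅)
          α (yd.tree t₀) β _ rfl
  rcases below_or_above_or_beside yd h _ _ _ _ heq₁ with ⟨D₂, rfl, heq₂⟩ | ⟨C', rfl, rfl⟩ | H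
  rotate_left
  · refine Or.inr ⟨_, C₁, C₃.plug t₅, hF, hlen, rfl, ?_⟩
    simp only [yd.tree_plug, yd.left_comp, yd.right_comp, h.edgeCount_comp, List.append_assoc]
    exact Located.outer (F := pumpedFamily yd (yd.left C₁) (yd.right C₁) (D₁.comp C') C₃ C₄ t₅)
      (yd.left D₁) (yd.left C') (yd.right C') (yd.right D₁) _ _
      (yd.left_comp _ _) (yd.right_comp _ _) (Nat.le_add_right _ _)
  · refine Or.inl (hsub _ (fun p => ?_) ?_ _ _ H)
    · simp only [ProjYield.ctx, yd.left_comp, yd.right_comp, List.count_append]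
      omega
    · simp only [h.edgeCount_comp]
      omega
  rcases below_or_above_or_beside yd h _ _ _ _ heq₂ with ⟨D₃, rfl, heq₃⟩ | ⟨C', rfl, rfl⟩ | H
  rotate_left
  · refine Or.inr ⟨_, C₁.comp D₂, C'.plug t₅, hF, hlen, by simp only [Ctx.plug_comp], ?_⟩
    have hE : (h.ctx (C₁.comp (C₂.comp D₂))).edgeCount z =
        (h.ctx (C₁.comp D₂)).edgeCount z + (h.ctx C₂).edgeCount z := by
      simp only [h.edgeCount_comp]
      omega
    rw [hE]
    simp only [yd.tree_plug, yd.left_comp, yd.right_comp, List.append_assoc]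
    exact Located.between (F := pumpedFamily yd (yd.left C₁) (yd.right C₁) C₂ (D₂.comp C') C₄ t₅)
      (yd.left D₂) (yd.left C') (yd.right C') (yd.right D₂) _
      (yd.left_comp _ _) (yd.right_comp _ _)
  · refine Or.inl (hsub _ (fun p => ?_) ?_ _ _ H)
    · simp only [ProjYield.ctx, yd.left_comp, yd.right_comp, List.count_append]
      omega
    · simp only [h.edgeCount_comp]
      omega
  rcases below_or_above_or_beside yd h _ _ _ _ heq₃ with ⟨D₄, rfl, rfl⟩ | ⟨C', rfl, rfl⟩ | H
  · refine Or.inr ⟨_, C₁.comp (C₃.comp D₄), t₀, hF, hlen, by simp only [Ctx.plug_comp], ?_⟩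
    have hE : (h.ctx (C₁.comp (C₂.comp (C₃.comp (C₄.comp D₄))))).edgeCount z =
        (h.ctx (C₁.comp (C₃.comp D₄))).edgeCount z + (h.ctx C₂).edgeCount z +
          (h.ctx C₄).edgeCount z := by
      simp only [h.edgeCount_comp]
      omega
    rw [hE]
    simp only [yd.left_comp, yd.right_comp, List.append_assoc]
    exact Located.below (F := pumpedFamily yd (yd.left C₁) (yd.right C₁) C₂ C₃ C₄ (D₄.plug t₀))
      (yd.left D₄) (yd.tree t₀) (yd.right D₄) _ (yd.tree_plug _ _)
  · refine Or.inr ⟨_, C₁.comp C₃, t₅, hF, hlen, by simp only [Ctx.plug_comp], ?_⟩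
    have hE : (h.ctx (C₁.comp (C₂.comp (C₃.comp D₃)))).edgeCount z =
        (h.ctx (C₁.comp C₃)).edgeCount z + (h.ctx C₂).edgeCount z +
          (h.ctx D₃).edgeCount z := by
      simp only [h.edgeCount_comp]
      omega
    rw [hE]
    simp only [yd.tree_plug, yd.left_comp, yd.right_comp, h.edgeCount_comp D₃, List.append_assoc]
    exact Located.inner (F := pumpedFamily yd (yd.left C₁) (yd.right C₁) C₂ C₃ (D₃.comp C') t₅)
      (yd.left D₃) (yd.left C') (yd.right C') (yd.right D₃) _ _
      (yd.left_comp _ _) (yd.right_comp _ _) (Nat.le_add_right _ _)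
  · refine Or.inl (hsub _ (fun p => ?_) ?_ _ _ H)
    · simp only [ProjYield.ctx, yd.left_comp, yd.right_comp, List.count_append]
      omega
    · simp only [h.edgeCount_comp]
      omega

variable {yd h} {T : Set (RTree Δ)} {p l₀ : ℕ}

/-- Induction along pumping decompositions: a property of the contexts without `y` in the trees
of `T` holds if it holds for small trees, for contexts whose complement is small, and if it is
preserved by insertion of pumped parts. -/
theorem context_induction (hp : IsPumpingHeight T p) (hl₀ : IsGenerationBound yd h p l₀)
    (hT : ∀ t ∈ T, IsCrossSerial (yd.tree t)) (y : Core) (z : L) (τ : Token)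
    (hedge : ∀ t ∈ T, (h.tree t).edgeCount z = (yd.tree t).count τ)
    (Q : List Token → List Token → List Token → ℕ → Prop)
    (hsmall : ∀ D t₀, D.plug t₀ ∈ T → D.height ≤ p → Token.core y ∉ yd.right D →
      Q (yd.left D) (yd.tree t₀) (yd.right D) ((h.ctx D).edgeCount z))
    (hside : ∀ D t₀, D.plug t₀ ∈ T → (yd.tree t₀).count τ ≤ l₀ →
      (h.tree t₀).edgeCount z ≤ l₀ → Token.core y ∉ yd.left D → Token.core y ∉ yd.right D →
      Q (yd.left D) (yd.tree t₀) (yd.right D) ((h.ctx D).edgeCount z))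
    (hstep : ∀ (F : PumpedFamily) (e₂ e₄ : ℕ) (l m r : List Token) (e : ℕ)
      (l' m' r' : List Token) (e' : ℕ), (∀ i, IsCrossSerial (F.word i)) →
      Located F e₂ e₄ l m r e l' m' r' e' → e₂ + e₄ = F.pumpedCount τ → F.ctxLength ≤ l₀ →
      Token.core y ∉ l → Token.core y ∉ r → e ≤ (F.word 1).count τ →
      Q l' m' r' e' → Q l m r e) :
    ∀ D t₀, D.plug t₀ ∈ T → Token.core y ∉ yd.left D → Token.core y ∉ yd.right D →
      Q (yd.left D) (yd.tree t₀) (yd.right D) ((h.ctx D).edgeCount z) := by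
  suffices H : ∀ n, ∀ D t₀, (D.plug t₀).nodes = n → D.plug t₀ ∈ T → Token.core y ∉ yd.left D →
      Token.core y ∉ yd.right D →
      Q (yd.left D) (yd.tree t₀) (yd.right D) ((h.ctx D).edgeCount z) from
    fun D t₀ => H _ D t₀ rfl
  intro n
  induction n using Nat.strong_induction_on with
  | _ n ih =>
  intro D t₀ hn ht hl hr
  rcases le_or_gt (D.plug t₀).height p with hht | hht
  · exact hsmall D t₀ ht ((D.height_le_height_plug t₀).trans hht) hr
  obtain ⟨C₁, C₂, C₃, C₄, t₅, heq, hCp, hpos, hpump⟩ := hp _ ht hht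
  have hbd := hl₀ _ hCp
  rcases exists_located yd h heq.symm z with ⟨h1, h2⟩ | ⟨F, D', t₀', hF, hlen, heq', hloc⟩
  · exact hside D t₀ ht ((h1 τ).trans (List.count_le_length.trans hbd.1))
      (h2.trans ((SGraph.edgeCount_le_size _ z).trans hbd.2)) hl hr
  have ht' : D'.plug t₀' ∈ T := by
    rw [← heq']
    exact hpump 0
  have hFc : ∀ i, IsCrossSerial (F.word i) := fun i => by
    rw [hF]
    exact hT _ (hpump i)
  have hnodes : (D'.plug t₀').nodes < n := by
    obtain ⟨n₁, -, h₁⟩ := RTree.nodes_plug C₁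
    obtain ⟨n₂, h₂', h₂⟩ := RTree.nodes_plug C₂
    obtain ⟨n₃, -, h₃⟩ := RTree.nodes_plug C₃
    obtain ⟨n₄, h₄', h₄⟩ := RTree.nodes_plug C₄
    rw [← hn, heq, ← heq']
    simp only [h₁, h₂, h₃, h₄]
    omega
  have w1 : F.word 1 = yd.tree (D.plug t₀) := by
    rw [hF, heq, pump, pump, Ctx.plug_comp, Ctx.plug_comp]
  have w0 : F.word 0 = yd.tree (D'.plug t₀') := by
    rw [hF, ← heq', pump]
  refine hstep F _ _ _ _ _ _ _ _ _ _ hFc hloc ?_ (hlen.le.trans hbd.1) hl hr ?_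
    (ih _ hnodes D' t₀' rfl ht' ?_ ?_)
  -- Edges and tokens agree in both trees, hence also in their difference, the pumped part.
  · have e1 := hedge _ ht
    have e0 := hedge _ ht'
    rw [← w1, F.count_word_one, heq] at e1
    rw [← w0, ← heq'] at e0
    simp only [h.edgeCount_plug] at e0 e1
    omega
  · rw [w1, ← hedge _ ht, h.edgeCount_plug]
    omega
  · have := hloc.count_left_le (Token.core y)
    rw [← List.count_eq_zero] at hl ⊢
    omega
  · have := hloc.count_right_le (Token.core y)
    rw [← List.count_eq_zero] at hr ⊢
    omega

/-- In a context without `y`, the tokens `x̄` outnumber the edges `x̄` by at most `l₀` for each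
`x` in the string. -/
theorem edgeCount_le_of_context (hp : IsPumpingHeight T p) (hl₀ : IsGenerationBound yd h p l₀)
    (hT : ∀ t ∈ T, IsCrossSerial (yd.tree t)) {x y : Core}
    (hxy : ∀ w, IsCrossSerial w → w.count (Token.core x) = w.count (Token.core y))
    (hy : ∀ w, IsCrossSerial w → Token.core y ∈ w) {z : L}
    (hedge : ∀ t ∈ T, (h.tree t).edgeCount z = (yd.tree t).count (Token.bar x))
    {D : Ctx Δ} {t₀ : RTree Δ} (ht : D.plug t₀ ∈ T) (hl : Token.core y ∉ yd.left D)
    (hr : Token.core y ∉ yd.right D) :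
    (h.tree t₀).edgeCount z ≤ (yd.tree t₀).count (Token.bar x) +
      (yd.tree (D.plug t₀)).count (Token.core x) * l₀ := by
  -- As `x` occurs at least once, the allowance is at least `l₀`, which settles the small cases.
  have hx : ∀ w, IsCrossSerial w → l₀ ≤ w.count (Token.core x) * l₀ := fun w hw =>
    Nat.le_mul_of_pos_left l₀ (by
      rw [hxy w hw]
      exact List.count_pos_iff.2 (hy w hw))
  have := context_induction hp hl₀ hT y z (Token.bar x) hedge
    (fun l m r e => l.count (Token.bar x) + r.count (Token.bar x) ≤
      e + (l ++ (m ++ r)).count (Token.core x) * l₀)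
    (fun D t₀ ht hD _ => by
      have h1 := List.count_le_length (a := Token.bar x) (l := yd.ctx D)
      have h2 := (hl₀ D hD).1
      have h3 := hx _ (hT _ ht)
      rw [yd.tree_plug] at h3
      rw [ProjYield.ctx, List.count_append] at h1
      rw [ProjYield.ctx] at h2
      omega)
    (fun D t₀ ht h1 h2 _ _ => by
      have h3 := hx _ (hT _ ht)
      have h4 := hedge _ ht
      rw [h.edgeCount_plug] at h4
      rw [yd.tree_plug] at h3 h4
      simp only [List.count_append] at h3 h4 ⊢
      omega)
    (fun F e₂ e₄ l m r e l' m' r' e' hF H he hlen hl hr _ ih => by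
      have w1 := H.word_one
      have w0 := H.word_zero
      rw [List.append_assoc] at w1 w0
      rw [← w0] at ih
      rw [← w1]
      exact bars_le_edges_step hF hxy H he hlen hl hr (hy _ (hF 1)) ih)
    D t₀ ht hl hr
  have h4 := hedge _ ht
  rw [h.edgeCount_plug, yd.tree_plug] at h4
  rw [yd.tree_plug]
  simp only [List.count_append] at h4 this ⊢
  omega

/-- The number of edges `ȳ` generated by a context without `y`. -/
theorem edgeCount_context_le (hp : IsPumpingHeight T p) (hl₀ : IsGenerationBound yd h p l₀)
    (hT : ∀ t ∈ T, IsCrossSerial (yd.tree t)) {x y : Core}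
    (hxy : ∀ w, IsCrossSerial w → w.count (Token.core x) = w.count (Token.core y))
    (hy : ∀ w, IsCrossSerial w → Token.core y ∈ w) {z : L}
    (hedge : ∀ t ∈ T, (h.tree t).edgeCount z = (yd.tree t).count (Token.bar y))
    {D : Ctx Δ} {t₀ : RTree Δ} (ht : D.plug t₀ ∈ T) (hl : Token.core y ∉ yd.left D)
    (hr : Token.core y ∉ yd.right D) :
    (h.ctx D).edgeCount z ≤ (yd.tree (D.plug t₀)).count (Token.core x) * l₀ +
      lastRun (Token.bar y) (yd.tree (D.plug t₀)) := by
  have hx : ∀ w, IsCrossSerial w → l₀ ≤ w.count (Token.core x) * l₀ := fun w hw =>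
    Nat.le_mul_of_pos_left l₀ (by
      rw [hxy w hw]
      exact List.count_pos_iff.2 (hy w hw))
  have := context_induction hp hl₀ hT y z (Token.bar y) hedge
    (fun l m r e => EdgeBound y l₀ ((l ++ m ++ r).count (Token.core x) * l₀) e (l ++ m) r)
    (fun D t₀ ht hD hr => by
      have h2 := (SGraph.edgeCount_le_size _ z).trans (hl₀ D hD).2
      have h3 := hT _ ht
      rw [yd.tree_plug, ← List.append_assoc] at h3
      have h4 := hx _ h3
      exact h3.edgeBound_of_le hr (by omega))
    (fun D t₀ ht h1 h2 hl hr => by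
      have h3 := hT _ ht
      have h4 := hedge _ ht
      rw [h.edgeCount_plug] at h4
      rw [yd.tree_plug, ← List.append_assoc] at h3 h4
      have h5 := hx _ h3
      -- A `ȳ` is preceded by a `y`, so the left part of `D` has none. The edges `ȳ` of `D` are then
      -- at most the `ȳ` of its right part plus the at most `l₀` tokens `ȳ` in `t₀`.
      have h6 : (yd.left D).count (Token.bar y) = 0 := List.count_eq_zero.2 fun hb =>
        hl (h3.core_of_bar (yd.left D) (yd.tree t₀ ++ yd.right D) (List.append_assoc _ _ _) y hb)
      refine h3.edgeBound_of_le hr ?_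
      simp only [List.count_append] at h4 h5 ⊢
      omega)
    (fun F e₂ e₄ l m r e l' m' r' e' hF H he hlen hl hr hle ih => by
      rw [← H.word_zero] at ih
      rw [← H.word_one]
      exact edgeBound_step hF hxy H he hlen hl hr (hy _ (hF 1)) hle ih)
    D t₀ ht hl hr
  rw [List.append_assoc, ← yd.tree_plug] at this
  have h1 := this.1
  rw [List.append_assoc, ← yd.tree_plug] at h1
  exact h1.trans (Nat.add_le_add_left ((hT _ ht).barsAfterLast_le_lastRun (hy _ (hT _ ht))) _)

end Pumping

/-! ## The pumping lemma for linear monadic context-free tree grammars -/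

namespace SForm

variable {Δ : Signature} {N₀ N₁ : Type}

theorem subst_var (r : SForm Δ N₀ N₁) : r.subst .var = r := by
  induction r with
  | var => rfl
  | term f ts ih => simp only [subst, ih]
  | nt0 A => rfl
  | nt1 B s ih => simp only [subst, ih]

theorem subst_of_varCount_eq_zero {r : SForm Δ N₀ N₁} (h : r.varCount = 0) (u : SForm Δ N₀ N₁) :
    r.subst u = r := by
  induction r with
  | var => simp [varCount] at h
  | term f ts ih =>
    simp only [varCount, Finset.sum_eq_zero_iff, Finset.mem_univ, true_implies] at h
    simp only [subst, ih _ (h _)]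
  | nt0 A => rfl
  | nt1 B s ih => simp only [subst, ih h]

/-- The subforms of a sentential form. -/
def subforms : SForm Δ N₀ N₁ → Set (SForm Δ N₀ N₁)
  | .var => {.var}
  | .term f ts => insert (.term f ts) (⋃ i, (ts i).subforms)
  | .nt0 A => {.nt0 A}
  | .nt1 B s => insert (.nt1 B s) s.subforms

theorem self_mem_subforms (r : SForm Δ N₀ N₁) : r ∈ r.subforms := by
  cases r <;> simp [subforms]

theorem finite_subforms (r : SForm Δ N₀ N₁) : r.subforms.Finite := by
  induction r with
  | var => exact Set.finite_singleton _
  | term f ts ih => exact (Set.finite_iUnion ih).insert _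
  | nt0 A => exact Set.finite_singleton _
  | nt1 B s ih => exact ih.insert _

theorem subforms_subset {r s : SForm Δ N₀ N₁} (h : s ∈ r.subforms) : s.subforms ⊆ r.subforms := by
  induction r with
  | var =>
    rw [subforms, Set.mem_singleton_iff] at h
    rw [h]
  | term f ts ih =>
    rw [subforms, Set.mem_insert_iff, Set.mem_iUnion] at h
    rcases h with rfl | ⟨i, hi⟩
    · exact subset_rfl
    · exact (ih i hi).trans ((Set.subset_iUnion (fun i => (ts i).subforms) i).trans
        (Set.subset_insert _ _))
  | nt0 A =>
    rw [subforms, Set.mem_singleton_iff] at h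
    rw [h]
  | nt1 B s ih =>
    rw [subforms, Set.mem_insert_iff] at h
    rcases h with rfl | h
    · exact subset_rfl
    · exact (ih h).trans (Set.subset_insert _ _)

end SForm

/-- A context with a sentential form at its hole. -/
def Ctx.fill {Δ : Signature} {N₀ N₁ : Type} : Ctx Δ → SForm Δ N₀ N₁ → SForm Δ N₀ N₁
  | .hole, u => u
  | .node f i ts c, u => .term f fun j => if hj : j = i then c.fill u else (ts j hj).toSForm

theorem Ctx.fill_comp {Δ : Signature} {N₀ N₁ : Type} (C C' : Ctx Δ) (u : SForm Δ N₀ N₁) :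
    (C.comp C').fill u = C.fill (C'.fill u) := by
  induction C with
  | hole => rfl
  | node f i ts c ih => simp only [comp, fill, ih]

theorem Ctx.fill_toSForm {Δ : Signature} {N₀ N₁ : Type} (C : Ctx Δ) (t : RTree Δ) :
    (C.fill t.toSForm : SForm Δ N₀ N₁) = (C.plug t).toSForm := by
  induction C with
  | hole => rfl
  | node f i ts c ih =>
    rw [fill, plug, RTree.toSForm, ih]
    congr 1
    funext j
    by_cases hj : j = i <;> simp [hj]

namespace LMCFTG

variable {Δ : Signature} (G : LMCFTG Δ)

/-- `G.Derives n s o`: the form `s` derives the object `o` by a derivation tree of height at most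
`n`. The object is a tree if the variable does not survive in the derivation, and a context, whose
hole stands for the variable, otherwise. -/
inductive Derives : ℕ → SForm Δ G.N₀ G.N₁ → RTree Δ ⊕ Ctx Δ → Prop
  | term (n : ℕ) (f : Δ.Sym) (ts : Fin (Δ.rank f) → SForm Δ G.N₀ G.N₁)
      (us : Fin (Δ.rank f) → RTree Δ) :
      (∀ i, Derives n (ts i) (.inl (us i))) → Derives (n + 1) (.term f ts) (.inl (.node f us))
  | nt0 (n : ℕ) (A : G.N₀) (r : SForm Δ G.N₀ G.N₁) (t : RTree Δ) : (A, r) ∈ G.rules₀ →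
      Derives n r (.inl t) → Derives (n + 1) (.nt0 A) (.inl t)
  | nt1 (n : ℕ) (B : G.N₁) (r s : SForm Δ G.N₀ G.N₁) (C : Ctx Δ) (t : RTree Δ) :
      (B, r) ∈ G.rules₁ → Derives n r (.inr C) → Derives n s (.inl t) →
      Derives (n + 1) (.nt1 B s) (.inl (C.plug t))
  | nt1Const (n : ℕ) (B : G.N₁) (r s : SForm Δ G.N₀ G.N₁) (t : RTree Δ) :
      (B, r) ∈ G.rules₁ → Derives n r (.inl t) → Derives (n + 1) (.nt1 B s) (.inl t)
  | var (n : ℕ) : Derives n .var (.inr .hole)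
  | termCtx (n : ℕ) (f : Δ.Sym) (ts : Fin (Δ.rank f) → SForm Δ G.N₀ G.N₁) (i : Fin (Δ.rank f))
      (us : ∀ j : Fin (Δ.rank f), j ≠ i → RTree Δ) (C : Ctx Δ) : Derives n (ts i) (.inr C) →
      (∀ j hj, Derives n (ts j) (.inl (us j hj))) →
      Derives (n + 1) (.term f ts) (.inr (.node f i us C))
  | nt1Ctx (n : ℕ) (B : G.N₁) (r s : SForm Δ G.N₀ G.N₁) (C C' : Ctx Δ) :
      (B, r) ∈ G.rules₁ → Derives n r (.inr C) → Derives n s (.inr C') →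
      Derives (n + 1) (.nt1 B s) (.inr (C.comp C'))

variable {G}

theorem Derives.succ {n : ℕ} {s : SForm Δ G.N₀ G.N₁} {o : RTree Δ ⊕ Ctx Δ}
    (h : G.Derives n s o) : G.Derives (n + 1) s o := by
  induction h with
  | term n f ts us _ ih => exact .term _ f ts us ih
  | nt0 n A r t hr _ ih => exact .nt0 _ A r t hr ih
  | nt1 n B r s C t hr _ _ ih ih' => exact .nt1 _ B r s C t hr ih ih'
  | nt1Const n B r s t hr _ ih => exact .nt1Const _ B r s t hr ih
  | var n => exact .var _
  | termCtx n f ts i us C _ _ ih ih' => exact .termCtx _ f ts i us C ih ih'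
  | nt1Ctx n B r s C C' hr _ _ ih ih' => exact .nt1Ctx _ B r s C C' hr ih ih'

theorem Derives.mono {n m : ℕ} {s : SForm Δ G.N₀ G.N₁} {o : RTree Δ ⊕ Ctx Δ}
    (h : G.Derives n s o) (hnm : n ≤ m) : G.Derives m s o := by
  induction hnm with
  | refl => exact h
  | step _ ih => exact ih.succ

/-- Height of a tree or a context. -/
def objHeight (o : RTree Δ ⊕ Ctx Δ) : ℕ :=
  o.elim RTree.height Ctx.height

/-- The height can double at each level, because a rank-1 nonterminal places one derived object on
top of another. -/
theorem Derives.height_lt {n : ℕ} {s : SForm Δ G.N₀ G.N₁} {o : RTree Δ ⊕ Ctx Δ}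
    (h : G.Derives n s o) : objHeight o < 2 ^ n := by
  induction h with
  | term n f ts us _ ih =>
    have : (Finset.univ.sup fun i => (us i).height) < 2 ^ n :=
      (Finset.sup_lt_iff (Nat.two_pow_pos n)).2 fun i _ => ih i
    simp only [objHeight, Sum.elim_inl, RTree.height, pow_succ]
    omega
  | nt0 n A r t hr _ ih =>
    rw [pow_succ]
    omega
  | nt1 n B r s C t hr _ _ ih ih' =>
    simp only [objHeight, Sum.elim_inl, Sum.elim_inr, pow_succ] at ih ih' ⊢
    have := C.height_plug_le t
    omega
  | nt1Const n B r s t hr _ ih =>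
    rw [pow_succ]
    simp only [objHeight, Sum.elim_inl] at ih ⊢
    omega
  | var n => exact Nat.two_pow_pos n
  | termCtx n f ts i us C _ _ ih ih' =>
    have : (Finset.univ.sup fun j => if hj : j = i then C.height else (us j hj).height) < 2 ^ n :=
      (Finset.sup_lt_iff (Nat.two_pow_pos n)).2 fun j _ => by
        by_cases hj : j = i
        · simpa [hj, objHeight] using ih
        · simpa [hj, objHeight] using ih' j hj
    simp only [objHeight, Sum.elim_inr, Ctx.height, pow_succ]
    omega
  | nt1Ctx n B r s C C' hr _ _ ih ih' =>
    simp only [objHeight, Sum.elim_inr, pow_succ] at ih ih' ⊢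
    have := C.height_comp_le C'
    omega

variable (G) in
/-- The form `s` derives the object `o`. -/
def Derivable (s : SForm Δ G.N₀ G.N₁) (o : RTree Δ ⊕ Ctx Δ) : Prop :=
  ∃ n, G.Derives n s o

namespace Derivable

theorem exists_common {ι : Type*} [Finite ι] {s : ι → SForm Δ G.N₀ G.N₁}
    {o : ι → RTree Δ ⊕ Ctx Δ} (h : ∀ i, G.Derivable (s i) (o i)) :
    ∃ n, ∀ i, G.Derives n (s i) (o i) := by
  cases nonempty_fintype ι
  choose n hn using h
  exact ⟨Finset.univ.sup n, fun i => (hn i).mono (Finset.le_sup (Finset.mem_univ i))⟩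

theorem term {f : Δ.Sym} {ts : Fin (Δ.rank f) → SForm Δ G.N₀ G.N₁}
    {us : Fin (Δ.rank f) → RTree Δ} (h : ∀ i, G.Derivable (ts i) (.inl (us i))) :
    G.Derivable (.term f ts) (.inl (.node f us)) := by
  obtain ⟨n, hn⟩ := exists_common h
  exact ⟨_, .term n f ts us hn⟩

theorem nt0 {A : G.N₀} {r : SForm Δ G.N₀ G.N₁} {t : RTree Δ} (hr : (A, r) ∈ G.rules₀)
    (h : G.Derivable r (.inl t)) : G.Derivable (.nt0 A) (.inl t) := by
  obtain ⟨n, hn⟩ := h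
  exact ⟨_, .nt0 n A r t hr hn⟩

theorem nt1 {B : G.N₁} {r s : SForm Δ G.N₀ G.N₁} {C : Ctx Δ} {t : RTree Δ}
    (hr : (B, r) ∈ G.rules₁) (h : G.Derivable r (.inr C)) (h' : G.Derivable s (.inl t)) :
    G.Derivable (.nt1 B s) (.inl (C.plug t)) := by
  obtain ⟨n, hn⟩ := h
  obtain ⟨m, hm⟩ := h'
  exact ⟨_, .nt1 (max n m) B r s C t hr (hn.mono (le_max_left _ _)) (hm.mono (le_max_right _ _))⟩

theorem nt1Const {B : G.N₁} {r s : SForm Δ G.N₀ G.N₁} {t : RTree Δ} (hr : (B, r) ∈ G.rules₁)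
    (h : G.Derivable r (.inl t)) : G.Derivable (.nt1 B s) (.inl t) := by
  obtain ⟨n, hn⟩ := h
  exact ⟨_, .nt1Const n B r s t hr hn⟩

theorem nt1Ctx {B : G.N₁} {r s : SForm Δ G.N₀ G.N₁} {C C' : Ctx Δ}
    (hr : (B, r) ∈ G.rules₁) (h : G.Derivable r (.inr C)) (h' : G.Derivable s (.inr C')) :
    G.Derivable (.nt1 B s) (.inr (C.comp C')) := by
  obtain ⟨n, hn⟩ := h
  obtain ⟨m, hm⟩ := h'
  exact ⟨_, .nt1Ctx (max n m) B r s C C' hr (hn.mono (le_max_left _ _))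
    (hm.mono (le_max_right _ _))⟩

theorem termCtx {f : Δ.Sym} {ts : Fin (Δ.rank f) → SForm Δ G.N₀ G.N₁} {i : Fin (Δ.rank f)}
    {us : ∀ j : Fin (Δ.rank f), j ≠ i → RTree Δ} {C : Ctx Δ} (h : G.Derivable (ts i) (.inr C))
    (h' : ∀ j hj, G.Derivable (ts j) (.inl (us j hj))) :
    G.Derivable (.term f ts) (.inr (.node f i us C)) := by
  obtain ⟨n, hn⟩ := h
  obtain ⟨m, hm⟩ := exists_common (ι := {j // j ≠ i}) fun j => h' j.1 j.2
  exact ⟨_, .termCtx (max n m) f ts i us C (hn.mono (le_max_left _ _))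
    fun j hj => (hm ⟨j, hj⟩).mono (le_max_right _ _)⟩

end Derivable

/-! ### Derivability and rewriting -/

theorem steps_term {f : Δ.Sym} {ts us : Fin (Δ.rank f) → SForm Δ G.N₀ G.N₁}
    (h : ∀ i, Relation.ReflTransGen G.Step (ts i) (us i)) :
    Relation.ReflTransGen G.Step (.term f ts) (.term f us) := by
  have key : ∀ S : Finset (Fin (Δ.rank f)), Relation.ReflTransGen G.Step (.term f ts)
      (.term f fun i => if i ∈ S then us i else ts i) := by
    intro S
    induction S using Finset.induction_on with
    | empty => simpa using Relation.ReflTransGen.refl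
    | insert a S ha ih =>
      refine ih.trans ?_
      have hu : ∀ v, Relation.ReflTransGen G.Step (ts a) v → Relation.ReflTransGen G.Step
          (.term f fun i => if i ∈ S then us i else ts i)
          (.term f (Function.update (fun i => if i ∈ S then us i else ts i) a v)) := by
        intro v hv
        induction hv with
        | refl =>
          have : Function.update (fun i => if i ∈ S then us i else ts i) a (ts a) =
              fun i => if i ∈ S then us i else ts i := by
            rw [Function.update_eq_self_iff]
            simp [ha]
          rw [this]
        | @tail v w _ hvw ih =>
          refine ih.tail ?_
          have := Step.inTerm f (Function.update (fun i => if i ∈ S then us i else ts i) a v) a w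
            (by simpa using hvw)
          simpa using this
      convert hu _ (h a) using 2
      funext i
      by_cases hi : i = a
      · subst hi
        simp
      · simp [hi]
  simpa using key Finset.univ

theorem steps_fill (C : Ctx Δ) {u v : SForm Δ G.N₀ G.N₁} (h : Relation.ReflTransGen G.Step u v) :
    Relation.ReflTransGen G.Step (C.fill u) (C.fill v) := by
  induction C with
  | hole => exact h
  | node f i ts c ih =>
    refine steps_term fun j => ?_
    by_cases hj : j = i
    · simpa [hj] using ih
    · simpa [hj] using Relation.ReflTransGen.refl

theorem Derives.steps {n : ℕ} {s : SForm Δ G.N₀ G.N₁} {o : RTree Δ ⊕ Ctx Δ}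
    (h : G.Derives n s o) (u : SForm Δ G.N₀ G.N₁) :
    Relation.ReflTransGen G.Step (s.subst u) (o.elim RTree.toSForm fun C => C.fill u) := by
  induction h generalizing u with
  | term n f ts us _ ih => exact steps_term fun i => ih i u
  | nt0 n A r t hr _ ih =>
    refine Relation.ReflTransGen.head (Step.rule₀ A r hr) ?_
    have := ih .var
    rwa [SForm.subst_var] at this
  | nt1 n B r s C t hr _ _ ih ih' =>
    refine Relation.ReflTransGen.head (Step.rule₁ B r _ hr) ((ih _).trans ?_)
    simp only [Sum.elim_inr, Sum.elim_inl, ← Ctx.fill_toSForm]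
    exact steps_fill C (ih' u)
  | nt1Const n B r s t hr _ ih =>
    exact Relation.ReflTransGen.head (Step.rule₁ B r _ hr) (ih _)
  | var n => exact Relation.ReflTransGen.refl
  | termCtx n f ts i us C _ _ ih ih' =>
    refine steps_term fun j => ?_
    by_cases hj : j = i
    · subst hj
      simpa using ih u
    · simpa [hj] using ih' j hj u
  | nt1Ctx n B r s C C' hr _ _ ih ih' =>
    refine Relation.ReflTransGen.head (Step.rule₁ B r _ hr) ((ih _).trans ?_)
    simp only [Sum.elim_inr, Ctx.fill_comp]
    exact steps_fill C (ih' u)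

theorem derivable_toSForm (t : RTree Δ) : G.Derivable t.toSForm (.inl t) := by
  induction t with
  | node f ts ih => exact .term ih

/-- As the variable occurs at most once, a derivation from `r[s]` contains at most one derivation
from the inserted `s`. Cutting it out leaves a context. -/
theorem Derivable.of_subst {r : SForm Δ G.N₀ G.N₁} (hr : r.varCount ≤ 1)
    {s : SForm Δ G.N₀ G.N₁} {t : RTree Δ} (h : G.Derivable (r.subst s) (.inl t)) :
    G.Derivable r (.inl t) ∨ ∃ C t', G.Derivable r (.inr C) ∧ G.Derivable s (.inl t') ∧
      t = C.plug t' := by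
  induction r generalizing t with
  | var => exact Or.inr ⟨.hole, t, ⟨0, .var 0⟩, h, rfl⟩
  | nt0 A => exact Or.inl h
  | nt1 B r ih =>
    obtain ⟨n, h⟩ := h
    cases h with
    | nt1 n _ q _ C t' hq h1 h2 =>
      rcases ih hr ⟨_, h2⟩ with h3 | ⟨C', t'', h3, h4, rfl⟩
      · exact Or.inl (.nt1 hq ⟨_, h1⟩ h3)
      · exact Or.inr ⟨C.comp C', t'', .nt1Ctx hq ⟨_, h1⟩ h3, h4, (Ctx.plug_comp _ _ _).symm⟩
    | nt1Const n _ q _ _ hq h1 => exact Or.inl (.nt1Const hq ⟨_, h1⟩)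
  | term f ts ih =>
    by_cases h0 : (SForm.term f ts).varCount = 0
    · rw [SForm.subst_of_varCount_eq_zero h0] at h
      exact Or.inl h
    rw [SForm.varCount] at hr h0
    obtain ⟨i, -, hi⟩ := Finset.exists_ne_zero_of_sum_ne_zero h0
    have hother : ∀ j, j ≠ i → (ts j).varCount = 0 := by
      intro j hj
      have := Finset.add_le_sum (f := fun i => (ts i).varCount) (fun _ _ => Nat.zero_le _)
        (Finset.mem_univ i) (Finset.mem_univ j) hj.symm
      omega
    have hle : (ts i).varCount ≤ 1 :=
      (Finset.single_le_sum (f := fun i => (ts i).varCount) (fun _ _ => Nat.zero_le _)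
        (Finset.mem_univ i)).trans hr
    obtain ⟨n, h⟩ := h
    cases h with
    | term n _ _ us h1 =>
      have h2 : ∀ j, j ≠ i → G.Derivable (ts j) (.inl (us j)) := by
        intro j hj
        have : G.Derives n ((ts j).subst s) (.inl (us j)) := h1 j
        rw [SForm.subst_of_varCount_eq_zero (hother j hj)] at this
        exact ⟨_, this⟩
      rcases ih i hle ⟨_, h1 i⟩ with h3 | ⟨C, t', h3, h4, h5⟩
      · refine Or.inl (.term fun j => ?_)
        by_cases hj : j = i
        · rw [hj]
          exact h3
        · exact h2 j hj
      · refine Or.inr ⟨.node f i (fun j _ => us j) C, t', .termCtx h3 h2, h4, ?_⟩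
        rw [Ctx.plug]
        congr 1
        funext j
        by_cases hj : j = i
        · subst hj
          simp [h5]
        · simp [hj]

/-- Derivation trees absorb a rewriting step at their root side, so rewriting in any order is
captured by derivability. -/
theorem Derivable.of_step {s s' : SForm Δ G.N₀ G.N₁} (hs : G.Step s s') {t : RTree Δ}
    (h : G.Derivable s' (.inl t)) : G.Derivable s (.inl t) := by
  induction hs generalizing t with
  | rule₀ A r hr => exact .nt0 hr h
  | rule₁ B r s hr =>
    rcases Derivable.of_subst (G.linear₁ _ hr) h with h | ⟨C, t', h1, h2, rfl⟩
    · exact .nt1Const hr h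
    · exact .nt1 hr h1 h2
  | inTerm f ts i u _ ih =>
    obtain ⟨n, h⟩ := h
    cases h with
    | term n _ _ us h1 =>
      refine .term fun j => ?_
      by_cases hj : j = i
      · subst hj
        have := h1 j
        rw [Function.update_self] at this
        exact ih ⟨_, this⟩
      · have := h1 j
        rw [Function.update_of_ne hj] at this
        exact ⟨_, this⟩
  | inNt1 B s u _ ih =>
    obtain ⟨n, h⟩ := h
    cases h with
    | nt1 n _ q _ C t' hq h1 h2 => exact .nt1 hq ⟨_, h1⟩ (ih ⟨_, h2⟩)
    | nt1Const n _ q _ _ hq h1 => exact .nt1Const hq ⟨_, h1⟩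

theorem mem_language_iff {t : RTree Δ} :
    t ∈ G.language ↔ G.Derivable (.nt0 G.start) (.inl t) := by
  constructor
  · intro h
    exact Relation.ReflTransGen.head_induction_on
      (motive := fun s _ => G.Derivable s (.inl t)) h (derivable_toSForm t)
      fun hs _ ih => ih.of_step hs
  · rintro ⟨n, h⟩
    exact h.steps .var

/-! ### Paths in derivation trees -/

variable (G) in
/-- `o'` is derived from `s'` inside the derivation of `o` from `s`, and may be exchanged for
other objects derived from `s'`. -/
def Inside (s : SForm Δ G.N₀ G.N₁) (s' : SForm Δ G.N₀ G.N₁) :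
    RTree Δ ⊕ Ctx Δ → RTree Δ ⊕ Ctx Δ → Prop
  | .inl t, .inl t' => ∃ D : Ctx Δ, t = D.plug t' ∧
      ∀ u, G.Derivable s' (.inl u) → G.Derivable s (.inl (D.plug u))
  | .inl t, .inr C => ∃ (D : Ctx Δ) (u : RTree Δ), t = D.plug (C.plug u) ∧
      ∀ C', G.Derivable s' (.inr C') → G.Derivable s (.inl (D.plug (C'.plug u)))
  | .inr C, .inr C' => ∃ D E : Ctx Δ, C = D.comp (C'.comp E) ∧
      ∀ C'', G.Derivable s' (.inr C'') → G.Derivable s (.inr (D.comp (C''.comp E)))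
  -- A tree derived inside a context lies beside its hole, so the surrounding one-hole context `D`
  -- exists only once that hole is filled with some `v`.
  | .inr C, .inl t => ∀ v, ∃ D : Ctx Δ, C.plug v = D.plug t ∧
      ∀ u, G.Derivable s' (.inl u) → ∃ C'', G.Derivable s (.inr C'') ∧ C''.plug v = D.plug u

theorem Inside.refl_tree (s : SForm Δ G.N₀ G.N₁) (t : RTree Δ) :
    G.Inside s s (.inl t) (.inl t) :=
  ⟨.hole, rfl, fun _ h => h⟩

theorem Inside.refl_ctx (s : SForm Δ G.N₀ G.N₁) (C : Ctx Δ) : G.Inside s s (.inr C) (.inr C) :=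
  ⟨.hole, .hole, (Ctx.comp_hole C).symm, fun C' h => by
    rw [Ctx.comp_hole]
    exact h⟩

theorem Inside.trans_tree {s s' s'' : SForm Δ G.N₀ G.N₁} {t : RTree Δ} {o' o'' : RTree Δ ⊕ Ctx Δ}
    (h : G.Inside s s' (.inl t) o') (h' : G.Inside s' s'' o' o'') :
    G.Inside s s'' (.inl t) o'' := by
  rcases o' with t' | C'
  · obtain ⟨D, rfl, hD⟩ := h
    rcases o'' with t'' | C''
    · obtain ⟨E, rfl, hE⟩ := h'
      refine ⟨D.comp E, (Ctx.plug_comp _ _ _).symm, fun u hu => ?_⟩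
      rw [Ctx.plug_comp]
      exact hD _ (hE _ hu)
    · obtain ⟨E, v, rfl, hE⟩ := h'
      refine ⟨D.comp E, v, (Ctx.plug_comp _ _ _).symm, fun u hu => ?_⟩
      rw [Ctx.plug_comp]
      exact hD _ (hE _ hu)
  · obtain ⟨D, v, rfl, hD⟩ := h
    rcases o'' with t'' | C''
    · obtain ⟨E, hE, hE'⟩ := h' v
      refine ⟨D.comp E, by rw [Ctx.plug_comp, hE], fun u hu => ?_⟩
      obtain ⟨C'', h1, h2⟩ := hE' u hu
      rw [Ctx.plug_comp, ← h2]
      exact hD _ h1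
    · obtain ⟨E, E', rfl, hE⟩ := h'
      refine ⟨D.comp E, E'.plug v, by simp only [Ctx.plug_comp], fun u hu => ?_⟩
      have := hD _ (hE u hu)
      simpa only [Ctx.plug_comp] using this

theorem Inside.trans_ctx {s s' s'' : SForm Δ G.N₀ G.N₁} {C C' C'' : Ctx Δ}
    (h : G.Inside s s' (.inr C) (.inr C')) (h' : G.Inside s' s'' (.inr C') (.inr C'')) :
    G.Inside s s'' (.inr C) (.inr C'') := by
  obtain ⟨D, E, rfl, hD⟩ := h
  obtain ⟨D', E', rfl, hD'⟩ := h'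
  refine ⟨D.comp D', E'.comp E, by simp only [Ctx.comp_assoc], fun u hu => ?_⟩
  have := hD _ (hD' u hu)
  simpa only [Ctx.comp_assoc] using this

variable (G) in
/-- The start symbol and the subforms of the right-hand sides. -/
def allForms : Set (SForm Δ G.N₀ G.N₁) :=
  insert (.nt0 G.start) ((⋃ r ∈ G.rules₀, r.2.subforms) ∪ ⋃ r ∈ G.rules₁, r.2.subforms)

variable (G) in
theorem finite_allForms : G.allForms.Finite :=
  ((G.finite_rules₀.biUnion fun r _ => r.2.finite_subforms).union
    (G.finite_rules₁.biUnion fun r _ => r.2.finite_subforms)).insert _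

theorem rhs₀_mem_allForms {A : G.N₀} {r : SForm Δ G.N₀ G.N₁} (h : (A, r) ∈ G.rules₀) :
    r ∈ G.allForms :=
  Or.inr (Or.inl (Set.mem_biUnion h r.self_mem_subforms))

theorem rhs₁_mem_allForms {B : G.N₁} {r : SForm Δ G.N₀ G.N₁} (h : (B, r) ∈ G.rules₁) :
    r ∈ G.allForms :=
  Or.inr (Or.inr (Set.mem_biUnion h r.self_mem_subforms))

theorem subforms_subset_allForms {s : SForm Δ G.N₀ G.N₁} (h : s ∈ G.allForms) :
    s.subforms ⊆ G.allForms := by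
  rcases h with rfl | h | h
  · rw [SForm.subforms, Set.singleton_subset_iff]
    exact Or.inl rfl
  · obtain ⟨r, hr, h⟩ := Set.mem_iUnion₂.1 h
    exact fun u hu => Or.inr (Or.inl (Set.mem_biUnion hr (SForm.subforms_subset h hu)))
  · obtain ⟨r, hr, h⟩ := Set.mem_iUnion₂.1 h
    exact fun u hu => Or.inr (Or.inr (Set.mem_biUnion hr (SForm.subforms_subset h hu)))

theorem term_child_mem_allForms {f : Δ.Sym} {ts : Fin (Δ.rank f) → SForm Δ G.N₀ G.N₁}
    (h : SForm.term f ts ∈ G.allForms) (i : Fin (Δ.rank f)) : ts i ∈ G.allForms :=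
  subforms_subset_allForms h (Or.inr (Set.mem_iUnion.2 ⟨i, (ts i).self_mem_subforms⟩))

theorem nt1_child_mem_allForms {B : G.N₁} {s : SForm Δ G.N₀ G.N₁}
    (h : SForm.nt1 B s ∈ G.allForms) : s ∈ G.allForms :=
  subforms_subset_allForms h (Or.inr s.self_mem_subforms)

/-- In a derivation tree of minimal height `n + 2`, some subtree has minimal height `n + 1`. -/
theorem exists_inside {n : ℕ} {s : SForm Δ G.N₀ G.N₁} {o : RTree Δ ⊕ Ctx Δ} (hs : s ∈ G.allForms)
    (h : G.Derives (n + 2) s o) (h' : ¬ G.Derives (n + 1) s o) :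
    ∃ s' o', s' ∈ G.allForms ∧ G.Derives (n + 1) s' o' ∧ ¬ G.Derives n s' o' ∧
      G.Inside s s' o o' := by
  -- If every immediate subderivation could be lowered to height `n`, the same rule would derive `o`
  -- in height `n + 1`.
  by_contra hcon
  push Not at hcon
  refine h' ?_
  cases h with
  | term _ f ts us h1 =>
    refine .term n f ts us fun i => ?_
    by_contra hn
    refine hcon _ _ (term_child_mem_allForms hs i) (h1 i) hn
      ⟨.node f i (fun j _ => us j) .hole, ?_, fun u hu => ?_⟩
    · rw [Ctx.plug]
      congr 1
      funext j
      by_cases hj : j = i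
      · subst hj
        simp [Ctx.plug]
      · simp [hj]
    · refine Derivable.term fun j => ?_
      by_cases hj : j = i
      · subst hj
        simpa [Ctx.plug] using hu
      · simp only [hj, dite_false]
        exact ⟨_, h1 j⟩
  | nt0 _ A r t hr h1 =>
    refine .nt0 n A r t hr ?_
    by_contra hn
    exact hcon _ _ (rhs₀_mem_allForms hr) h1 hn ⟨.hole, rfl, fun u hu => .nt0 hr hu⟩
  | nt1 _ B r s C t hr h1 h2 =>
    refine .nt1 n B r s C t hr ?_ ?_
    · by_contra hn
      exact hcon _ _ (rhs₁_mem_allForms hr) h1 hn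
        (show G.Inside _ _ (.inl _) (.inr C) from
          ⟨.hole, t, rfl, fun C' hC' =>
            show G.Derivable _ (.inl (C'.plug t)) from .nt1 hr hC' ⟨_, h2⟩⟩)
    · by_contra hn
      exact hcon _ _ (nt1_child_mem_allForms hs) h2 hn ⟨C, rfl, fun u hu => .nt1 hr ⟨_, h1⟩ hu⟩
  | nt1Const _ B r s t hr h1 =>
    refine .nt1Const n B r s t hr ?_
    by_contra hn
    exact hcon _ _ (rhs₁_mem_allForms hr) h1 hn ⟨.hole, rfl, fun u hu => .nt1Const hr hu⟩
  | var => exact .var _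
  | termCtx _ f ts i us C h1 h2 =>
    refine .termCtx n f ts i us C ?_ fun j hj => ?_
    · by_contra hn
      refine hcon _ _ (term_child_mem_allForms hs i) h1 hn
        ⟨.node f i us .hole, .hole, ?_, fun C' hC' => ?_⟩
      · simp only [Ctx.comp, Ctx.comp_hole]
      · simp only [Ctx.comp, Ctx.comp_hole]
        exact .termCtx hC' fun j hj => ⟨_, h2 j hj⟩
    · by_contra hn
      -- The path leaves the spine at a sibling `j` of the hole's child `i`; the surrounding context
      -- has its hole at `j` and `C[v]` at `i`.
      refine hcon _ _ (term_child_mem_allForms hs j) (h2 j hj) hn fun v =>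
        ⟨.node f j (fun l hl => if hli : l = i then C.plug v else us l hli) .hole, ?_,
          fun u hu => ⟨.node f i (fun l hl => if l = j then u else us l hl) C,
            .termCtx ⟨_, h1⟩ fun l hl => ?_, ?_⟩⟩
      · simp only [Ctx.plug]
        congr 1
        funext l
        by_cases hli : l = i
        · subst hli
          simp [hj.symm]
        · by_cases hlj : l = j
          · subst hlj
            simp [hj]
          · simp [hli, hlj]
      · by_cases hlj : l = j
        · subst hlj
          simpa using hu
        · simp only [hlj, if_false]
          exact ⟨_, h2 l hl⟩
      · simp only [Ctx.plug]
        congr 1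
        funext l
        by_cases hli : l = i
        · subst hli
          simp [hj.symm]
        · by_cases hlj : l = j
          · subst hlj
            simp [hj]
          · simp [hli, hlj]
  | nt1Ctx _ B r s C C' hr h1 h2 =>
    refine .nt1Ctx n B r s C C' hr ?_ ?_
    · by_contra hn
      exact hcon _ _ (rhs₁_mem_allForms hr) h1 hn
        (show G.Inside _ _ (.inr _) (.inr C) from
          ⟨.hole, C', rfl, fun C'' hC'' =>
            show G.Derivable _ (.inr (C''.comp C')) from .nt1Ctx hr hC'' ⟨_, h2⟩⟩)
    · by_contra hn
      refine hcon _ _ (nt1_child_mem_allForms hs) h2 hn ⟨C, .hole, ?_, fun C'' hC'' => ?_⟩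
      · rw [Ctx.comp_hole]
      · rw [Ctx.comp_hole]
        exact .nt1Ctx hr ⟨_, h1⟩ hC''

/-- A path of minimal heights `N + 1, …, 1`. -/
theorem exists_path (N : ℕ) : ∀ {s : SForm Δ G.N₀ G.N₁} {o : RTree Δ ⊕ Ctx Δ}, s ∈ G.allForms →
    G.Derives (N + 1) s o → ¬ G.Derives N s o →
    ∃ (σ : ℕ → SForm Δ G.N₀ G.N₁) (ω : ℕ → RTree Δ ⊕ Ctx Δ), σ N = s ∧ ω N = o ∧
      (∀ i ≤ N, σ i ∈ G.allForms ∧ G.Derives (i + 1) (σ i) (ω i) ∧ ¬ G.Derives i (σ i) (ω i)) ∧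
      ∀ i < N, G.Inside (σ (i + 1)) (σ i) (ω (i + 1)) (ω i) := by
  induction N with
  | zero =>
    intro s o hs h h'
    refine ⟨fun _ => s, fun _ => o, rfl, rfl, fun i hi => ?_, fun i hi => absurd hi (by omega)⟩
    obtain rfl : i = 0 := by omega
    exact ⟨hs, h, h'⟩
  | succ N ih =>
    intro s o hs h h'
    obtain ⟨s', o', hs', h1, h2, h3⟩ := exists_inside hs h h'
    obtain ⟨σ, ω, rfl, rfl, hσ, hin⟩ := ih hs' h1 h2
    refine ⟨Function.update σ (N + 1) s, Function.update ω (N + 1) o, by simp, by simp,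
      fun i hi => ?_, fun i hi => ?_⟩
    · rcases Nat.lt_or_ge i (N + 1) with hlt | hge
      · rw [Function.update_of_ne (by omega), Function.update_of_ne (by omega)]
        exact hσ i (by omega)
      · obtain rfl : i = N + 1 := by omega
        simpa using ⟨hs, h, h'⟩
    · rw [Function.update_of_ne (a := i) (by omega), Function.update_of_ne (a := i) (by omega)]
      rcases Nat.lt_or_ge i N with hlt | hge
      · rw [Function.update_of_ne (by omega), Function.update_of_ne (by omega)]
        exact hin i hlt
      · obtain rfl : i = N := by omega
        simpa using h3

end LMCFTG

/-- In a long enough sequence of labels, some label occurs twice in marked places, or twice with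
no marked place from the first to the second occurrence. -/
theorem exists_repetition {S : Type*} [Finite S] (f : ℕ → S) (marked : ℕ → Prop) :
    ∃ i j, i < j ∧ j < (Nat.card S + 1) * (Nat.card S + 1) ∧ f i = f j ∧
      (marked i ∧ marked j ∨ ∀ m, i ≤ m → m ≤ j → ¬ marked m) := by
  cases nonempty_fintype S
  rw [Nat.card_eq_fintype_card]
  generalize hK : Fintype.card S = K
  have hcard : Fintype.card S < Fintype.card (Fin (K + 1)) := by
    rw [Fintype.card_fin]
    omega
  have pigeon : ∀ g : Fin (K + 1) → S, ∃ a b, a < b ∧ g a = g b := by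
    intro g
    obtain ⟨a, b, hab, h⟩ := Fintype.exists_ne_map_eq_of_card_lt g hcard
    rcases lt_or_gt_of_ne hab with h' | h'
    · exact ⟨a, b, h', h⟩
    · exact ⟨b, a, h', h.symm⟩
  -- There are `K + 1` blocks of `K + 1` places. A block without marks has a repetition inside;
  -- otherwise one marked place from each block gives `K + 1` labels, two of which agree.
  by_cases hb : ∃ b : Fin (K + 1), ∀ c < K + 1, ¬ marked (b * (K + 1) + c)
  · obtain ⟨b, hb⟩ := hb
    obtain ⟨c, c', hcc, h⟩ := pigeon fun c => f (b * (K + 1) + c)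
    refine ⟨b * (K + 1) + c, b * (K + 1) + c', by simpa using hcc, ?_, h, Or.inr fun m h1 h2 => ?_⟩
    · have h1 : (b : ℕ) * (K + 1) + (K + 1) ≤ (K + 1) * (K + 1) := by
        rw [← Nat.succ_mul]
        exact Nat.mul_le_mul_right _ b.2
      have := c'.2
      omega
    · have := c'.2
      have := hb (m - b * (K + 1)) (by omega)
      rwa [Nat.add_sub_cancel' (by omega)] at this
  · push Not at hb
    choose c hc hm using hb
    obtain ⟨b, b', hbb, h⟩ := pigeon fun b => f (b * (K + 1) + c b)
    have hlt : ∀ b b' : Fin (K + 1), b < b' →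
        (b : ℕ) * (K + 1) + c b < (b' : ℕ) * (K + 1) := by
      intro b b' hbb
      have h1 : (b : ℕ) * (K + 1) + (K + 1) ≤ b' * (K + 1) := by
        rw [← Nat.succ_mul]
        exact Nat.mul_le_mul_right _ hbb
      have := hc b
      omega
    refine ⟨_, _, (hlt b b' hbb).trans_le (Nat.le_add_right _ (c b')), ?_, h, Or.inl ⟨hm b, hm b'⟩⟩
    have h1 : (b' : ℕ) * (K + 1) + (K + 1) ≤ (K + 1) * (K + 1) := by
      rw [← Nat.succ_mul]
      exact Nat.mul_le_mul_right _ b'.2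
    have := hc b'
    omega

namespace LMCFTG

variable {Δ : Signature} (G : LMCFTG Δ)

/-- The pumping lemma. -/
theorem exists_isPumpingHeight : ∃ p, IsPumpingHeight G.language p := by
  have := G.finite_allForms.to_subtype
  set M := (Nat.card G.allForms + 1) * (Nat.card G.allForms + 1) with hM
  refine ⟨2 ^ M, fun t ht hht => ?_⟩
  have hder := mem_language_iff.1 ht
  classical
  obtain ⟨N, hN, hN'⟩ : ∃ N, G.Derives (N + 1) (.nt0 G.start) (.inl t) ∧
      ¬ G.Derives N (.nt0 G.start) (.inl t) := by
    have h0 : Nat.find hder ≠ 0 := by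
      intro h
      have := Nat.find_spec hder
      rw [h] at this
      cases this
    obtain ⟨N, hN⟩ := Nat.exists_eq_succ_of_ne_zero h0
    refine ⟨N, ?_, Nat.find_min hder (by omega)⟩
    have := Nat.find_spec hder
    rwa [hN] at this
  have hMN : M ≤ N := by
    by_contra hlt
    have h1 := (hN.mono (m := M) (by omega)).height_lt
    simp only [objHeight, Sum.elim_inl] at h1
    omega
  obtain ⟨σ, ω, hσN, hωN, hσ, hin⟩ := exists_path N (Or.inl rfl) hN hN'
  -- The truncation only makes the labelling total. The repetition is found at indices below `M ≤
  -- N`, that is, near the bottom of the path, so the repeated object is of height less than `2 ^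
  -- M`.
  have hσ' : ∀ i, σ (min i N) ∈ G.allForms := fun i => (hσ _ (min_le_right _ _)).1
  obtain ⟨i, j, hij, hjM, hlab, hmark⟩ := exists_repetition
    (fun i => (⟨σ (min i N), hσ' i⟩ : G.allForms)) fun i => (ω i).isLeft
  rw [← hM] at hjM
  rw [Subtype.mk.injEq, min_eq_left (by omega), min_eq_left (by omega)] at hlab
  have htree : ∀ b ≤ N, ∀ u, ω b = .inl u → ∀ a ≤ b,
      G.Inside (σ b) (σ a) (.inl u) (ω a) := by
    intro b hb u hu a ha
    induction ha using Nat.decreasingInduction with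
    | self =>
      rw [hu]
      exact Inside.refl_tree _ _
    | of_succ a ha ih => exact ih.trans_tree (hin a (by omega))
  -- Minimality of the heights along the path makes the two objects different, so that the pumped
  -- contexts are not both trivial.
  have hne : ω i ≠ ω j := by
    intro h
    refine (hσ j (by omega)).2.2 ?_
    rw [← hlab, ← h]
    exact (hσ i (by omega)).2.1.mono hij
  have hheight : objHeight (ω j) < 2 ^ M :=
    ((hσ j (by omega)).2.1.height_lt).trans_le (Nat.pow_le_pow_right (by omega) hjM)
  have htop := htree N le_rfl t hωN j (by omega)
  rw [hσN] at htop
  have hdi : G.Derivable (σ j) (ω i) := ⟨_, hlab ▸ (hσ i (by omega)).2.1⟩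
  -- Two trees give ordinary one-context pumping with trivial `C₃` and `C₄`. Two contexts give
  -- pumping on both sides; as all objects between them are contexts, the inner one lies on the
  -- spine of the outer one.
  rcases hmark with ⟨hi, hj⟩ | hmark
  · obtain ⟨u', hu'⟩ := Sum.isLeft_iff.1 hi
    obtain ⟨u, hu⟩ := Sum.isLeft_iff.1 hj
    have hji := htree j (by omega) u hu i hij.le
    rw [hlab, hu'] at hji
    rw [hu] at htop hheight
    rw [hu'] at hdi
    obtain ⟨D₁, rfl, hD₁⟩ := htop
    obtain ⟨D₂, rfl, hD₂⟩ := hji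
    refine ⟨D₁, D₂, .hole, .hole, u', rfl, ?_, ?_, fun m => mem_language_iff.2 (hD₁ _ ?_)⟩
    · simp only [Ctx.comp, Ctx.comp_hole]
      exact (D₂.height_le_height_plug u').trans hheight.le
    · refine Nat.add_pos_left (Ctx.height_pos ?_) _
      rintro rfl
      exact hne (hu'.trans hu.symm)
    · induction m with
      | zero => exact hdi
      | succ m ih =>
        rw [pump, Ctx.plug_comp, Ctx.comp_hole]
        exact hD₂ _ ih
  · have hctx : ∀ m, i ≤ m → m ≤ j → ∃ C, ω m = .inr C := by
      intro m h1 h2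
      have := hmark m h1 h2
      rw [Sum.not_isLeft] at this
      exact Sum.isRight_iff.1 this
    obtain ⟨C, hC⟩ := hctx j hij.le le_rfl
    obtain ⟨C', hC'⟩ := hctx i le_rfl hij.le
    have hji : ∀ a, a ≤ j → i ≤ a → G.Inside (σ j) (σ a) (ω j) (ω a) := by
      intro a ha
      induction ha using Nat.decreasingInduction with
      | self =>
        intro _
        rw [hC]
        exact Inside.refl_ctx _ _
      | of_succ a ha ih =>
        intro hia
        obtain ⟨Ca, hCa⟩ := hctx a hia (by omega)
        obtain ⟨Cb, hCb⟩ := hctx (a + 1) (by omega) (by omega)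
        have h1 := ih (by omega)
        have h2 := hin a (by omega)
        rw [hCb, hCa] at h2
        rw [hC, hCb] at h1
        rw [hC, hCa]
        exact h1.trans_ctx h2
    have hji := hji i hij.le le_rfl
    rw [hC, hC', hlab] at hji
    rw [hC] at htop hheight
    rw [hC'] at hdi
    obtain ⟨D₁, v, rfl, hD₁⟩ := htop
    obtain ⟨D, E, rfl, hDE⟩ := hji
    refine ⟨D₁, D, C', E, v, by simp only [Ctx.plug_comp], hheight.le, ?_,
      fun m => mem_language_iff.2 (hD₁ _ ?_)⟩
    · by_contra h0
      have hD : D = .hole := by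
        by_contra h
        have := Ctx.height_pos h
        omega
      have hE : E = .hole := by
        by_contra h
        have := Ctx.height_pos h
        omega
      subst hD hE
      rw [Ctx.comp_hole] at hC
      exact hne (hC'.trans hC.symm)
    · induction m with
      | zero => exact hdi
      | succ m ih => exact hDE _ ih

end LMCFTG

/-! ## Contexts of bounded height -/

/-- With finitely many symbols, each height admits finitely many trees, hence finitely many
contexts, and `l₀` can be taken as a maximum. -/
theorem RTree.finite_height_le {Δ : Signature} [Finite Δ.Sym] (n : ℕ) :
    {t : RTree Δ | t.height ≤ n}.Finite := by
  induction n with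
  | zero =>
    refine Set.Finite.subset Set.finite_empty fun t ht => ?_
    cases t
    simp [RTree.height] at ht
  | succ n ih =>
    refine (Set.finite_iUnion fun f : Δ.Sym =>
      (Set.Finite.pi' fun _ : Fin (Δ.rank f) => ih).image (RTree.node f)).subset ?_
    rintro ⟨f, ts⟩ ht
    refine Set.mem_iUnion.2 ⟨f, ts, fun i => ?_, rfl⟩
    have h1 := Finset.le_sup (f := fun i => (ts i).height) (Finset.mem_univ i)
    simp only [Set.mem_ofPred_eq, RTree.height] at ht h1 ⊢
    omega

theorem Ctx.finite_height_le {Δ : Signature} [Finite Δ.Sym] (n : ℕ) :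
    {C : Ctx Δ | C.height ≤ n}.Finite := by
  induction n with
  | zero =>
    refine Set.Finite.subset (Set.finite_singleton Ctx.hole) fun C hC => ?_
    cases C with
    | hole => rfl
    | node f i ts c => simp [Ctx.height] at hC
  | succ n ih =>
    refine ((Set.finite_singleton Ctx.hole).union (Set.finite_iUnion fun f : Δ.Sym =>
      Set.finite_iUnion fun i : Fin (Δ.rank f) =>
      ((Set.Finite.pi' fun _ : {j // j ≠ i} => RTree.finite_height_le (Δ := Δ) n).prod ih).image
        fun P => Ctx.node f i (fun j hj => P.1 ⟨j, hj⟩) P.2)).subset ?_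
    intro C hC
    cases C with
    | hole => exact Or.inl rfl
    | node f i ts c =>
      have h1 (j : Fin (Δ.rank f)) : (if hj : j = i then c.height else (ts j hj).height) ≤ n := by
        have := Finset.le_sup (f := fun j => if hj : j = i then c.height else (ts j hj).height)
          (Finset.mem_univ j)
        simp only [Set.mem_ofPred_eq, Ctx.height] at hC
        omega
      refine Or.inr (Set.mem_iUnion.2 ⟨f, Set.mem_iUnion.2 ⟨i, ⟨fun j => ts j.1 j.2, c⟩,
        ⟨fun j => ?_, ?_⟩, rfl⟩⟩)
      · simpa [j.2] using h1 j.1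
      · simpa using h1 i

theorem exists_isGenerationBound {Δ : Signature} [Finite Δ.Sym] {k : ℕ} {L : Type}
    (yd : ProjYield Δ) (h : HRHom Δ k L) (p : ℕ) : ∃ l, IsGenerationBound yd h p l := by
  obtain ⟨l, hl⟩ := ((Ctx.finite_height_le (Δ := Δ) p).image
    fun C => max (yd.ctx C).length (h.ctx C).size).bddAbove
  exact ⟨l, fun C hC => max_le_iff.1 (hl ⟨C, hC, rfl⟩)⟩

/-! ### Minimal separations and the two bounds -/

theorem exists_isMinimalSeparation {Δ : Signature} {yd : ProjYield Δ} {x y : Core} {l : ℕ}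
    {t : RTree Δ} (hs : IsSeparated yd x y l t) :
    ∃ (Dx D₀ : Ctx Δ) (ty : RTree Δ), IsMinimalSeparation yd x y l t Dx D₀ ty := by
  classical
  have hex : ∃ n, ∃ (Dx D₀ : Ctx Δ) (ty : RTree Δ), IsSeparation yd x y l t Dx D₀ ty ∧
      D₀.height = n := by
    obtain ⟨Dx, D₀, ty, h⟩ := hs
    exact ⟨_, Dx, D₀, ty, h, rfl⟩
  obtain ⟨Dx, D₀, ty, h, hn⟩ := Nat.find_spec hex
  refine ⟨Dx, D₀, ty, h, fun Dx' D₀' ty' h' => ?_⟩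
  rw [hn]
  exact Nat.find_min' hex ⟨Dx', D₀', ty', h', rfl⟩

theorem IsCrossSerial.count_eq_of_mem_sepPairs {w : List Token} (hw : IsCrossSerial w)
    {x y : Core} (hxy : (x, y) ∈ sepPairs) :
    w.count (.core x) = w.count (.core y) := by
  simp only [sepPairs, Set.mem_insert_iff, Set.mem_singleton_iff, Prod.mk.injEq] at hxy
  rcases hxy with ⟨rfl, rfl⟩ | ⟨rfl, rfl⟩ | ⟨rfl, rfl⟩ | ⟨rfl, rfl⟩
  · exact hw.count_a_c
  · exact hw.count_a_c.symm
  · exact hw.count_b_d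
  · exact hw.count_b_d.symm

theorem IsCrossSerial.core_mem {w : List Token} (hw : IsCrossSerial w) (z : Core) :
    Token.core z ∈ w := by
  rw [← List.count_pos_iff]
  have h1 := hw.count_a_pos
  have h2 := hw.count_b_pos
  have h3 := hw.count_a_c
  have h4 := hw.count_b_d
  cases z <;> omega

theorem lemma7 (Δ : Signature) [Finite Δ.Sym] (Λ : Type) (k : ℕ)
    (G : LMCFTG Δ) (yd : ProjYield Δ) (h : HRHom Δ k (Token ⊕ Λ))
    (hcsd : rel G yd h ⊆ csdPairs k Λ) :
    (∃ p l₀ : ℕ, IsPumpingHeight G.language p ∧ IsGenerationBound yd h p l₀) ∧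
    ∀ p l₀ : ℕ, IsPumpingHeight G.language p → IsGenerationBound yd h p l₀ →
      ∀ x y : Core, (x, y) ∈ sepPairs → ∀ t ∈ G.language,
        (∀ (Dx D₀ : Ctx Δ) (ty : RTree Δ), IsSeparation yd x y l₀ t Dx D₀ ty →
          (h.tree (D₀.plug ty)).edgeCount (Sum.inl (Token.bar x)) ≤
            (yd.tree (D₀.plug ty)).count (Token.bar x) +
              (yd.tree t).count (Token.core x) * l₀) ∧
        (IsSeparated yd x y l₀ t →
          ∃ (Dx D₀ : Ctx Δ) (ty : RTree Δ), IsMinimalSeparation yd x y l₀ t Dx D₀ ty ∧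
            ((yd.tree t).count (Token.bar y) : ℤ) -
                ((yd.tree t).count (Token.core x) : ℤ) * (l₀ : ℤ) -
                (lastRun (Token.bar y) (yd.tree t) : ℤ) ≤
              ((h.tree (D₀.plug ty)).edgeCount (Sum.inl (Token.bar y)) : ℤ)) := by
  have hpair (t : RTree Δ) (ht : t ∈ G.language) : (yd.tree t, h.tree t) ∈ csdPairs k Λ :=
    hcsd ⟨t, ht, rfl⟩
  have hT (t : RTree Δ) (ht : t ∈ G.language) : IsCrossSerial (yd.tree t) :=
    isCrossSerial_of_mem (hpair t ht).1
  have hnot {D : Ctx Δ} {y : Core} (h0 : (yd.ctx D).count (.core y) = 0) :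
      Token.core y ∉ yd.left D ∧ Token.core y ∉ yd.right D := by
    rw [List.count_eq_zero, ProjYield.ctx, List.mem_append, not_or] at h0
    exact h0
  refine ⟨?_, fun p l₀ hp hl₀ x y hxy t ht => ⟨?_, fun hs => ?_⟩⟩
  · obtain ⟨p, hp⟩ := G.exists_isPumpingHeight
    obtain ⟨l, hl⟩ := exists_isGenerationBound yd h p
    exact ⟨p, l, hp, hl⟩
  · rintro Dx D₀ ty ⟨rfl, h0, -, -⟩
    exact edgeCount_le_of_context hp hl₀ hT (fun w hw => hw.count_eq_of_mem_sepPairs hxy)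
      (fun w hw => hw.core_mem y) (fun t ht => ((hpair t ht).2 x).2) ht (hnot h0).1 (hnot h0).2
  -- Any minimal separation will do, since the bound on the edges `ȳ` holds for every context
  -- without `y`; the edges not in `Dx` are in `t₀`.
  · obtain ⟨Dx, D₀, ty, hmin⟩ := exists_isMinimalSeparation hs
    refine ⟨Dx, D₀, ty, hmin, ?_⟩
    obtain ⟨rfl, h0, -, -⟩ := hmin.1
    have h1 := edgeCount_context_le hp hl₀ hT (fun w hw => hw.count_eq_of_mem_sepPairs hxy)
      (fun w hw => hw.core_mem y) (fun t ht => ((hpair t ht).2 y).2) ht (hnot h0).1 (hnot h0).2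
    have h2 := h.edgeCount_plug Dx (D₀.plug ty) (.inl (.bar y))
    have h3 := ((hpair _ ht).2 y).2
    simp only at h3
    rw [← h3, h2]
    zify at h1
    push_cast
    linarith
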